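/- Conventions. A model category is complete and cocomplete. For a model category $M$ and a small category $D$, a projective model structure on $M^D$ is one whose weak equivalences and fibrations are objectwise; a projective-cofibration in $M^D$ is a map with the left lifting property against all objectwise acyclic fibrations, and it is acyclic if it is also an objectwise weak equivalence. Abstract bigluing data from a small category $C$ to a small category $D$ consists of functors $U:C^{op}\times D\to \mathrm{Set}$ and $W:D^{op}\times C\to\mathrm{Set}$ and maps $\alpha:U(c,d)\times W(d,c')\to C(c,c')$, natural in $c,c'$ and dinatural in $d$. Its collage is the category with objects $\mathrm{ob}\,C\sqcup\mathrm{ob}\,D$ and hom-sets $C(c,c')$, $U(c,d)$ from $c$ to $d$, $W(d,c)$ from $d$ to $c$, and $D(d,d')\sqcup\int^{c}W(d,c)\times U(c,d')$ from $d$ to $d'$, with the evident composition. Bistratified categories of height $\beta$ are defined by transfinite recursion: for height $0$, the empty category; for height $\beta+1$, up to isomorphism, the collages of abstract bigluing data from a bistratified category of height $\beta$ to a small category $D$, the objects of $D$ being given degree $\beta$ and $D$ being called the stratum $C_{=\beta}$ (a not necessarily full subcategory); for limit heights, the colimits of the resulting chains of full inclusions. Write $C_\delta$ for the full subcategory of objects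 of degree $<\delta$. For $A\in M^C$ ($M$ complete and cocomplete) let $M_\delta A$ and $L_\delta A$ be the right and left Kan extensions along $C_\delta\hookrightarrow C$ of $A|_{C_\delta}$; so $(M_\delta A)_x$ is the limit of $A|_{C_\delta}$ weighted by $C(x,-)$ and $(L_\delta A)_x$ is the colimit weighted by $C(-,x)$. There are canonical maps $L_\delta A\to A\to M_\delta A$. For $x$ of degree $\delta$ write $M_xA=(M_\delta A)_x$, $L_xA=(L_\delta A)_x$. Write $A_\delta=A|_{C_{=\delta}}$, and also $L_\delta A$ for its restriction to $C_{=\delta}$. For a class $R$ of right maps in $M$, call $A\to B$ in $M^C$ a c-Reedy $R$-map if $A_x\to M_xA\times_{M_xB}B_x$ is in $R$ for all $x\in C$, and a c-Reedy $L$-map if for all $\delta$ the map $L_\delta B\sqcup_{L_\delta A}A_\delta\to B_\delta$ in $M^{C_{=\delta}}$ has the left lifting property against all maps that are objectwise in $R$. A bistratified category $C$ is almost c-Reedy if for every object $x$, of degree $\beta$ say, (i) the map from $C(-,x)$, regarded as an object of $(\mathrm{Set}^{op})^{C_\beta}$, to the terminal object is a c-Reedy $R$-map, where $R$ consists of the opposites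 of injections, and (ii) $\emptyset\to C(x,-)$ is a c-Reedy $L$-map in $\mathrm{Set}^{C_\beta}$, where $R$ consists of the surjections. It is almost g-Reedy if moreover all strata $C_{=\delta}$ are groupoids. Theorem. Let $C$ be almost c-Reedy, and let $M$ be a model category such that each $M^{C_{=\delta}}$ has a projective model structure. Then $M^C$ has a model structure such that: - the weak equivalences are objectwise; - $A\to B$ is a fibration (resp. acyclic fibration) iff for all $x\in C$ the induced map $A_x\to M_xA\times_{M_xB}B_x$ is a fibration (resp. acyclic fibration) in $M$; - $A\to B$ is a cofibration (resp. acyclic cofibration) iff for all degrees $\delta$ the induced map $L_\delta B\sqcup_{L_\delta A}A_\delta\to B_\delta$ is a projective-cofibration (resp. acyclic projective-cofibration) in $M^{C_{=\delta}}$. If $C$ is almost g-Reedy, then moreover $A\to B$ is a cofibration (resp. acyclic cofibration) iff for all $x\in C$ the induced map $L_xB\sqcup_{L_xA}A_x\to B_x$ is a projective-cofibration (resp. acyclic projective-cofibration) in $M^{\mathrm{aut}(x)}$, where $\mathrm{aut}(x)$ is the automorphism group of $x$. -/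

import Mathlib

open CategoryTheory Limits Opposite HomotopicalAlgebra

universe v u w w'

/-- Abstract bigluing data from `C` to `D`: profunctors `U : D ⇸ C` and `W : C ⇸ D` together with
a map of profunctors `W ⊗_D U ⟶ C(-,-)`.  The latter is a family of maps
`U(c,d) × W(d,c') → C(c,c')`, natural in `c` and `c'` and balanced over `d`. -/
structure AbstractBigluingData (C D : Type v) [SmallCategory C] [SmallCategory D] where
  U : Cᵒᵖ ⥤ D ⥤ Type v
  W : Dᵒᵖ ⥤ C ⥤ Type v
  α {c : C} {d : D} {c' : C} :
    (U.obj (op c)).obj d → (W.obj (op d)).obj c' → (c ⟶ c')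
  α_left {c₁ c : C} {d : D} {c' : C} (f : c₁ ⟶ c)
    (a : (U.obj (op c)).obj d) (w : (W.obj (op d)).obj c') :
    α ((U.map f.op).app d a) w = f ≫ α a w
  α_right {c : C} {d : D} {c' c₁ : C} (a : (U.obj (op c)).obj d)
    (w : (W.obj (op d)).obj c') (g : c' ⟶ c₁) :
    α a ((W.obj (op d)).map g w) = α a w ≫ g
  α_middle {c : C} {d d' : D} {c' : C} (a : (U.obj (op c)).obj d) (h : d ⟶ d')
    (w : (W.obj (op d')).obj c') :
    α ((U.obj (op c)).map h a) w = α a ((W.map h.op).app c' w)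

namespace AbstractBigluingData

variable {C D : Type v} [SmallCategory C] [SmallCategory D] (P : AbstractBigluingData C D)

/-- The action of a morphism of `C` on `U(-,d)`. -/
def lc {c₁ c : C} {d : D} (f : c₁ ⟶ c) (a : (P.U.obj (op c)).obj d) :
    (P.U.obj (op c₁)).obj d := (P.U.map f.op).app d a

/-- The action of a morphism of `D` on `U(c,-)`. -/
def ld {c : C} {d d' : D} (a : (P.U.obj (op c)).obj d) (h : d ⟶ d') :
    (P.U.obj (op c)).obj d' := (P.U.obj (op c)).map h a

/-- The action of a morphism of `D` on `W(-,c)`. -/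
def wd {d₁ d : D} {c : C} (h : d₁ ⟶ d) (w : (P.W.obj (op d)).obj c) :
    (P.W.obj (op d₁)).obj c := (P.W.map h.op).app c w

/-- The action of a morphism of `C` on `W(d,-)`. -/
def wc {d : D} {c c' : C} (w : (P.W.obj (op d)).obj c) (f : c ⟶ c') :
    (P.W.obj (op d)).obj c' := (P.W.obj (op d)).map f w

@[simp] lemma lc_id {c : C} {d : D} (a : (P.U.obj (op c)).obj d) : P.lc (𝟙 c) a = a := by
  simp [lc]
@[simp] lemma lc_comp {c₂ c₁ c : C} {d : D} (f : c₂ ⟶ c₁) (g : c₁ ⟶ c)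
    (a : (P.U.obj (op c)).obj d) : P.lc (f ≫ g) a = P.lc f (P.lc g a) := by
  simp [lc]
@[simp] lemma ld_id {c : C} {d : D} (a : (P.U.obj (op c)).obj d) : P.ld a (𝟙 d) = a := by
  simp [ld]
@[simp] lemma ld_comp {c : C} {d d' d'' : D} (a : (P.U.obj (op c)).obj d) (h : d ⟶ d')
    (k : d' ⟶ d'') : P.ld a (h ≫ k) = P.ld (P.ld a h) k := by
  simp [ld]
@[simp] lemma ld_lc {c₁ c : C} {d d' : D} (f : c₁ ⟶ c) (a : (P.U.obj (op c)).obj d)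
    (h : d ⟶ d') : P.ld (P.lc f a) h = P.lc f (P.ld a h) := by
  simp [ld, lc]
@[simp] lemma wd_id {d : D} {c : C} (w : (P.W.obj (op d)).obj c) : P.wd (𝟙 d) w = w := by
  simp [wd]
@[simp] lemma wd_comp {d₂ d₁ d : D} {c : C} (h : d₂ ⟶ d₁) (k : d₁ ⟶ d)
    (w : (P.W.obj (op d)).obj c) : P.wd (h ≫ k) w = P.wd h (P.wd k w) := by
  simp [wd]
@[simp] lemma wc_id {d : D} {c : C} (w : (P.W.obj (op d)).obj c) : P.wc w (𝟙 c) = w := by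
  simp [wc]
@[simp] lemma wc_comp {d : D} {c c' c'' : C} (w : (P.W.obj (op d)).obj c) (f : c ⟶ c')
    (g : c' ⟶ c'') : P.wc w (f ≫ g) = P.wc (P.wc w f) g := by
  simp [wc]
@[simp] lemma wc_wd {d₁ d : D} {c c' : C} (h : d₁ ⟶ d) (w : (P.W.obj (op d)).obj c)
    (f : c ⟶ c') : P.wc (P.wd h w) f = P.wd h (P.wc w f) := by
  simp [wc, wd]
@[simp] lemma α_lc {c₁ c : C} {d : D} {c' : C} (f : c₁ ⟶ c) (a : (P.U.obj (op c)).obj d)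
    (w : (P.W.obj (op d)).obj c') : P.α (P.lc f a) w = f ≫ P.α a w := P.α_left f a w
@[simp] lemma α_wc {c : C} {d : D} {c' c₁ : C} (a : (P.U.obj (op c)).obj d)
    (w : (P.W.obj (op d)).obj c') (g : c' ⟶ c₁) : P.α a (P.wc w g) = P.α a w ≫ g :=
  P.α_right a w g
@[simp] lemma α_wd {c : C} {d d' : D} {c' : C} (a : (P.U.obj (op c)).obj d) (h : d ⟶ d')
    (w : (P.W.obj (op d')).obj c') : P.α a (P.wd h w) = P.α (P.ld a h) w :=
  (P.α_middle a h w).symm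

/-- The relation generating the equivalence relation that defines the coend
`(U ⊗_C W)(d,d')`. -/
inductive ThroughRel (d d' : D) :
    (Σ c : C, (P.W.obj (op d)).obj c × (P.U.obj (op c)).obj d') →
    (Σ c : C, (P.W.obj (op d)).obj c × (P.U.obj (op c)).obj d') → Prop
  | mk {c c' : C} (w : (P.W.obj (op d)).obj c) (k : c ⟶ c') (a : (P.U.obj (op c')).obj d') :
    ThroughRel d d' ⟨c', P.wc w k, a⟩ ⟨c, w, P.lc k a⟩

/-- The set `(U ⊗_C W)(d,d')`, the coend over `c` of `W(d,c) × U(c,d')`. -/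
def Through (d d' : D) : Type v := Quot (P.ThroughRel d d')

/-- The class of a pair `d → c → d'` in `(U ⊗_C W)(d,d')`. -/
def through {d d' : D} {c : C} (w : (P.W.obj (op d)).obj c) (a : (P.U.obj (op c)).obj d') :
    P.Through d d' := Quot.mk _ ⟨c, w, a⟩

lemma through_wc {d d' : D} {c c' : C} (w : (P.W.obj (op d)).obj c) (k : c ⟶ c')
    (a : (P.U.obj (op c')).obj d') : P.through (P.wc w k) a = P.through w (P.lc k a) :=
  Quot.sound ⟨w, k, a⟩

/-- The objects of the collage: the disjoint union of those of `C` and those of `D`. -/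
inductive Collage (P : AbstractBigluingData C D) : Type v
  | low (c : C) : Collage P
  | high (d : D) : Collage P

namespace Collage
variable {P}

/-- The hom-sets of the collage. -/
def Hom : P.Collage → P.Collage → Type v
  | low c, low c' => c ⟶ c'
  | low c, high d => (P.U.obj (op c)).obj d
  | high d, low c => (P.W.obj (op d)).obj c
  | high d, high d' => (d ⟶ d') ⊕ P.Through d d'

/-- Identities of the collage. -/
def id : (X : P.Collage) → Hom X X
  | low c => 𝟙 c
  | high d => Sum.inl (𝟙 d)

/-- Composition of the collage. -/
def comp : {X Y Z : P.Collage} → Hom X Y → Hom Y Z → Hom X Z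
  | low _, low _, low _, f, g => CategoryStruct.comp (obj := C) f g
  | low _, low _, high _, f, a => P.lc f a
  | low _, high _, low _, a, w => P.α a w
  | low _, high _, high _, a, Sum.inl h => P.ld a h
  | low _, high _, high _, a, Sum.inr q =>
      Quot.lift (fun t => P.lc (P.α a t.2.1) t.2.2) (by
        rintro _ _ ⟨w, k, b⟩
        exact (congrArg (fun f => P.lc f b) (P.α_wc a w k)).trans (P.lc_comp _ _ _)) q
  | high _, low _, low _, w, f => P.wc w f
  | high _, low _, high _, w, a => Sum.inr (P.through w a)
  | high _, high _, low _, Sum.inl h, w => P.wd h w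
  | high _, high _, low _, Sum.inr q, w =>
      Quot.lift (fun t => P.wc t.2.1 (P.α t.2.2 w)) (by
        rintro _ _ ⟨w', k, b⟩
        exact ((congrArg (P.wc w') (P.α_lc k b w)).trans (P.wc_comp _ _ _)).symm) q
  | high _, high _, high _, Sum.inl h, Sum.inl h' => Sum.inl (h ≫ h')
  | high _, high _, high _, Sum.inl h, Sum.inr q => Sum.inr
      (Quot.lift (fun t => P.through (P.wd h t.2.1) t.2.2)
        (by rintro _ _ ⟨w, k, b⟩; dsimp; rw [← wc_wd, through_wc]) q)
  | high _, high _, high _, Sum.inr q, Sum.inl h' => Sum.inr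
      (Quot.lift (fun t => P.through t.2.1 (P.ld t.2.2 h'))
        (by rintro _ _ ⟨w, k, b⟩; dsimp; rw [through_wc, ld_lc]) q)
  | high _, high _, high _, Sum.inr q, Sum.inr q' => Sum.inr
      (Quot.lift (fun t => Quot.lift (fun t' => P.through t.2.1 (P.lc (P.α t.2.2 t'.2.1) t'.2.2))
          (by rintro _ _ ⟨w, k, b⟩; simp) q')
        (by rintro _ _ ⟨w, k, b⟩; induction q' using Quot.ind
            dsimp; rw [through_wc]; simp) q)

@[elab_as_elim]
lemma through_ind {d d' : D} {m : P.Through d d' → Prop}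
    (h : ∀ {c : C} (w : (P.W.obj (op d)).obj c) (a : (P.U.obj (op c)).obj d'),
      m (P.through w a)) (q : P.Through d d') : m q := by
  rcases q with ⟨c, w, a⟩
  exact h w a

/-- The collage of abstract bigluing data. -/
instance : Category.{v} P.Collage where
  Hom := Hom
  id := id
  comp := comp
  id_comp {X Y} f := by
    rcases X with c | d <;> rcases Y with c' | d'
    · exact Category.id_comp (obj := C) f
    · exact P.lc_id f
    · exact P.wd_id f
    · rcases f with f | q
      · exact congrArg Sum.inl (Category.id_comp f)
      · induction q using through_ind with
        | h w a => exact congrArg (fun w => Sum.inr (P.through w a)) (P.wd_id w)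
  comp_id {X Y} f := by
    rcases X with c | d <;> rcases Y with c' | d'
    · exact Category.comp_id (obj := C) f
    · exact P.ld_id f
    · exact P.wc_id f
    · rcases f with f | q
      · exact congrArg Sum.inl (Category.comp_id f)
      · induction q using through_ind with
        | h w a => exact congrArg (fun a => Sum.inr (P.through w a)) (P.ld_id a)
  assoc {X Y Z T} f g h := by
    rcases X with x | x <;> rcases Y with y | y <;> rcases Z with z | z <;> rcases T with t | t
    · exact Category.assoc (obj := C) f g h
    · exact P.lc_comp f g h
    · exact P.α_lc f g h
    · rcases h with h | h
      · exact P.ld_lc f g h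
      · induction h using through_ind with
        | h w a => exact (congrArg (P.lc · a) (P.α_lc f g w)).trans (P.lc_comp _ _ _)
    · exact (P.α_wc f g h).symm
    · rfl
    · rcases g with g | g
      · exact (P.α_wd f g h).symm
      · induction g using through_ind with
        | h w a => exact (P.α_lc _ a h).trans (P.α_wc f w _).symm
    · rcases g with g | g <;> rcases h with h | h
      · exact (P.ld_comp f g h).symm
      · induction h using through_ind with
        | h w a => exact congrArg (P.lc · a) (P.α_wd f g w).symm
      · induction g using through_ind with
        | h w a => exact P.ld_lc _ a h
      · induction g using through_ind with
        | h w a => induction h using through_ind with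
          | h w' a' => exact (congrArg (P.lc · a') (P.α_lc _ a w')).trans (P.lc_comp _ _ _)
    · exact (P.wc_comp f g h).symm
    · exact congrArg Sum.inr (P.through_wc f g h)
    · rfl
    · rcases h with h | h
      · rfl
      · induction h using through_ind with
        | h w a => rfl
    · rcases f with f | f
      · exact P.wc_wd f g h
      · induction f using through_ind with
        | h w a => exact (P.wc_comp w _ h).symm.trans (congrArg (P.wc w) (P.α_wc a g h).symm)
    · rcases f with f | f
      · rfl
      · induction f using through_ind with
        | h w a => exact congrArg Sum.inr (P.through_wc w _ h)
    · rcases f with f | f <;> rcases g with g | g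
      · exact P.wd_comp f g h
      · induction g using through_ind with
        | h w a => exact P.wc_wd f w _
      · induction f using through_ind with
        | h w a => exact congrArg (P.wc w) (P.α_wd a g h).symm
      · induction f using through_ind with
        | h w a => induction g using through_ind with
          | h w' a' =>
            exact congrArg (P.wc w) ((P.α_lc _ a' h).trans (P.α_wc a w' _).symm)
    · rcases f with f | f <;> rcases g with g | g <;> rcases h with h | h
      · exact congrArg Sum.inl (Category.assoc f g h)
      · induction h using through_ind with
        | h w a => exact congrArg (fun w => Sum.inr (P.through w a)) (P.wd_comp f g w)
      · induction g using through_ind with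
        | h w a => rfl
      · induction g using through_ind with
        | h w a => induction h using through_ind with
          | h w' a' => rfl
      · induction f using through_ind with
        | h w a => exact congrArg (fun a => Sum.inr (P.through w a)) (P.ld_comp a g h).symm
      · induction f using through_ind with
        | h w a => induction h using through_ind with
          | h w' a' =>
            exact congrArg (fun k => Sum.inr (P.through w (P.lc k a'))) (P.α_wd a g w').symm
      · induction f using through_ind with
        | h w a => induction g using through_ind with
          | h w' a' => exact congrArg (fun a => Sum.inr (P.through w a)) (P.ld_lc _ a' h)
      · induction f using through_ind with
        | h w a => induction g using through_ind with
          | h w' a' => induction h using through_ind with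
            | h w'' a'' =>
              exact congrArg (fun a => Sum.inr (P.through w a))
                ((congrArg (P.lc · a'') (P.α_lc _ a' w'')).trans (P.lc_comp _ _ _))
end Collage
end AbstractBigluingData

/-- The projective `L`-maps in `M^D`, for a pre-wfs on `M` with class of right maps `R`: the maps
with the left lifting property with respect to the maps that are objectwise in `R`. -/
def projectiveL {M : Type u} [Category.{v} M] (R : MorphismProperty M)
    (D : Type w) [Category.{w'} D] : MorphismProperty (D ⥤ M) :=
  (R.functorCategory D).llp

/-- A degree function on the objects of `C`, together with a choice, for each ordinal `δ`, of a
subcategory (not necessarily full) whose objects are exactly those of degree `δ`.  These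
subcategories are encoded together by the class `inStratum` of all their morphisms. -/
structure Stratification (C : Type v) [SmallCategory C] where
  deg : C → Ordinal.{v}
  inStratum : MorphismProperty C
  deg_eq {x y : C} (f : x ⟶ y) (hf : inStratum f) : deg x = deg y
  isMultiplicative : inStratum.IsMultiplicative

namespace Stratification

attribute [instance] isMultiplicative

section

variable {C : Type v} [SmallCategory C] (S : Stratification C)

/-- The objects of degree `< δ`. -/
abbrev below (δ : Ordinal.{v}) : ObjectProperty C := fun x => S.deg x < δ

/-- `C_δ`, the full subcategory of objects of degree `< δ`. -/
abbrev Below (δ : Ordinal.{v}) : Type v := (S.below δ).FullSubcategory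

/-- The inclusion of `C_δ` in `C`. -/
abbrev belowι (δ : Ordinal.{v}) : S.Below δ ⥤ C := (S.below δ).ι

/-- The stratification of `C` restricted to `C_δ`. -/
def restrict (δ : Ordinal.{v}) : Stratification (S.Below δ) where
  deg x := S.deg x.obj
  inStratum := S.inStratum.inverseImage (S.belowι δ)
  deg_eq f hf := S.deg_eq ((S.belowι δ).map f) hf
  isMultiplicative := inferInstance

/-- The stratum `C_{=δ}`: the subcategory of objects of degree `δ` and morphisms in the stratum. -/
structure Stratum (δ : Ordinal.{v}) : Type v where
  obj : C
  deg_obj : S.deg obj = δ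

instance (δ : Ordinal.{v}) : Category.{v} (S.Stratum δ) where
  Hom x y := { f : x.obj ⟶ y.obj // S.inStratum f }
  id x := ⟨𝟙 x.obj, S.inStratum.id_mem x.obj⟩
  comp f g := ⟨f.1 ≫ g.1, S.inStratum.comp_mem _ _ f.2 g.2⟩

/-- The (non-full) inclusion of the stratum `C_{=δ}` in `C`. -/
def stratumι (δ : Ordinal.{v}) : S.Stratum δ ⥤ C where
  obj x := x.obj
  map f := f.1

end

/-- The stratification of a collage obtained from one of `C` by letting the objects of `D` have
degree `β` and letting `D` be the corresponding stratum. -/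
def collage {C D : Type v} [SmallCategory C] [SmallCategory D] (T : Stratification C)
    (β : Ordinal.{v}) (P : AbstractBigluingData C D) : Stratification P.Collage where
  deg
    | .low c => T.deg c
    | .high _ => β
  inStratum X Y f := match X, Y, f with
    | .low _, .low _, f => T.inStratum f
    | .high _, .high _, Sum.inl _ => True
    | _, _, _ => False
  deg_eq {X Y} f hf := by
    rcases X with c | d <;> rcases Y with c' | d'
    · exact T.deg_eq f hf
    · exact hf.elim
    · exact hf.elim
    · rfl
  isMultiplicative :=
    { id_mem X := by
        rcases X with c | d
        · exact T.inStratum.id_mem c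
        · trivial
      comp_mem {X Y Z} f g hf hg := by
        rcases X with x | x <;> rcases Y with y | y
        · rcases Z with z | z
          · exact T.inStratum.comp_mem _ _ hf hg
          · exact hg.elim
        · exact hf.elim
        · exact hf.elim
        · rcases Z with z | z
          · exact hg.elim
          · rcases f with f | f
            · rcases g with g | g
              · trivial
              · exact hg.elim
            · exact hf.elim }

/-- Bistratified categories of height `β`, by transfinite recursion.  Height `0`: the empty
category.  Height `β + 1`: up to isomorphism, the collages of abstract bigluing data from a
bistratified category of height `β` to an arbitrary small category `D`, which becomes the `β`-th
stratum.  Limit height `β`: the colimits of the cotowers of full inclusions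
`C_0 ⊆ C_1 ⊆ ⋯ ⊆ C_δ ⊆ ⋯` (`δ < β`) of bistratified categories `C_δ` of height `δ`, i.e. the
categories in which every object has some degree `< β` and whose full subcategory of objects of
degree `< δ` is bistratified of height `δ` for every `δ < β`. -/
inductive IsBistratifiedOfHeight :
    Ordinal.{v} → ∀ {C : Type v} [SmallCategory C], Stratification C → Prop
  | zero {C : Type v} [SmallCategory C] (S : Stratification C) (hC : IsEmpty C) :
      IsBistratifiedOfHeight 0 S
  | succ {β : Ordinal.{v}} {C D E : Type v} [SmallCategory C] [SmallCategory D] [SmallCategory E]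
      (T : Stratification C) (hT : IsBistratifiedOfHeight β T) (P : AbstractBigluingData C D)
      (S : Stratification E) (Φ : P.Collage ⥤ E) (full : Φ.Full) (faithful : Φ.Faithful)
      (bijective : Function.Bijective Φ.obj)
      (deg_eq : ∀ X, S.deg (Φ.obj X) = (T.collage β P).deg X)
      (inStratum_iff : ∀ {X Y : P.Collage} (f : X ⟶ Y),
        S.inStratum (Φ.map f) ↔ (T.collage β P).inStratum f) :
      IsBistratifiedOfHeight (β + 1) S
  | limit {β : Ordinal.{v}} (hβ : Order.IsSuccLimit β) {C : Type v} [SmallCategory C]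
      (S : Stratification C) (deg_lt : ∀ x, S.deg x < β)
      (hS : ∀ δ < β, IsBistratifiedOfHeight δ (S.restrict δ)) :
      IsBistratifiedOfHeight β S

section Reedy

variable {C : Type v} [SmallCategory C] (S : Stratification C)
  {M : Type u} [Category.{v} M]

/-- `C` is bistratified, with the given degrees and strata. -/
def IsBistratified : Prop := ∃ β : Ordinal.{v}, IsBistratifiedOfHeight β S

section Matching

variable [HasLimits M]

/-- The functor `A ↦ M_δ A`, defined on all of `C`: restrict `A` to `C_δ` and take the right Kan
extension along the inclusion of `C_δ` in `C`.  Its value at `x` is the limit of `A` over `C_δ`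
weighted by `C(x,-)`. -/
noncomputable def matching (δ : Ordinal.{v}) : (C ⥤ M) ⥤ (C ⥤ M) :=
  (Functor.whiskeringLeft _ _ M).obj (S.belowι δ) ⋙ (S.belowι δ).ran

/-- The canonical map `A ⟶ M_δ A`. -/
noncomputable def toMatching (δ : Ordinal.{v}) : 𝟭 (C ⥤ M) ⟶ S.matching δ :=
  ((S.belowι δ).ranAdjunction M).unit

/-- The relative matching map `A_x ⟶ M_x A ×_{M_x B} B_x` of `f : A ⟶ B`, where `M_x` is `M_δ`
evaluated at `x`, for `δ` the degree of `x`. -/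
noncomputable def matchingMap {A B : C ⥤ M} (f : A ⟶ B) (x : C) :
    A.obj x ⟶ pullback (((S.matching (S.deg x)).map f).app x)
      (((S.toMatching (S.deg x)).app B).app x) :=
  pullback.lift (((S.toMatching (S.deg x)).app A).app x) (f.app x)
    (by simpa using (congrArg (NatTrans.app · x) ((S.toMatching (S.deg x)).naturality f)).symm)

/-- The `R`-maps of the c-Reedy pre-wfs on `M^C` induced by a pre-wfs on `M` with class of
right maps `R`. -/
def cReedyR (R : MorphismProperty M) : MorphismProperty (C ⥤ M) :=
  fun _ _ f => ∀ x : C, R (S.matchingMap f x)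

end Matching

section Latching

variable [HasColimits M]

/-- The functor `A ↦ L_δ A`, defined on all of `C`: restrict `A` to `C_δ` and take the left Kan
extension along the inclusion of `C_δ` in `C`.  Its value at `x` is the colimit of `A` over `C_δ`
weighted by `C(-,x)`. -/
noncomputable def latching (δ : Ordinal.{v}) : (C ⥤ M) ⥤ (C ⥤ M) :=
  (Functor.whiskeringLeft _ _ M).obj (S.belowι δ) ⋙ (S.belowι δ).lan

/-- The canonical map `L_δ A ⟶ A`. -/
noncomputable def fromLatching (δ : Ordinal.{v}) : S.latching δ ⟶ 𝟭 (C ⥤ M) :=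
  ((S.belowι δ).lanAdjunction M).counit

/-- For `f : A ⟶ B` and a functor `K : D ⥤ C`, the relative latching map
`L_δ B ⊔_{L_δ A} A ⟶ B` of diagrams on `D`, all diagrams being restricted to `D` along `K`. -/
noncomputable def latchingMap (δ : Ordinal.{v}) {D : Type w} [Category.{w'} D] (K : D ⥤ C)
    {A B : C ⥤ M} (f : A ⟶ B) :
    pushout (Functor.whiskerLeft K ((S.latching δ).map f))
      (Functor.whiskerLeft K ((S.fromLatching δ).app A)) ⟶ K ⋙ B :=
  pushout.desc (Functor.whiskerLeft K ((S.fromLatching δ).app B)) (Functor.whiskerLeft K f)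
    (by
      rw [← Functor.whiskerLeft_comp, ← Functor.whiskerLeft_comp]
      exact congrArg (Functor.whiskerLeft K) ((S.fromLatching δ).naturality f))

/-- The relative latching map `L_δ B ⊔_{L_δ A} A_δ ⟶ B_δ` in `M^{C_{=δ}}`. -/
noncomputable abbrev stratumLatchingMap (δ : Ordinal.{v}) {A B : C ⥤ M} (f : A ⟶ B) :=
  S.latchingMap δ (S.stratumι δ) f

/-- The inclusion of the automorphism group of `x`, as a category with one object, in `C`. -/
def autι (x : C) : SingleObj (Aut x) ⥤ C := SingleObj.functor (Aut.toEnd x)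

/-- The relative latching map `L_x B ⊔_{L_x A} A_x ⟶ B_x` in `M^{aut(x)}`. -/
noncomputable abbrev autLatchingMap (x : C) {A B : C ⥤ M} (f : A ⟶ B) :=
  S.latchingMap (S.deg x) (autι x) f

/-- The `L`-maps of the c-Reedy pre-wfs on `M^C` induced by a pre-wfs on `M` with class of
right maps `R`. -/
def cReedyL (R : MorphismProperty M) : MorphismProperty (C ⥤ M) :=
  fun _ _ f => ∀ δ : Ordinal.{v}, projectiveL R (S.Stratum δ) (S.stratumLatchingMap δ f)

end Latching

/-- A bistratified category is almost c-Reedy if, for every object `x` of degree `β`, the functors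
`C(-,x)` and `C(x,-)` on `C_β` are `L`-objects, where `Set` has the wfs (injections, surjections):
* `C(-,x)` for the opposite of the c-Reedy wfs on `(Set^op)^{C_β}`, so that the map from `C(-,x)`
  to the terminal object of `(Set^op)^{C_β}` is an `R`-map; the right maps of `Set^op` are the
  opposites of the injections;
* `C(x,-)` for the c-Reedy wfs on `Set^{C_β}`. -/
structure IsAlmostCReedy : Prop where
  isBistratified : S.IsBistratified
  yoneda (x : C) :
    (S.restrict (S.deg x)).cReedyR (MorphismProperty.monomorphisms (Type v)).op
      (terminal.from ((S.belowι (S.deg x)).op ⋙ CategoryTheory.yoneda.obj x).rightOp)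
  coyoneda (x : C) :
    (S.restrict (S.deg x)).cReedyL (MorphismProperty.epimorphisms (Type v))
      (initial.to (S.belowι (S.deg x) ⋙ CategoryTheory.coyoneda.obj (op x)))

/-- An almost c-Reedy category is almost g-Reedy if all its strata are groupoids. -/
structure IsAlmostGReedy : Prop extends S.IsAlmostCReedy where
  isGroupoid (δ : Ordinal.{v}) : IsGroupoid (S.Stratum δ)

end Reedy

end Stratification

section Projective

variable (D : Type w) [Category.{w'} D] (M : Type u) [Category.{v} M] [ModelCategory M]

/-- `M^D` has a projective model structure: one whose weak equivalences and fibrations are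
objectwise. -/
def HasProjectiveModelStructure : Prop :=
  ∃ _ : ModelCategory (D ⥤ M),
    weakEquivalences (D ⥤ M) = (weakEquivalences M).functorCategory D ∧
    fibrations (D ⥤ M) = (fibrations M).functorCategory D

/-- The projective-cofibrations in `M^D`. -/
def projectiveCofibrations : MorphismProperty (D ⥤ M) := projectiveL (trivialFibrations M) D

/-- The acyclic projective-cofibrations in `M^D`. -/
def acyclicProjectiveCofibrations : MorphismProperty (D ⥤ M) :=
  projectiveCofibrations D M ⊓ (weakEquivalences M).functorCategory D

end Projective

/-! Only one consequence of bistratification is used, `HasThroughDecomposition`: a map between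
objects of equal degree either lies in the stratum or passes through a lower degree, and any two
such passages of one map are linked by a zigzag. The zigzag appears as transport of every predicate
that is invariant under sliding a morphism across a factorization. For a collage this is the
description of the hom-sets of `D`-objects as `D(d,d') ⊔ ∫^c W(d,c) × U(c,d')`.

It follows that extending a diagram `E` from `C_δ` to `C_{δ+1}` amounts to factoring the canonical
map `L_δ E ⟶ M_δ E` through some diagram on the stratum `C_{=δ}`. Relative versions of this,
iterated transfinitely, yield lifts and factorizations in `M^C`. A lift is extended by solving one
lifting problem in `M^{C_{=δ}}`, of a relative latching map against a relative matching map
(`PartialLift.exists_succ`). A factorization is extended by factoring the map from the relative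
latching object to the relative matching object (`exists_stratumExtension`, `exists_glue`). Hence a
class `R` with `R.llp.rlp = R` and projective factorizations on every stratum induces a weak
factorization system on `M^C` (`isWeakFactorizationSystem_cReedy`). The two Reedy conditions play no
role up to this point.

They serve to recognize the acyclic maps. Lifting `i` against `M_x f` is the same as lifting `∅ ⟶
C(x,-)` against the map from diagonals to squares between `i` and `f`. Dually, lifting `L_x f`
against `p : X ⟶ Y` is the same as lifting `f` against `X^{C(-,x)} ⟶ Y^{C(-,x)}` over the lower
degrees. So `M_x` preserves right maps and `L_x` preserves left maps (`matching_map_app_mem`,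
`latching_map_app_mem`). Now `f_x` is the relative matching map followed by a base change of `M_x
f`, and it is a cobase change of `L_x f` followed by the relative latching map. Two-out-of-three and
induction on the degree then identify the acyclic maps, and the two weak factorization systems form
a model structure.

When the strata are groupoids, a lift over a stratum can be assembled from equivariant lifts at
representatives of the isomorphism classes. This replaces strata by automorphism groups. -/

namespace Stratification

/-! ### Morphisms between objects of equal degree -/

/-- Morphisms between objects of the same degree either belong to the stratum or factor through an
object of smaller degree, but not both, and any two such factorizations are connected. -/
structure HasThroughDecomposition {C : Type v} [SmallCategory C] (S : Stratification C) : Prop where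
  exists_fac {x y : C} (f : x ⟶ y) (hxy : S.deg x = S.deg y) (hf : ¬ S.inStratum f) :
    ∃ (z : C) (g : x ⟶ z) (h : z ⟶ y), S.deg z < S.deg x ∧ g ≫ h = f
  not_inStratum {x y z : C} (g : x ⟶ z) (h : z ⟶ y) (hz : S.deg z < S.deg x) :
    ¬ S.inStratum (g ≫ h)
  connected {x y : C} (hxy : S.deg x = S.deg y)
    (φ : ∀ z : C, S.deg z < S.deg x → (x ⟶ z) → (z ⟶ y) → Prop)
    (hφ : ∀ (z z' : C) (hz : S.deg z < S.deg x) (hz' : S.deg z' < S.deg x) (g : x ⟶ z)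
      (k : z ⟶ z') (h : z' ⟶ y), φ z hz g (k ≫ h) ↔ φ z' hz' (g ≫ k) h)
    {z z' : C} (hz : S.deg z < S.deg x) (hz' : S.deg z' < S.deg x)
    (g : x ⟶ z) (h : z ⟶ y) (g' : x ⟶ z') (h' : z' ⟶ y) (e : g ≫ h = g' ≫ h') :
    φ z hz g h → φ z' hz' g' h'

namespace HasThroughDecomposition

lemma of_isomorphism {C E : Type v} [SmallCategory C] [SmallCategory E] {T : Stratification C}
    (hT : T.HasThroughDecomposition) {S : Stratification E} (Φ : C ⥤ E) [Φ.Full] [Φ.Faithful]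
    (surj : Function.Surjective Φ.obj) (deg_eq : ∀ X, S.deg (Φ.obj X) = T.deg X)
    (inStratum_iff : ∀ {X Y : C} (f : X ⟶ Y), S.inStratum (Φ.map f) ↔ T.inStratum f) :
    S.HasThroughDecomposition where
  exists_fac {x y} f hxy hf := by
    obtain ⟨X, rfl⟩ := surj x
    obtain ⟨Y, rfl⟩ := surj y
    obtain ⟨f, rfl⟩ := Φ.map_surjective f
    rw [inStratum_iff] at hf
    obtain ⟨z, g, h, hz, rfl⟩ := hT.exists_fac f (by rwa [deg_eq, deg_eq] at hxy) hf
    exact ⟨Φ.obj z, Φ.map g, Φ.map h, by rwa [deg_eq, deg_eq], by simp⟩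
  not_inStratum {x y z} g h hz := by
    obtain ⟨X, rfl⟩ := surj x
    obtain ⟨Y, rfl⟩ := surj y
    obtain ⟨Z, rfl⟩ := surj z
    obtain ⟨g, rfl⟩ := Φ.map_surjective g
    obtain ⟨h, rfl⟩ := Φ.map_surjective h
    rw [← Φ.map_comp, inStratum_iff]
    exact hT.not_inStratum g h (by rwa [deg_eq, deg_eq] at hz)
  connected {x y} hxy φ hφ z z' hz hz' g h g' h' e := by
    obtain ⟨X, rfl⟩ := surj x
    obtain ⟨Y, rfl⟩ := surj y
    obtain ⟨Z, rfl⟩ := surj z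
    obtain ⟨Z', rfl⟩ := surj z'
    obtain ⟨g, rfl⟩ := Φ.map_surjective g
    obtain ⟨h, rfl⟩ := Φ.map_surjective h
    obtain ⟨g', rfl⟩ := Φ.map_surjective g'
    obtain ⟨h', rfl⟩ := Φ.map_surjective h'
    refine hT.connected (by rwa [deg_eq, deg_eq] at hxy)
      (fun z hz g h => φ (Φ.obj z) (by rwa [deg_eq, deg_eq]) (Φ.map g) (Φ.map h)) ?_
      (by rwa [deg_eq, deg_eq] at hz) (by rwa [deg_eq, deg_eq] at hz') g h g' h'
      (Φ.map_injective (by simpa using e))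
    intro z z' hz hz' g k h
    simpa using hφ (Φ.obj z) (Φ.obj z') (by rwa [deg_eq, deg_eq]) (by rwa [deg_eq, deg_eq])
      (Φ.map g) (Φ.map k) (Φ.map h)

/-- The assumption `hβ` keeps the degree of the new objects apart from all degrees of `C`. So equal
degrees mean two old objects, settled by `hT`, or two new ones, where the claim is the definition of
the hom-set as a disjoint union with a coend. -/
lemma collage {C D : Type v} [SmallCategory C] [SmallCategory D] {T : Stratification C}
    (hT : T.HasThroughDecomposition) {β : Ordinal.{v}} (hβ : ∀ x, T.deg x < β)
    (P : AbstractBigluingData C D) : (T.collage β P).HasThroughDecomposition where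
  exists_fac {x y} f hxy hf := by
    rcases x with x | x <;> rcases y with y | y
    · obtain ⟨z, g, h, hz, e⟩ := hT.exists_fac f hxy hf
      exact ⟨.low z, g, h, hz, e⟩
    · exact ((hβ x).ne hxy).elim
    · exact ((hβ y).ne hxy.symm).elim
    · rcases f with f | f
      · exact (hf trivial).elim
      · induction f using AbstractBigluingData.Collage.through_ind with
        | @h c w a => exact ⟨.low c, w, a, hβ c, rfl⟩
  not_inStratum {x y z} g h hz := by
    intro H
    rcases z with z | z
    · rcases x with x | x <;> rcases y with y | y
      · exact hT.not_inStratum (x := x) (y := y) (z := z) g h hz H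
      · exact H
      · exact H
      · exact H
    · rcases x with x | x
      · exact (lt_asymm (hβ x) hz).elim
      · exact (lt_irrefl _ hz).elim
  connected {x y} hxy φ hφ z z' hz hz' g h g' h' e := by
    -- New objects have the top degree, so no factorization through a smaller degree passes through
    -- one.
    have key {x : P.Collage} {z : D} (h : (T.collage β P).deg (.high z) < (T.collage β P).deg x) :
        False := by
      rcases x with x | x
      · exact (lt_asymm (hβ x) h).elim
      · exact (lt_irrefl _ h).elim
    rcases z with z | z
    swap
    · exact (key hz).elim
    rcases z' with z' | z'
    swap
    · exact (key hz').elim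
    rcases x with x | x <;> rcases y with y | y
    · exact hT.connected (x := x) (y := y) hxy (fun z hz g h => φ (.low z) hz g h)
        (fun z z' hz hz' g k h => hφ (.low z) (.low z') hz hz' g k h) hz hz' g h g' h' e
    · exact ((hβ x).ne hxy).elim
    · exact ((hβ y).ne hxy.symm).elim
    · have e' : P.through (d := x) (d' := y) g h = P.through g' h' := Sum.inr_injective e
      -- Invariance of `φ` under sliding says exactly that it descends to a `Prop`-valued function
      -- on the coend, so it takes equal values on representatives of the same class.
      have := congrArg (Quot.lift (fun t : Σ c : C, (P.W.obj (op x)).obj c × (P.U.obj (op c)).obj y =>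
        φ (.low t.1) (hβ t.1) t.2.1 t.2.2) (by
        rintro _ _ ⟨w, k, a⟩
        exact propext (hφ (.low _) (.low _) (hβ _) (hβ _) w k a).symm)) e'
      exact fun H => this.mp H

lemma restrict {C : Type v} [SmallCategory C] {S : Stratification C}
    (hS : S.HasThroughDecomposition) (δ : Ordinal.{v}) :
    (S.restrict δ).HasThroughDecomposition where
  exists_fac {x y} f hxy hf := by
    obtain ⟨z, g, h, hz, e⟩ := hS.exists_fac f.hom hxy hf
    exact ⟨⟨z, hz.trans x.property⟩, ⟨g⟩, ⟨h⟩, hz, InducedCategory.hom_ext e⟩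
  not_inStratum {x y z} g h hz := hS.not_inStratum g.hom h.hom hz
  connected {x y} hxy φ hφ z z' hz hz' g h g' h' e := by
    exact hS.connected hxy
      (fun z hz g h => φ ⟨z, hz.trans x.property⟩ hz ⟨g⟩ ⟨h⟩)
      (fun z z' hz hz' g k h => hφ ⟨z, hz.trans x.property⟩ ⟨z', hz'.trans x.property⟩
        hz hz' ⟨g⟩ ⟨k⟩ ⟨h⟩) hz hz' g.hom h.hom g'.hom h'.hom
      (congrArg InducedCategory.Hom.hom e)

/-- Every condition at `x` involves only objects of degree at most `S.deg x`, so it can be checked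
in one sufficiently large `C_δ`. -/
lemma of_restrict {C : Type v} [SmallCategory C] {S : Stratification C}
    (hS : ∀ x : C, ∃ δ, S.deg x < δ ∧ (S.restrict δ).HasThroughDecomposition) :
    S.HasThroughDecomposition where
  exists_fac {x y} f hxy hf := by
    obtain ⟨δ, hδ, H⟩ := hS x
    obtain ⟨z, g, h, hz, e⟩ := H.exists_fac (x := ⟨x, hδ⟩) (y := ⟨y, hxy.symm.trans_lt hδ⟩) ⟨f⟩ hxy hf
    exact ⟨z.obj, g.hom, h.hom, hz, congrArg InducedCategory.Hom.hom e⟩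
  not_inStratum {x y z} g h hz := by
    intro hgh
    obtain ⟨δ, hδ, H⟩ := hS x
    exact H.not_inStratum (x := ⟨x, hδ⟩) (y := ⟨y, (S.deg_eq _ hgh).symm.trans_lt hδ⟩)
      (z := ⟨z, hz.trans hδ⟩) ⟨g⟩ ⟨h⟩ hz hgh
  connected {x y} hxy φ hφ z z' hz hz' g h g' h' e := by
    obtain ⟨δ, hδ, H⟩ := hS x
    exact H.connected (x := ⟨x, hδ⟩) (y := ⟨y, hxy.symm.trans_lt hδ⟩) hxy
      (fun z hz g h => φ z.obj hz g.hom h.hom)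
      (fun z z' hz hz' g k h => hφ z.obj z'.obj hz hz' g.hom k.hom h.hom)
      (z := ⟨z, hz.trans hδ⟩) (z' := ⟨z', hz'.trans hδ⟩) hz hz' ⟨g⟩ ⟨h⟩ ⟨g'⟩ ⟨h'⟩
      (InducedCategory.hom_ext e)

end HasThroughDecomposition

lemma IsBistratifiedOfHeight.deg_lt_and_hasThroughDecomposition {β : Ordinal.{v}} {C : Type v}
    [SmallCategory C] {S : Stratification C} (h : IsBistratifiedOfHeight β S) :
    (∀ x, S.deg x < β) ∧ S.HasThroughDecomposition := by
  induction h with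
  | zero S hC =>
    exact ⟨fun x => hC.elim x, ⟨fun {x} => hC.elim x, fun {x} => hC.elim x, fun {x} => hC.elim x⟩⟩
  | @succ β C D E _ _ _ T hT P S Φ full faithful bijective deg_eq inStratum_iff ih =>
    refine ⟨fun x => ?_, (ih.2.collage ih.1 P).of_isomorphism Φ bijective.2 deg_eq inStratum_iff⟩
    obtain ⟨X, rfl⟩ := bijective.2 x
    rw [deg_eq]
    rcases X with c | d
    · exact (ih.1 c).trans (lt_add_one β)
    · exact lt_add_one β
  | @limit β hβ C _ S deg_lt hS ih =>
    -- As `β` is a limit, the successor of the degree of `x` is still below `β`.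
    refine ⟨deg_lt, .of_restrict fun x => ⟨Order.succ (S.deg x), Order.lt_succ _, ?_⟩⟩
    exact (ih _ (hβ.succ_lt (deg_lt x))).2

lemma IsBistratified.hasThroughDecomposition {C : Type v} [SmallCategory C] {S : Stratification C}
    (h : S.IsBistratified) : S.HasThroughDecomposition :=
  h.choose_spec.deg_lt_and_hasThroughDecomposition.2

end Stratification

/-! ### Pointwise Kan extensions through their projections and inclusions -/

namespace KanExtension

section
variable {C : Type v} [SmallCategory C] {D : Type w} [Category.{v} D] (ι : D ⥤ C)
  {M : Type u} [Category.{v} M] [∀ x, HasLimitsOfShape (StructuredArrow x ι) M]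

/-- The projection from a right Kan extension indexed by `g : x ⟶ ι z`. -/
noncomputable def ranπ (E : D ⥤ M) {x : C} {z : D} (g : x ⟶ ι.obj z) :
    (ι.ran.obj E).obj x ⟶ E.obj z :=
  (ι.ran.obj E).map g ≫ (ι.ranCounit.app E).app z

variable {ι}

lemma ran_map_ranπ (E : D ⥤ M) {x y : C} (u : x ⟶ y) {z : D} (g : y ⟶ ι.obj z) :
    (ι.ran.obj E).map u ≫ ranπ ι E g = ranπ ι E (u ≫ g) := by
  simp [ranπ]

lemma ranπ_map (E : D ⥤ M) {x : C} {z z' : D} (g : x ⟶ ι.obj z) (k : z ⟶ z') :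
    ranπ ι E g ≫ E.map k = ranπ ι E (g ≫ ι.map k) := by
  have := (ι.ranCounit.app E).naturality k
  simp only [ranπ, Category.assoc, Functor.map_comp]
  exact congrArg _ this.symm

lemma ran_map_app_ranπ {E E' : D ⥤ M} (φ : E ⟶ E') {x : C} {z : D} (g : x ⟶ ι.obj z) :
    (ι.ran.map φ).app x ≫ ranπ ι E' g = ranπ ι E g ≫ φ.app z := by
  have := congr_app (ι.ranCounit.naturality φ) z
  simp only [ranπ, Category.assoc]
  rw [← NatTrans.naturality_assoc]
  exact congrArg _ this

lemma ranAdjunction_unit_ranπ (A : C ⥤ M) {x : C} {z : D} (g : x ⟶ ι.obj z) :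
    ((ι.ranAdjunction M).unit.app A).app x ≫ ranπ ι (ι ⋙ A) g = A.map g := by
  have h := ι.ranCounit_app_app_ranAdjunction_unit_app_app A z
  have h' := ((ι.ranAdjunction M).unit.app A).naturality g
  simp only [ranπ]
  refine (Category.assoc _ _ _).symm.trans ((congrArg (· ≫ _) h'.symm).trans ?_)
  refine (Category.assoc _ _ _).trans ((congrArg (A.map g ≫ ·) h).trans (Category.comp_id _))

lemma ran_hom_ext (E : D ⥤ M) {x : C} {T : M} {l l' : T ⟶ (ι.ran.obj E).obj x}
    (h : ∀ (z : D) (g : x ⟶ ι.obj z), l ≫ ranπ ι E g = l' ≫ ranπ ι E g) : l = l' :=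
  (ι.isPointwiseRightKanExtensionRanCounit E x).hom_ext fun j => h j.right j.hom

lemma exists_ran_lift (E : D ⥤ M) {x : C} {T : M} (m : ∀ (z : D), (x ⟶ ι.obj z) → (T ⟶ E.obj z))
    (hm : ∀ (z z' : D) (g : x ⟶ ι.obj z) (k : z ⟶ z'), m z g ≫ E.map k = m z' (g ≫ ι.map k)) :
    ∃ l : T ⟶ (ι.ran.obj E).obj x, ∀ z g, l ≫ ranπ ι E g = m z g := by
  let c : Cone (StructuredArrow.proj x ι ⋙ E) :=
    { pt := T
      π :=
        { app j := m j.right j.hom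
          naturality j j' f := by
            have := hm j.right j'.right j.hom f.right
            rw [StructuredArrow.w] at this
            exact (Category.id_comp _).trans this.symm } }
  exact ⟨(ι.isPointwiseRightKanExtensionRanCounit E x).lift c, fun z g =>
    (ι.isPointwiseRightKanExtensionRanCounit E x).fac c (StructuredArrow.mk g)⟩

end

section
variable {C D : Type v} [SmallCategory C] [SmallCategory D] (ι : D ⥤ C)
  {M : Type u} [Category.{v} M] [HasColimits M]

/-- The inclusion in a left Kan extension indexed by `h : ι z ⟶ x`. -/
noncomputable def lanι (E : D ⥤ M) {x : C} {z : D} (h : ι.obj z ⟶ x) :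
    E.obj z ⟶ (ι.lan.obj E).obj x :=
  (ι.lanUnit.app E).app z ≫ (ι.lan.obj E).map h

variable {ι}

lemma lanι_lan_map (E : D ⥤ M) {x y : C} (u : x ⟶ y) {z : D} (h : ι.obj z ⟶ x) :
    lanι ι E h ≫ (ι.lan.obj E).map u = lanι ι E (h ≫ u) := by
  simp [lanι]

lemma lanι_lan_map_assoc (E : D ⥤ M) {x y : C} (u : x ⟶ y) {z : D} (h : ι.obj z ⟶ x) {T : M}
    (t : (ι.lan.obj E).obj y ⟶ T) :
    lanι ι E h ≫ (ι.lan.obj E).map u ≫ t = lanι ι E (h ≫ u) ≫ t := by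
  rw [← Category.assoc, lanι_lan_map]

lemma map_lanι (E : D ⥤ M) {x : C} {z z' : D} (k : z ⟶ z') (h : ι.obj z' ⟶ x) :
    E.map k ≫ lanι ι E h = lanι ι E (ι.map k ≫ h) := by
  have := (ι.lanUnit.app E).naturality k
  simp only [lanι, Functor.map_comp]
  refine (Category.assoc _ _ _).symm.trans ((congrArg (· ≫ _) this).trans ?_)
  exact Category.assoc _ _ _

lemma map_lanι_assoc (E : D ⥤ M) {x : C} {z z' : D} (k : z ⟶ z') (h : ι.obj z' ⟶ x) {T : M}
    (t : (ι.lan.obj E).obj x ⟶ T) :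
    E.map k ≫ lanι ι E h ≫ t = lanι ι E (ι.map k ≫ h) ≫ t := by
  rw [← Category.assoc, map_lanι]

lemma lanι_lan_map_app {E E' : D ⥤ M} (φ : E ⟶ E') {x : C} {z : D} (h : ι.obj z ⟶ x) :
    lanι ι E h ≫ (ι.lan.map φ).app x = φ.app z ≫ lanι ι E' h := by
  have := congr_app (ι.lanUnit.naturality φ) z
  simp only [lanι, Category.assoc]
  rw [NatTrans.naturality]
  refine (Category.assoc _ _ _).symm.trans ((congrArg (· ≫ _) this.symm).trans ?_)
  exact Category.assoc _ _ _

lemma lanι_lan_map_app_assoc {E E' : D ⥤ M} (φ : E ⟶ E') {x : C} {z : D} (h : ι.obj z ⟶ x)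
    {T : M} (t : (ι.lan.obj E').obj x ⟶ T) :
    lanι ι E h ≫ (ι.lan.map φ).app x ≫ t = φ.app z ≫ lanι ι E' h ≫ t := by
  rw [← Category.assoc, lanι_lan_map_app, Category.assoc]

lemma lanι_lanAdjunction_counit (A : C ⥤ M) {x : C} {z : D} (h : ι.obj z ⟶ x) :
    lanι ι (ι ⋙ A) h ≫ ((ι.lanAdjunction M).counit.app A).app x = A.map h := by
  have h₁ := ι.lanUnit_app_app_lanAdjunction_counit_app_app A z
  have h₂ := ((ι.lanAdjunction M).counit.app A).naturality h
  simp only [lanι]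
  refine (Category.assoc _ _ _).trans ((congrArg (_ ≫ ·) h₂).trans ?_)
  refine (Category.assoc _ _ _).symm.trans
    ((congrArg (· ≫ A.map h) h₁).trans (Category.id_comp _))

lemma lanι_lanAdjunction_counit_assoc (A : C ⥤ M) {x : C} {z : D} (h : ι.obj z ⟶ x) {T : M}
    (t : A.obj x ⟶ T) :
    lanι ι (ι ⋙ A) h ≫ ((ι.lanAdjunction M).counit.app A).app x ≫ t = A.map h ≫ t :=
  (Category.assoc _ _ _).symm.trans (congrArg (· ≫ t) (lanι_lanAdjunction_counit A h))

lemma lan_hom_ext (E : D ⥤ M) {x : C} {T : M} {l l' : (ι.lan.obj E).obj x ⟶ T}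
    (h : ∀ (z : D) (g : ι.obj z ⟶ x), lanι ι E g ≫ l = lanι ι E g ≫ l') : l = l' :=
  (ι.isPointwiseLeftKanExtensionLeftKanExtensionUnit E x).hom_ext fun j => h j.left j.hom

lemma exists_lan_desc (E : D ⥤ M) {x : C} {T : M} (m : ∀ (z : D), (ι.obj z ⟶ x) → (E.obj z ⟶ T))
    (hm : ∀ (z z' : D) (k : z ⟶ z') (h : ι.obj z' ⟶ x), E.map k ≫ m z' h = m z (ι.map k ≫ h)) :
    ∃ l : (ι.lan.obj E).obj x ⟶ T, ∀ z h, lanι ι E h ≫ l = m z h := by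
  let c : Cocone (CostructuredArrow.proj ι x ⋙ E) :=
    { pt := T
      ι :=
        { app j := m j.left j.hom
          naturality j j' f := by
            have := hm j.left j'.left f.left j'.hom
            rw [CostructuredArrow.w] at this
            exact this.trans (Category.comp_id _).symm } }
  exact ⟨(ι.isPointwiseLeftKanExtensionLeftKanExtensionUnit E x).desc c, fun z h =>
    (ι.isPointwiseLeftKanExtensionLeftKanExtensionUnit E x).fac c (CostructuredArrow.mk h)⟩

end

end KanExtension

/-! ### Relative matching and latching objects by universal properties -/

section Cones

variable {C : Type v} [SmallCategory C] {P : ObjectProperty C} {M : Type u} [Category.{v} M]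

/-- A cone with vertex `T` over the diagram whose limit is the relative matching object at `x` of
`p : E ⟶ B|_P`. -/
@[ext]
structure MatchingCone {E : P.FullSubcategory ⥤ M} {B : C ⥤ M} (p : E ⟶ P.ι ⋙ B)
    (x : C) (T : M) where
  base : T ⟶ B.obj x
  proj (z : P.FullSubcategory) (g : x ⟶ z.obj) : T ⟶ E.obj z
  proj_map {z z' : P.FullSubcategory} (g : x ⟶ z.obj) (k : z ⟶ z') :
    proj z g ≫ E.map k = proj z' (g ≫ k.hom)
  proj_app (z : P.FullSubcategory) (g : x ⟶ z.obj) : proj z g ≫ p.app z = base ≫ B.map g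

namespace MatchingCone

variable {E : P.FullSubcategory ⥤ M} {B : C ⥤ M} {p : E ⟶ P.ι ⋙ B} {x : C} {T Q : M}

/-- Precomposition of a matching cone with a morphism. -/
@[simps]
def precomp (c : MatchingCone p x T) {T' : M} (l : T' ⟶ T) : MatchingCone p x T' where
  base := l ≫ c.base
  proj z g := l ≫ c.proj z g
  proj_map g k := by rw [Category.assoc, c.proj_map]
  proj_app z g := by rw [Category.assoc, Category.assoc, c.proj_app]

lemma precomp_comp (c : MatchingCone p x T) {T' T'' : M} (l : T' ⟶ T) (l' : T'' ⟶ T') :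
    c.precomp (l' ≫ l) = (c.precomp l).precomp l' := by
  ext <;> simp

/-- A matching cone is universal if it is a relative matching object. -/
def IsUniversal (c : MatchingCone p x Q) : Prop :=
  ∀ {T : M} (c' : MatchingCone p x T), ∃! l : T ⟶ Q, c.precomp l = c'

/-- The lifting problems against the map from `T` to the relative matching object, in terms of the
matching cone with vertex `T`. -/
def Lifts (c : MatchingCone p x T) {K L : M} (i : K ⟶ L) : Prop :=
  ∀ (t : K ⟶ T) (c' : MatchingCone p x L), c.precomp t = c'.precomp i →
    ∃ l : L ⟶ T, i ≫ l = t ∧ c.precomp l = c'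

/-- Maps into `Q` are cones, so a square from `i` to `φ` is a map `t` and a cone on `L` that agree
on `K`. The right side no longer mentions `Q`. This allows comparison of different constructions of
the relative matching object, and also makes sense for diagrams defined only in low degrees. -/
lemma IsUniversal.hasLiftingProperty_iff {cQ : MatchingCone p x Q} (hQ : cQ.IsUniversal)
    {c : MatchingCone p x T} {φ : T ⟶ Q} (hφ : cQ.precomp φ = c) {K L : M} (i : K ⟶ L) :
    HasLiftingProperty i φ ↔ c.Lifts i := by
  constructor
  · intro H t c' hc'
    obtain ⟨q, rfl, -⟩ := hQ c'
    have sq : CommSq t i φ q := ⟨(hQ (c.precomp t)).unique (by rw [precomp_comp, hφ])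
      (by rw [precomp_comp, hc'])⟩
    exact ⟨sq.lift, sq.fac_left, by rw [← hφ, ← precomp_comp, sq.fac_right]⟩
  · intro H
    refine ⟨fun {t q} sq => ?_⟩
    obtain ⟨l, hl, hl'⟩ := H t (cQ.precomp q) (by
      rw [← hφ, ← precomp_comp, ← precomp_comp, sq.w])
    exact ⟨⟨⟨l, hl, (hQ (cQ.precomp q)).unique (by rw [precomp_comp, hφ, hl']) rfl⟩⟩⟩

section
variable [HasLimits M]

/-- The matching cone determined by a commutative square over the matching objects. -/
noncomputable def ofSq (p : E ⟶ P.ι ⋙ B) {x : C} {Q : M} {fst : Q ⟶ (P.ι.ran.obj E).obj x}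
    {snd : Q ⟶ B.obj x}
    (h : CommSq fst snd ((P.ι.ran.map p).app x) (((P.ι.ranAdjunction M).unit.app B).app x)) :
    MatchingCone p x Q where
  base := snd
  proj z g := fst ≫ KanExtension.ranπ P.ι E g
  proj_map g k := by
    rw [Category.assoc, KanExtension.ranπ_map]
    rfl
  proj_app z g := by
    rw [Category.assoc, ← KanExtension.ran_map_app_ranπ, reassoc_of% h.w]
    exact congrArg _ (KanExtension.ranAdjunction_unit_ranπ (ι := P.ι) B (z := z) g)

/-- A map into the pullback is a pair of maps, and a map into the right Kan extension is a
compatible family of maps into the values of `E`. -/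
lemma isUniversal_ofSq {p : E ⟶ P.ι ⋙ B} {x : C} {Q : M} {fst : Q ⟶ (P.ι.ran.obj E).obj x}
    {snd : Q ⟶ B.obj x}
    (h : IsPullback fst snd ((P.ι.ran.map p).app x) (((P.ι.ranAdjunction M).unit.app B).app x)) :
    (ofSq p h.toCommSq).IsUniversal := by
  intro T c
  obtain ⟨m, hm⟩ := KanExtension.exists_ran_lift (ι := P.ι) E c.proj fun z z' g k => c.proj_map g k
  have w : m ≫ (P.ι.ran.map p).app x = c.base ≫ ((P.ι.ranAdjunction M).unit.app B).app x := by
    refine KanExtension.ran_hom_ext _ fun z g => ?_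
    rw [Category.assoc, KanExtension.ran_map_app_ranπ, reassoc_of% hm, c.proj_app, Category.assoc]
    exact congrArg _ (KanExtension.ranAdjunction_unit_ranπ (ι := P.ι) B (z := z) g).symm
  refine ⟨h.lift m c.base w, ?_, ?_⟩
  · ext z g
    · exact h.lift_snd _ _ _
    · exact (Category.assoc _ _ _).symm.trans
        ((congrArg (· ≫ _) (h.lift_fst _ _ w)).trans (hm z g))
  · intro l hl
    refine h.hom_ext ?_ ?_
    · refine KanExtension.ran_hom_ext _ fun z g => ?_
      rw [h.lift_fst, hm, ← hl]
      exact Category.assoc _ _ _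
    · rw [h.lift_snd, ← hl]
      rfl

end

end MatchingCone

/-- A cocone with vertex `X` over the diagram whose colimit is the relative latching object, as a
diagram on `D` via `K`, of `i : A|_P ⟶ E`. -/
@[ext]
structure LatchingCocone {E : P.FullSubcategory ⥤ M} {A : C ⥤ M} (i : P.ι ⋙ A ⟶ E)
    {D : Type w} [Category.{w'} D] (K : D ⥤ C) (X : D ⥤ M) where
  base : K ⋙ A ⟶ X
  incl (z : P.FullSubcategory) (d : D) (h : z.obj ⟶ K.obj d) : E.obj z ⟶ X.obj d
  map_incl {z z' : P.FullSubcategory} (k : z ⟶ z') {d : D} (h : z'.obj ⟶ K.obj d) :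
    E.map k ≫ incl z' d h = incl z d (k.hom ≫ h)
  incl_map (z : P.FullSubcategory) {d d' : D} (h : z.obj ⟶ K.obj d) (e : d ⟶ d') :
    incl z d h ≫ X.map e = incl z d' (h ≫ K.map e)
  app_incl (z : P.FullSubcategory) {d : D} (h : z.obj ⟶ K.obj d) :
    i.app z ≫ incl z d h = A.map h ≫ base.app d

namespace LatchingCocone

variable {E : P.FullSubcategory ⥤ M} {A : C ⥤ M} {i : P.ι ⋙ A ⟶ E}
  {D : Type w} [Category.{w'} D] {K : D ⥤ C} {X Q : D ⥤ M}

/-- Postcomposition of a latching cocone with a morphism. -/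
@[simps]
def postcomp (c : LatchingCocone i K X) {X' : D ⥤ M} (l : X ⟶ X') : LatchingCocone i K X' where
  base := c.base ≫ l
  incl z d h := c.incl z d h ≫ l.app d
  map_incl k d h := by rw [← Category.assoc, c.map_incl]
  incl_map z d d' h e := by rw [Category.assoc, ← l.naturality, ← Category.assoc, c.incl_map]
  app_incl z d h := by rw [← Category.assoc, c.app_incl, NatTrans.comp_app, Category.assoc]

lemma postcomp_comp (c : LatchingCocone i K X) {X' X'' : D ⥤ M} (l : X ⟶ X') (l' : X' ⟶ X'') :
    c.postcomp (l ≫ l') = (c.postcomp l).postcomp l' := by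
  ext <;> simp

/-- A latching cocone is universal if it is a relative latching object. -/
def IsUniversal (c : LatchingCocone i K Q) : Prop :=
  ∀ {X : D ⥤ M} (c' : LatchingCocone i K X), ∃! l : Q ⟶ X, c.postcomp l = c'

/-- The lifting problems against the map to `X` from the relative latching object, in terms of the
latching cocone with vertex `X`. -/
def Lifts (c : LatchingCocone i K X) {Y Z : D ⥤ M} (p : Y ⟶ Z) : Prop :=
  ∀ (b : X ⟶ Z) (c' : LatchingCocone i K Y), c'.postcomp p = c.postcomp b →
    ∃ l : X ⟶ Y, l ≫ p = b ∧ c.postcomp l = c'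

lemma IsUniversal.hasLiftingProperty_iff {cQ : LatchingCocone i K Q} (hQ : cQ.IsUniversal)
    {c : LatchingCocone i K X} {φ : Q ⟶ X} (hφ : cQ.postcomp φ = c) {Y Z : D ⥤ M} (p : Y ⟶ Z) :
    HasLiftingProperty φ p ↔ c.Lifts p := by
  constructor
  · intro H b c' hc'
    obtain ⟨q, rfl, -⟩ := hQ c'
    have sq : CommSq q φ p b := ⟨(hQ (c.postcomp b)).unique (by rw [postcomp_comp, hc'])
      (by rw [postcomp_comp, hφ])⟩
    exact ⟨sq.lift, sq.fac_right, by rw [← hφ, ← postcomp_comp, sq.fac_left]⟩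
  · intro H
    refine ⟨fun {q b} sq => ?_⟩
    obtain ⟨l, hl, hl'⟩ := H b (cQ.postcomp q) (by
      rw [← hφ, ← postcomp_comp, ← postcomp_comp, sq.w])
    exact ⟨⟨⟨l, (hQ (cQ.postcomp q)).unique (by rw [postcomp_comp, hφ, hl']) rfl, hl⟩⟩⟩

section
variable [HasColimits M]

/-- The latching cocone determined by a commutative square under the latching objects. -/
noncomputable def ofSq (i : P.ι ⋙ A ⟶ E) (K : D ⥤ C) {Q : D ⥤ M}
    {inl : K ⋙ P.ι.lan.obj E ⟶ Q} {inr : K ⋙ A ⟶ Q}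
    (h : CommSq (Functor.whiskerLeft K (P.ι.lan.map i))
      (Functor.whiskerLeft K ((P.ι.lanAdjunction M).counit.app A)) inl inr) :
    LatchingCocone i K Q where
  base := inr
  incl z d h := KanExtension.lanι P.ι E h ≫ inl.app d
  map_incl k d h := by
    rw [KanExtension.map_lanι_assoc]
    rfl
  incl_map z d d' h e := by
    rw [Category.assoc, ← inl.naturality]
    exact KanExtension.lanι_lan_map_assoc _ _ _ _
  app_incl z d g := by
    rw [← KanExtension.lanι_lan_map_app_assoc]
    have := congr_app h.w d
    refine (congrArg (_ ≫ ·) this).trans ?_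
    exact KanExtension.lanι_lanAdjunction_counit_assoc (ι := P.ι) A (z := z) g _

lemma isUniversal_ofSq {i : P.ι ⋙ A ⟶ E} {K : D ⥤ C} {Q : D ⥤ M}
    {inl : K ⋙ P.ι.lan.obj E ⟶ Q} {inr : K ⋙ A ⟶ Q}
    (h : IsPushout (Functor.whiskerLeft K (P.ι.lan.map i))
      (Functor.whiskerLeft K ((P.ι.lanAdjunction M).counit.app A)) inl inr) :
    (ofSq i K h.toCommSq).IsUniversal := by
  intro X c
  have H (d : D) := KanExtension.exists_lan_desc (ι := P.ι) E (x := K.obj d) (fun z h => c.incl z d h)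
    -- The descents are chosen separately for each `d`; `incl_map` makes them natural in `d`.
    fun z z' k h => c.map_incl k h
  choose m hm using H
  let m' : K ⋙ P.ι.lan.obj E ⟶ X :=
    { app := m
      naturality d d' e := by
        refine KanExtension.lan_hom_ext _ fun z h => ?_
        rw [← Category.assoc, ← Category.assoc, hm, c.incl_map]
        exact (congrArg (· ≫ _) (KanExtension.lanι_lan_map E (K.map e) h)).trans (hm _ _ _) }
  have w : Functor.whiskerLeft K (P.ι.lan.map i) ≫ m' =
      Functor.whiskerLeft K ((P.ι.lanAdjunction M).counit.app A) ≫ c.base := by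
    ext d
    refine KanExtension.lan_hom_ext _ fun z g => ?_
    refine (KanExtension.lanι_lan_map_app_assoc _ _ _).trans ?_
    refine (congrArg (_ ≫ ·) (hm _ _ _)).trans ((c.app_incl z g).trans ?_)
    exact (KanExtension.lanι_lanAdjunction_counit_assoc (ι := P.ι) A (z := z) g _).symm
  refine ⟨h.desc m' c.base w, ?_, ?_⟩
  · ext1
    · exact h.inr_desc _ _ _
    · funext z d g
      refine (Category.assoc _ _ _).trans ((congrArg (_ ≫ ·) ?_).trans (hm d z g))
      exact congr_app (h.inl_desc _ _ w) d
  · intro l hl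
    refine h.hom_ext ?_ ?_
    · rw [h.inl_desc]
      ext d
      refine KanExtension.lan_hom_ext _ fun z g => ?_
      refine Eq.trans ?_ (hm d z g).symm
      rw [← hl]
      exact (Category.assoc _ _ _).symm
    · rw [h.inr_desc, ← hl]
      rfl

end

end LatchingCocone

end Cones

/-! ### The c-Reedy classes as lifting conditions on cones -/

namespace Stratification

variable {C : Type v} [SmallCategory C] (S : Stratification C) {M : Type u} [Category.{v} M]

section Elementary

variable (P : ObjectProperty C)

/-- The canonical matching cone of a morphism of diagrams. -/
@[simps]
def matchingCone {A B : C ⥤ M} (f : A ⟶ B) (x : C) :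
    MatchingCone (Functor.whiskerLeft P.ι f) x (A.obj x) where
  base := f.app x
  proj _ g := A.map g
  proj_map _ _ := (A.map_comp _ _).symm
  proj_app _ g := f.naturality g

/-- The canonical latching cocone of a morphism of diagrams. -/
def latchingCocone {A B : C ⥤ M} (f : A ⟶ B) {D : Type w} [Category.{w'} D] (K : D ⥤ C) :
    LatchingCocone (Functor.whiskerLeft P.ι f) K (K ⋙ B) where
  base := Functor.whiskerLeft K f
  incl _ _ h := B.map h
  map_incl _ _ _ := (B.map_comp _ _).symm
  incl_map _ _ _ _ _ := (B.map_comp _ _).symm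
  app_incl _ _ h := (f.naturality h).symm

end Elementary

section
variable [HasLimits M]

lemma hasLiftingProperty_matchingMap_iff {A B : C ⥤ M} (f : A ⟶ B) (x : C) {K L : M} (i : K ⟶ L) :
    HasLiftingProperty i (S.matchingMap f x) ↔
      (matchingCone (S.below (S.deg x)) f x).Lifts i := by
  refine MatchingCone.IsUniversal.hasLiftingProperty_iff (MatchingCone.isUniversal_ofSq
    (p := Functor.whiskerLeft (S.belowι (S.deg x)) f) (IsPullback.of_hasPullback _ _)) ?_ i
  ext z g
  · exact pullback.lift_snd _ _ _
  · refine (pullback.lift_fst_assoc _ _ _ _).trans ?_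
    exact KanExtension.ranAdjunction_unit_ranπ (ι := S.belowι _) A (z := z) g

/-- The equality `R.llp.rlp = R` turns membership in `R` into a lifting condition, which is
expressed by cones. -/
lemma cReedyR_iff {R : MorphismProperty M} (hR : R.llp.rlp = R) {A B : C ⥤ M} (f : A ⟶ B) :
    S.cReedyR R f ↔ ∀ (x : C) {K L : M} (i : K ⟶ L), R.llp i →
      (matchingCone (S.below (S.deg x)) f x).Lifts i := by
  simp_rw [← hasLiftingProperty_matchingMap_iff]
  refine forall_congr' fun x => ?_
  conv_lhs => rw [← hR]
  rfl

end

section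
variable [HasColimits M]

lemma hasLiftingProperty_latchingMap_iff (δ : Ordinal.{v}) {A B : C ⥤ M} (f : A ⟶ B)
    {D : Type w} [Category.{w'} D] (K : D ⥤ C) {X Y : D ⥤ M} (p : X ⟶ Y) :
    HasLiftingProperty (S.latchingMap δ K f) p ↔ (latchingCocone (S.below δ) f K).Lifts p := by
  refine LatchingCocone.IsUniversal.hasLiftingProperty_iff (LatchingCocone.isUniversal_ofSq
    (i := Functor.whiskerLeft (S.belowι δ) f) (IsPushout.of_hasPushout _ _)) ?_ p
  ext1
  · exact pushout.inr_desc _ _ _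
  · funext z d h
    have w : pushout.inl _ _ ≫ S.latchingMap δ K f =
      Functor.whiskerLeft K ((S.fromLatching δ).app B) := pushout.inl_desc _ _ _
    refine (Category.assoc _ _ _).trans
      ((congrArg (KanExtension.lanι (S.belowι δ) _ h ≫ ·) (congr_app w d)).trans ?_)
    exact KanExtension.lanι_lanAdjunction_counit (ι := S.belowι _) B (z := z) h

lemma projectiveL_latchingMap_iff (R : MorphismProperty M) (δ : Ordinal.{v}) {A B : C ⥤ M}
    (f : A ⟶ B) {D : Type w} [Category.{w'} D] (K : D ⥤ C) :
    projectiveL R D (S.latchingMap δ K f) ↔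
      ∀ {X Y : D ⥤ M} (p : X ⟶ Y), R.functorCategory D p →
        (latchingCocone (S.below δ) f K).Lifts p := by
  simp_rw [← hasLiftingProperty_latchingMap_iff]
  rfl

end

end Stratification

/-! ### Inverse systems indexed by ordinals -/

/-- Transfinite construction of an element of an inverse system of types indexed by ordinals. -/
lemma nonempty_of_transfinite {T : Ordinal.{v} → Type w}
    (r : ∀ {i j : Ordinal.{v}}, i ≤ j → T j → T i)
    (r_refl : ∀ {i : Ordinal.{v}} (x : T i), r le_rfl x = x)
    (r_trans : ∀ {i j k : Ordinal.{v}} (hij : i ≤ j) (hjk : j ≤ k) (x : T k),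
      r hij (r hjk x) = r (hij.trans hjk) x)
    (zero : Nonempty (T 0))
    (succ : ∀ (j : Ordinal.{v}) (x : T j), ∃ y : T (Order.succ j), r (Order.le_succ j) y = x)
    (limit : ∀ (j : Ordinal.{v}), Order.IsSuccLimit j → ∀ x : ∀ i, i < j → T i,
      (∀ (i k : Ordinal.{v}) (hk : k < j) (hik : i ≤ k), r hik (x k hk) = x i (hik.trans_lt hk)) →
      ∃ y : T j, ∀ (i : Ordinal.{v}) (hi : i < j), r hi.le y = x i hi) (β : Ordinal.{v}) :
    Nonempty (T β) := by
  let F : (Ordinal.{v})ᵒᵖ ⥤ Type w :=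
    { obj j := T j.unop
      map f := ↾ (r (leOfHom f.unop))
      map_id j := by ext x; exact r_refl x
      map_comp f g := by ext x; exact (r_trans _ _ x).symm }
  let d : F.WellOrderInductionData := .ofExists (fun j _ x => succ j x) fun j hj x => by
    obtain ⟨y, hy⟩ := limit j hj (fun i hi => x.val (op ⟨i, hi⟩)) fun i k hk hik =>
      x.property (Quiver.Hom.op (show (⟨i, hik.trans_lt hk⟩ : Set.Iio j) ⟶ ⟨k, hk⟩ from homOfLE hik))
    exact ⟨y, hy⟩
  -- Evaluation of compatible families at `⊥` is surjective, so an element of `T 0` extends to a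
  -- family over all ordinals; its member at `β` is the one wanted.
  obtain ⟨s, -⟩ := d.surjective (show F.obj (op ⊥) from zero.some)
  exact ⟨s.val (op β)⟩

/-! ### The relative matching object as a diagram -/

section RelMatching

variable {C : Type v} [SmallCategory C] {P : ObjectProperty C} {M : Type u} [Category.{v} M]
  [HasLimits M] {E : P.FullSubcategory ⥤ M} {B : C ⥤ M} (p : E ⟶ P.ι ⋙ B)

/-- The relative matching object of `p`, as a diagram on `C`. -/
noncomputable def relMatching : C ⥤ M :=
  pullback (P.ι.ran.map p) ((P.ι.ranAdjunction M).unit.app B)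

lemma isPullback_relMatching (x : C) :
    IsPullback ((pullback.fst (P.ι.ran.map p) ((P.ι.ranAdjunction M).unit.app B)).app x)
      ((pullback.snd (P.ι.ran.map p) ((P.ι.ranAdjunction M).unit.app B)).app x)
      ((P.ι.ran.map p).app x) (((P.ι.ranAdjunction M).unit.app B).app x) :=
  (IsPullback.of_hasPullback (P.ι.ran.map p) ((P.ι.ranAdjunction M).unit.app B)).map
    ((evaluation C M).obj x)

/-- The universal matching cone. -/
noncomputable def relMatchingCone (x : C) : MatchingCone p x ((relMatching p).obj x) :=
  MatchingCone.ofSq p (isPullback_relMatching p x).toCommSq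

lemma isUniversal_relMatchingCone (x : C) : (relMatchingCone p x).IsUniversal :=
  MatchingCone.isUniversal_ofSq (isPullback_relMatching p x)

lemma relMatching_map_base {x y : C} (k : x ⟶ y) :
    (relMatching p).map k ≫ (relMatchingCone p y).base =
      (relMatchingCone p x).base ≫ B.map k :=
  (pullback.snd (P.ι.ran.map p) ((P.ι.ranAdjunction M).unit.app B)).naturality k

lemma relMatching_map_proj {x y : C} (k : x ⟶ y) (z : P.FullSubcategory) (g : y ⟶ z.obj) :
    (relMatching p).map k ≫ (relMatchingCone p y).proj z g =
      (relMatchingCone p x).proj z (k ≫ g) := by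
  have h := (pullback.fst (P.ι.ran.map p) ((P.ι.ranAdjunction M).unit.app B)).naturality k
  refine (Category.assoc _ _ _).symm.trans ((congrArg (· ≫ _) h).trans ?_)
  refine (Category.assoc _ _ _).trans (congrArg (_ ≫ ·) ?_)
  exact KanExtension.ran_map_ranπ (ι := P.ι) E k (z := z) g

/-- The components are given by universality at each object. Naturality follows from uniqueness,
since both composites induce the same cone. -/
lemma exists_relMatching_lift {D : Type w} [Category.{w'} D] {K : D ⥤ C} {F : D ⥤ M}
    (c : ∀ d : D, MatchingCone p (K.obj d) (F.obj d))
    (base : ∀ {d d' : D} (e : d ⟶ d'), F.map e ≫ (c d').base = (c d).base ≫ B.map (K.map e))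
    (proj : ∀ {d d' : D} (e : d ⟶ d') (z : P.FullSubcategory) (g : K.obj d' ⟶ z.obj),
      F.map e ≫ (c d').proj z g = (c d).proj z (K.map e ≫ g)) :
    ∃ φ : F ⟶ K ⋙ relMatching p, ∀ d, (relMatchingCone p (K.obj d)).precomp (φ.app d) = c d := by
  choose φ hφ _ using fun d => isUniversal_relMatchingCone p (K.obj d) (c d)
  refine ⟨{ app := φ, naturality := fun d d' e => ?_ }, hφ⟩
  refine (isUniversal_relMatchingCone p (K.obj d') ((c d').precomp (F.map e))).unique ?_ ?_
  · exact (MatchingCone.precomp_comp _ _ _).trans (congrArg (MatchingCone.precomp · _) (hφ d'))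
  · ext z g
    · have := congrArg MatchingCone.base (hφ d)
      refine (Category.assoc _ _ _).trans ?_
      refine (congrArg (φ d ≫ ·) (relMatching_map_base p (K.map e))).trans ?_
      refine (Category.assoc _ _ _).symm.trans ((congrArg (· ≫ _) this).trans (base e).symm)
    · have := congrArg (fun c => c.proj z (K.map e ≫ g)) (hφ d)
      refine (Category.assoc _ _ _).trans ?_
      refine (congrArg (φ d ≫ ·) (relMatching_map_proj p (K.map e) z g)).trans ?_
      exact this.trans (proj e z g).symm

end RelMatching

/-! ### Lifts by transfinite induction on the degree -/

namespace Stratification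

variable {C : Type v} [SmallCategory C] {S : Stratification C} {M : Type u} [Category.{v} M]

/-- A lift, defined on the objects of degree less than both `β` and `δ`, in a square of diagrams. -/
structure PartialLift (S : Stratification C) {β : Ordinal.{v}} {A B X Y : C ⥤ M} (f : A ⟶ B)
    (p : X ⟶ Y) (a : S.belowι β ⋙ A ⟶ S.belowι β ⋙ X) (b : S.belowι β ⋙ B ⟶ S.belowι β ⋙ Y)
    (δ : Ordinal.{v}) where
  app (x : S.Below β) (hx : S.deg x.obj < δ) : B.obj x.obj ⟶ X.obj x.obj
  naturality {x y : S.Below β} (hx : S.deg x.obj < δ) (hy : S.deg y.obj < δ) (k : x ⟶ y) :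
    B.map k.hom ≫ app y hy = app x hx ≫ X.map k.hom
  fac_left (x : S.Below β) (hx : S.deg x.obj < δ) : f.app x.obj ≫ app x hx = a.app x
  fac_right (x : S.Below β) (hx : S.deg x.obj < δ) : app x hx ≫ p.app x.obj = b.app x

namespace PartialLift

variable {β : Ordinal.{v}} {A B X Y : C ⥤ M} {f : A ⟶ B} {p : X ⟶ Y}
  {a : S.belowι β ⋙ A ⟶ S.belowι β ⋙ X} {b : S.belowι β ⋙ B ⟶ S.belowι β ⋙ Y}

@[ext]
lemma ext {δ : Ordinal.{v}} {l l' : PartialLift S f p a b δ}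
    (h : ∀ x hx, l.app x hx = l'.app x hx) : l = l' := by
  cases l
  cases l'
  congr
  funext x hx
  exact h x hx

/-- Restriction of partial lifts. -/
def restrict {δ ε : Ordinal.{v}} (h : δ ≤ ε) (l : PartialLift S f p a b ε) :
    PartialLift S f p a b δ where
  app x hx := l.app x (hx.trans_le h)
  naturality _ _ k := l.naturality _ _ k
  fac_left x _ := l.fac_left x _
  fac_right x _ := l.fac_right x _

/-- The value at `x` is taken at the stage just after the degree of `x`; by compatibility any later
stage gives the same value, so naturality is checked at a stage containing both objects. -/
lemma exists_limit {δ : Ordinal.{v}} (hδ : Order.IsSuccLimit δ)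
    (l : ∀ i, i < δ → PartialLift S f p a b i)
    (hl : ∀ (i k : Ordinal.{v}) (hk : k < δ) (hik : i ≤ k),
      (l k hk).restrict hik = l i (hik.trans_lt hk)) :
    ∃ l' : PartialLift S f p a b δ, ∀ (i : Ordinal.{v}) (hi : i < δ), l'.restrict hi.le = l i hi := by
  have h₁ {j k : Ordinal.{v}} (hj : j < δ) (hk : k < δ) (x : S.Below β) (hij : S.deg x.obj < j)
      (hik : S.deg x.obj < k) : (l j hj).app x hij = (l k hk).app x hik := by
    wlog hjk : j ≤ k generalizing j k
    · exact (this hk hj hik hij (le_of_not_ge hjk)).symm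
    rw [← hl j k hk hjk]
    rfl
  refine ⟨{ app := fun x hx => (l _ (hδ.succ_lt hx)).app x (Order.lt_succ _)
            naturality := fun {x y} hx hy k => ?_
            fac_left := fun x hx => (l _ (hδ.succ_lt hx)).fac_left x _
            fac_right := fun x hx => (l _ (hδ.succ_lt hx)).fac_right x _ }, fun i hi => ?_⟩
  · have hm : max (S.deg x.obj) (S.deg y.obj) < δ := max_lt hx hy
    rw [h₁ _ (hδ.succ_lt hm) x _ (Order.lt_succ_of_le (le_max_left _ _)),
      h₁ _ (hδ.succ_lt hm) y _ (Order.lt_succ_of_le (le_max_right _ _))]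
    exact (l _ (hδ.succ_lt hm)).naturality _ _ k
  · ext x hx
    exact h₁ _ _ _ _ _

/-- The extension to degree `δ` is a diagonal `m` in a square over the stratum, from the relative
latching map of `f` to the relative matching map of `p`. The upper triangle contains naturality for
maps coming from lower degrees, the lower triangle contains it for maps going to lower degrees. Maps
inside degree `δ` are in the stratum or are composites of these two kinds. -/
lemma exists_succ [HasLimits M] (hS : S.HasThroughDecomposition) {R : MorphismProperty M}
    (hR : R.llp.rlp = R)
    (w : a ≫ Functor.whiskerLeft _ p = Functor.whiskerLeft _ f ≫ b)
    (hf : ∀ δ < β, ∀ {X Y : S.Stratum δ ⥤ M} (q : X ⟶ Y), R.functorCategory _ q →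
      (latchingCocone (S.below δ) f (S.stratumι δ)).Lifts q)
    (hp : ∀ x, S.deg x < β → ∀ {K L : M} (i : K ⟶ L), R.llp i →
      (matchingCone (S.below (S.deg x)) p x).Lifts i)
    {δ : Ordinal.{v}} (l : PartialLift S f p a b δ) :
    ∃ l' : PartialLift S f p a b (Order.succ δ), l'.restrict (Order.le_succ δ) = l := by
  -- All objects have degree less than `β`, so for `δ ≥ β` there is nothing new to define.
  by_cases hδ : δ < β
  swap
  · have h {x : S.Below β} : S.deg x.obj < δ := x.property.trans_le (le_of_not_gt hδ)
    exact ⟨{ app := fun x _ => l.app x h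
             naturality := fun _ _ k => l.naturality _ _ k
             fac_left := fun x _ => l.fac_left x _
             fac_right := fun x _ => l.fac_right x _ }, rfl⟩
  let st (d : S.Stratum δ) : S.Below β := ⟨d.obj, d.deg_obj.trans_lt hδ⟩
  let bl (z : S.Below δ) : S.Below β := ⟨z.obj, z.property.trans hδ⟩
  let π : S.belowι δ ⋙ X ⟶ S.belowι δ ⋙ Y := Functor.whiskerLeft _ p
  -- The bottom of the square, from `B` to the relative matching object of `p`.
  let c (d : S.Stratum δ) : MatchingCone π d.obj (B.obj d.obj) :=
    { base := b.app (st d)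
      proj z g := B.map g ≫ l.app (bl z) z.property
      proj_map {z z'} g k := by
        rw [Category.assoc]
        exact (congrArg (_ ≫ ·) (l.naturality (x := bl z) (y := bl z') z.property z'.property
          ⟨k.hom⟩).symm).trans (by simp)
      proj_app z g := by
        rw [Category.assoc]
        refine (congrArg (_ ≫ ·) (l.fac_right (bl z) z.property)).trans ?_
        exact b.naturality (X := st d) (Y := bl z) ⟨g⟩ }
  let cX (d : S.Stratum δ) : MatchingCone π d.obj (X.obj d.obj) :=
    matchingCone (S.below δ) p d.obj
  obtain ⟨β', hβ'⟩ := exists_relMatching_lift π (K := S.stratumι δ) (F := S.stratumι δ ⋙ B) c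
    (fun {d d'} e => b.naturality (X := st d) (Y := st d') ⟨e.1⟩)
    (fun e z g => (Category.assoc _ _ _).symm.trans (congrArg (· ≫ _) (B.map_comp _ _).symm))
  obtain ⟨q, hq⟩ := exists_relMatching_lift π (K := S.stratumι δ) (F := S.stratumι δ ⋙ X) cX
    (fun e => p.naturality e.1) (fun e z g => (X.map_comp _ _).symm)
  -- The right side `q` of the square is the relative matching map of `p`, which lies in `R`
  -- objectwise by `hp`.
  have hqR : R.functorCategory _ q := fun d => by
    rw [← hR]
    intro K L i hi
    refine (MatchingCone.IsUniversal.hasLiftingProperty_iff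
      (isUniversal_relMatchingCone π d.obj) (hq d) i).2 ?_
    have := hp d.obj (d.deg_obj.trans_lt hδ) i hi
    have key : ∀ ε (_ : ε = δ), (matchingCone (S.below ε) p d.obj).Lifts i →
        (matchingCone (S.below δ) p d.obj).Lifts i := by
      rintro _ rfl h
      exact h
    exact key _ d.deg_obj this
  -- The top of the square, from the relative latching object of `f` to `X`.
  let ca : LatchingCocone (Functor.whiskerLeft (S.below δ).ι f) (S.stratumι δ)
      (S.stratumι δ ⋙ X) :=
    { base :=
        { app d := a.app (st d)
          naturality d d' e := a.naturality (X := st d) (Y := st d') ⟨e.1⟩ }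
      incl z d h := l.app (bl z) z.property ≫ X.map h
      map_incl {z z'} k d h := by
        refine (Category.assoc _ _ _).symm.trans ?_
        refine (congrArg (· ≫ _) (l.naturality (x := bl z) (y := bl z') z.property z'.property
          ⟨k.hom⟩)).trans ?_
        simp
      incl_map z d d' h e := (Category.assoc _ _ _).trans (congrArg (_ ≫ ·) (X.map_comp _ _).symm)
      app_incl z d h := by
        refine (Category.assoc _ _ _).symm.trans ?_
        refine (congrArg (· ≫ _) (l.fac_left (bl z) z.property)).trans ?_
        exact (a.naturality (X := bl z) (Y := st d) ⟨h⟩).symm }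
  -- The square commutes because its two composites into the relative matching object have the same
  -- cone.
  obtain ⟨m, hm₁, hm₂⟩ := hf δ hδ q hqR β' ca (by
    ext1
    · ext d
      refine (isUniversal_relMatchingCone π d.obj ((cX d).precomp (a.app (st d)))).unique ?_ ?_
      · exact (MatchingCone.precomp_comp _ _ _).trans (congrArg (MatchingCone.precomp · _) (hq d))
      · refine (MatchingCone.precomp_comp _ _ _).trans
          ((congrArg (MatchingCone.precomp · _) (hβ' d)).trans ?_)
        ext z g
        · exact (congr_app w (st d)).symm
        · refine (Category.assoc _ _ _).symm.trans ?_
          refine (congrArg (· ≫ _) (f.naturality g).symm).trans ?_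
          refine (Category.assoc _ _ _).trans ?_
          refine (congrArg (_ ≫ ·) (l.fac_left (bl z) z.property)).trans ?_
          exact a.naturality (X := st d) (Y := bl z) ⟨g⟩
    · funext z d h
      refine (isUniversal_relMatchingCone π d.obj
        ((cX d).precomp (l.app (bl z) z.property ≫ X.map h))).unique ?_ ?_
      · exact (MatchingCone.precomp_comp _ _ _).trans (congrArg (MatchingCone.precomp · _) (hq d))
      · refine (MatchingCone.precomp_comp _ _ _).trans
          ((congrArg (MatchingCone.precomp · _) (hβ' d)).trans ?_)
        ext z' g
        · refine (b.naturality (X := bl z) (Y := st d) ⟨h⟩).trans ?_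
          refine (congrArg (· ≫ _) (l.fac_right (bl z) z.property).symm).trans ?_
          refine (Category.assoc _ _ _).trans ((congrArg (_ ≫ ·) (p.naturality h).symm).trans ?_)
          exact (Category.assoc _ _ _).symm
        · refine (Category.assoc _ _ _).symm.trans ?_
          refine (congrArg (· ≫ _) (B.map_comp h g).symm).trans ?_
          refine (l.naturality (x := bl z) (y := bl z') z.property z'.property ⟨h ≫ g⟩).trans ?_
          refine (congrArg (_ ≫ ·) (X.map_comp h g)).trans ?_
          exact (Category.assoc _ _ _).symm)
  have m_base (d : S.Stratum δ) : f.app d.obj ≫ m.app d = a.app (st d) :=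
    congr_app (congrArg LatchingCocone.base hm₂) d
  have m_incl (z : S.Below δ) (d : S.Stratum δ) (h : z.obj ⟶ d.obj) :
      B.map h ≫ m.app d = l.app (bl z) z.property ≫ X.map h :=
    congrArg (fun c => c.incl z d h) hm₂
  have m_cone (d : S.Stratum δ) : (cX d).precomp (m.app d) = c d := by
    rw [← hq d, ← hβ' d, ← hm₁]
    exact (MatchingCone.precomp_comp _ _ _).symm
  have m_right (d : S.Stratum δ) : m.app d ≫ p.app d.obj = b.app (st d) :=
    congrArg MatchingCone.base (m_cone d)
  have m_proj (d : S.Stratum δ) (z : S.Below δ) (g : d.obj ⟶ z.obj) :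
      m.app d ≫ X.map g = B.map g ≫ l.app (bl z) z.property :=
    congrArg (fun c => c.proj z g) (m_cone d)
  let st' (x : S.Below β) (hx : S.deg x.obj < Order.succ δ) (h : ¬ S.deg x.obj < δ) :
      S.Stratum δ := ⟨x.obj, le_antisymm (Order.lt_succ_iff.1 hx) (le_of_not_gt h)⟩
  let l' (x : S.Below β) (hx : S.deg x.obj < Order.succ δ) : B.obj x.obj ⟶ X.obj x.obj :=
    if h : S.deg x.obj < δ then l.app x h else m.app (st' x hx h)
  have l'_lt (x : S.Below β) (hx : S.deg x.obj < Order.succ δ) (h : S.deg x.obj < δ) :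
    l' x hx = l.app x h := dif_pos h
  have l'_eq (x : S.Below β) (hx : S.deg x.obj < Order.succ δ) (h : ¬ S.deg x.obj < δ) :
    l' x hx = m.app (st' x hx h) := dif_neg h
  refine ⟨{ app := l'
            naturality := fun {x y} hx hy k => ?_
            fac_left := fun x hx => ?_
            fac_right := fun x hx => ?_ }, ?_⟩
  · by_cases h : S.deg x.obj < δ <;> by_cases h' : S.deg y.obj < δ
    · rw [l'_lt x hx h, l'_lt y hy h']
      exact l.naturality h h' k
    · rw [l'_lt x hx h, l'_eq y hy h']
      exact m_incl ⟨x.obj, h⟩ (st' y hy h') k.hom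
    · rw [l'_eq x hx h, l'_lt y hy h']
      exact (m_proj (st' x hx h) ⟨y.obj, h'⟩ k.hom).symm
    · rw [l'_eq x hx h, l'_eq y hy h']
      by_cases hk : S.inStratum k.hom
      · exact m.naturality (X := st' x hx h) (Y := st' y hy h') ⟨k.hom, hk⟩
      -- Outside the stratum, `k` factors through some `z` of smaller degree; `m_incl` and `m_proj`
      -- both express compatibility with the given lift at `z`.
      · have e₁ := (st' x hx h).deg_obj
        have e₂ := (st' y hy h').deg_obj
        obtain ⟨z, g, g', hz, e⟩ := hS.exists_fac k.hom (e₁.trans e₂.symm) hk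
        have hz' : S.deg z < δ := hz.trans_eq e₁
        rw [← e, Functor.map_comp, Functor.map_comp]
        refine (Category.assoc _ _ _).trans ?_
        refine (congrArg (_ ≫ ·) (m_incl ⟨z, hz'⟩ (st' y hy h') g')).trans ?_
        refine (Category.assoc _ _ _).symm.trans ?_
        refine (congrArg (· ≫ _) (m_proj (st' x hx h) ⟨z, hz'⟩ g).symm).trans ?_
        exact Category.assoc _ _ _
  · by_cases h : S.deg x.obj < δ
    · rw [l'_lt x hx h]
      exact l.fac_left x h
    · rw [l'_eq x hx h]
      exact m_base (st' x hx h)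
  · by_cases h : S.deg x.obj < δ
    · rw [l'_lt x hx h]
      exact l.fac_right x h
    · rw [l'_eq x hx h]
      exact m_right (st' x hx h)
  · ext x hx
    exact l'_lt x (hx.trans (Order.lt_succ δ)) hx

end PartialLift

/-- The horizontal maps `a` and `b` need to exist only over `C_β`: for the latching object at an `x`
of degree `β`, the square obtained by adjunction is defined only there. -/
theorem HasThroughDecomposition.exists_lift_below [HasLimits M] (hS : S.HasThroughDecomposition)
    {R : MorphismProperty M} (hR : R.llp.rlp = R) {β : Ordinal.{v}} {A B X Y : C ⥤ M} {f : A ⟶ B}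
    {p : X ⟶ Y} {a : S.belowι β ⋙ A ⟶ S.belowι β ⋙ X} {b : S.belowι β ⋙ B ⟶ S.belowι β ⋙ Y}
    (w : a ≫ Functor.whiskerLeft _ p = Functor.whiskerLeft _ f ≫ b)
    (hf : ∀ δ < β, ∀ {X Y : S.Stratum δ ⥤ M} (q : X ⟶ Y), R.functorCategory _ q →
      (latchingCocone (S.below δ) f (S.stratumι δ)).Lifts q)
    (hp : ∀ x, S.deg x < β → ∀ {K L : M} (i : K ⟶ L), R.llp i →
      (matchingCone (S.below (S.deg x)) p x).Lifts i) :
    ∃ l : S.belowι β ⋙ B ⟶ S.belowι β ⋙ X,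
      Functor.whiskerLeft _ f ≫ l = a ∧ l ≫ Functor.whiskerLeft _ p = b := by
  obtain ⟨l⟩ := nonempty_of_transfinite (T := PartialLift S f p a b)
    (fun h l => l.restrict h) (fun _ => rfl) (fun _ _ _ => rfl)
    ⟨{ app := fun x hx => (not_lt_zero hx).elim
       naturality := fun hx => (not_lt_zero hx).elim
       fac_left := fun x hx => (not_lt_zero hx).elim
       fac_right := fun x hx => (not_lt_zero hx).elim }⟩
    (fun _ l => l.exists_succ hS hR w hf hp) (fun _ hδ => PartialLift.exists_limit hδ) β
  refine ⟨{ app := fun x => l.app x x.property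
            naturality := fun x y k => l.naturality _ _ k }, ?_, ?_⟩
  · ext x
    exact l.fac_left x x.property
  · ext x
    exact l.fac_right x x.property

end Stratification

/-! ### Injections and surjections of sets -/

section TypeLifting

lemma hasLiftingProperty_of_mono_of_epi {K L X Y : Type v} (i : K ⟶ L) (p : X ⟶ Y) (hi : Mono i)
    (hp : Epi p) : HasLiftingProperty i p := by
  classical
  rw [mono_iff_injective] at hi
  rw [epi_iff_surjective] at hp
  refine ⟨fun {t s} sq => ?_⟩
  choose r hr using hp
  let l : L → X := fun y => if h : ∃ k, i k = y then t h.choose else r (s y)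
  have l_eq (k : K) : l (i k) = t k := by
    have h : ∃ k', i k' = i k := ⟨k, rfl⟩
    exact (dif_pos h).trans (congrArg _ (hi h.choose_spec))
  refine ⟨⟨⟨↾ l, ?_, ?_⟩⟩⟩
  · ext k
    exact l_eq k
  · ext y
    change p (l y) = s y
    by_cases h : ∃ k, i k = y
    · obtain ⟨k, rfl⟩ := h
      rw [l_eq]
      exact ConcreteCategory.congr_hom sq.w k
    · exact (congrArg p (dif_neg h)).trans (hr _)

/-- Surjectivity is the right lifting property against the single injection `∅ ⟶ 1`. -/
lemma epimorphisms_llp_rlp : (MorphismProperty.epimorphisms (Type v)).llp.rlp =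
    MorphismProperty.epimorphisms (Type v) := by
  refine le_antisymm (fun X Y p hp => ?_) (MorphismProperty.le_llp_iff_le_rlp _ _ |>.1 le_rfl)
  change Epi p
  rw [epi_iff_surjective]
  intro y
  let i : (PEmpty.{v + 1} : Type v) ⟶ (PUnit.{v + 1} : Type v) := ↾ PEmpty.elim
  have : HasLiftingProperty i p := hp i fun X' Y' p' (hp' : Epi p') =>
    hasLiftingProperty_of_mono_of_epi i p' ((mono_iff_injective i).2 fun x => x.elim) hp'
  have sq : CommSq (↾ PEmpty.elim) i p (↾ fun _ => y) := ⟨by ext x; exact x.elim⟩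
  exact ⟨sq.lift PUnit.unit, ConcreteCategory.congr_hom sq.fac_right PUnit.unit⟩

end TypeLifting

/-! ### Matching functors preserve right maps, latching functors preserve left maps -/

namespace Stratification

variable {C : Type v} [SmallCategory C] {S : Stratification C} {M : Type u} [Category.{v} M]

section Matching

/-- The diagram of commutative squares from `i` to the components of `f`. -/
def squares {C : Type v} [SmallCategory C] {K L : M} (i : K ⟶ L) {A B : C ⥤ M} (f : A ⟶ B) :
    C ⥤ Type v where
  obj z := { q : (K ⟶ A.obj z) × (L ⟶ B.obj z) // q.1 ≫ f.app z = i ≫ q.2 }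
  map k := ↾ fun q => ⟨(q.1.1 ≫ A.map k, q.1.2 ≫ B.map k), by
    rw [Category.assoc, f.naturality, ← Category.assoc, q.2, Category.assoc]⟩
  map_id z := by ext q <;> simp
  map_comp k k' := by ext q <;> simp

/-- The map from diagonals to commutative squares. -/
def diagonalsToSquares {C : Type v} [SmallCategory C] {K L : M} (i : K ⟶ L) {A B : C ⥤ M}
    (f : A ⟶ B) : A ⋙ coyoneda.obj (op L) ⟶ squares i f where
  app z := ↾ fun l => ⟨(i ≫ l, l ≫ f.app z), Category.assoc _ _ _⟩
  naturality z z' k := by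
    refine ConcreteCategory.hom_ext _ _ fun l => Subtype.ext (Prod.ext ?_ ?_)
    · exact (Category.assoc i l (A.map k)).symm
    · exact (Category.assoc _ _ _).trans
        ((congrArg (l ≫ ·) (f.naturality k)).trans (Category.assoc _ _ _).symm)

/-- The relative matching object at `y` of the map from diagonals to squares is the set of squares
from `i` to the relative matching map of `f`. The relative matching map is therefore surjective as
soon as `i` lifts against that of `f`. -/
lemma lifts_diagonalsToSquares {C : Type v} [SmallCategory C] {K L : M} (i : K ⟶ L) {A B : C ⥤ M}
    (f : A ⟶ B) (P : ObjectProperty C) (y : C) (h : (matchingCone P f y).Lifts i)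
    {K' L' : Type v} (j : K' ⟶ L') (hj : (MorphismProperty.epimorphisms (Type v)).llp j) :
    (matchingCone P (diagonalsToSquares i f) y).Lifts j := by
  intro t c hc
  -- A solution over `a` is a diagonal in the square encoded by `c` at `a`. The pairs of an `a` and
  -- a solution surject onto `L'` by `h`, and lifting `j` against this surjection chooses solutions
  -- extending the prescribed ones.
  let sol (a : L') (l : L ⟶ A.obj y) : Prop :=
    (diagonalsToSquares i f).app y l = c.base a ∧ ∀ z g, l ≫ A.map g = c.proj z g a
  let e : ({ q : L' × (L ⟶ A.obj y) // sol q.1 q.2 } : Type v) ⟶ L' := ↾ fun q => q.1.1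
  have he : Epi e := by
    rw [epi_iff_surjective]
    intro a
    obtain ⟨l, hl, hl'⟩ := h (c.base a).1.1
      { base := (c.base a).1.2
        proj := fun z g => c.proj z g a
        proj_map := fun {z z'} g k => ConcreteCategory.congr_hom (c.proj_map g k) a
        proj_app := fun z g =>
          congrArg (fun q => q.1.2) (ConcreteCategory.congr_hom (c.proj_app z g) a) } (by
        ext z g
        · exact (c.base a).2
        · exact (congrArg (fun q => q.1.1) (ConcreteCategory.congr_hom (c.proj_app z g) a)).symm)
    refine ⟨⟨(a, l), Subtype.ext (Prod.ext hl (congrArg MatchingCone.base hl')), fun z g => ?_⟩,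
      rfl⟩
    exact congrArg (fun c => c.proj z g) hl'
  have := hj e he
  have sq : CommSq (↾ fun k => ⟨(j k, t k), ConcreteCategory.congr_hom
      (congrArg MatchingCone.base hc) k, fun z g => ConcreteCategory.congr_hom
      (congrArg (fun c => c.proj z g) hc) k⟩) j e (𝟙 L') := ⟨by ext; rfl⟩
  have h' (a : L') : (sq.lift a).1.1 = a := by
    have := ConcreteCategory.congr_hom sq.fac_right a
    exact this
  refine ⟨sq.lift ≫ ↾ fun q => q.1.2, ?_, ?_⟩
  · rw [sq.fac_left_assoc]
    rfl
  · ext1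
    · exact ConcreteCategory.hom_ext _ _ fun a => (sq.lift a).2.1.trans (congrArg _ (h' a))
    · funext z g
      exact ConcreteCategory.hom_ext _ _ fun a =>
        ((sq.lift a).2.2 z g).trans (congrArg _ (h' a))

/-- The matching object functor at `x` preserves the right maps. -/
lemma matching_map_app_mem [HasLimits M] (hS : S.HasThroughDecomposition) (x : C)
    (hx : (S.restrict (S.deg x)).cReedyL (MorphismProperty.epimorphisms (Type v))
      (initial.to (S.belowι (S.deg x) ⋙ CategoryTheory.coyoneda.obj (op x))))
    {R : MorphismProperty M} (hR : R.llp.rlp = R) {A B : C ⥤ M} (f : A ⟶ B)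
    (hf : ∀ y, S.deg y < S.deg x → ∀ {K L : M} (i : K ⟶ L), R.llp i →
      (matchingCone (S.below (S.deg y)) f y).Lifts i) :
    R (((S.matching (S.deg x)).map f).app x) := by
  rw [← hR]
  intro K L i hi
  refine ⟨fun {t s} sq => ?_⟩
  let β := S.deg x
  let W : S.Below β ⥤ Type v := S.belowι β ⋙ CategoryTheory.coyoneda.obj (op x)
  let φ : S.belowι β ⋙ A ⟶ S.belowι β ⋙ B := Functor.whiskerLeft _ f
  let q := diagonalsToSquares i φ
  let tπ (z : S.Below β) (g : x ⟶ z.obj) : K ⟶ A.obj z.obj :=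
    t ≫ KanExtension.ranπ (S.belowι β) (S.belowι β ⋙ A) g
  let sπ (z : S.Below β) (g : x ⟶ z.obj) : L ⟶ B.obj z.obj :=
    s ≫ KanExtension.ranπ (S.belowι β) (S.belowι β ⋙ B) g
  have tπ_map {z z' : S.Below β} (g : x ⟶ z.obj) (k : z ⟶ z') :
      tπ z g ≫ A.map k.hom = tπ z' (g ≫ k.hom) :=
    (Category.assoc _ _ _).trans (congrArg (t ≫ ·) (KanExtension.ranπ_map _ _ _))
  have sπ_map {z z' : S.Below β} (g : x ⟶ z.obj) (k : z ⟶ z') :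
      sπ z g ≫ B.map k.hom = sπ z' (g ≫ k.hom) :=
    (Category.assoc _ _ _).trans (congrArg (s ≫ ·) (KanExtension.ranπ_map _ _ _))
  -- A square from `i` to `M_x f` is a natural family of squares from `i` to the components of `f`,
  -- indexed by `C(x,-)` on `C_β`.
  let b : W ⟶ squares i φ :=
    { app z := ↾ fun g => ⟨(tπ z g, sπ z g), by
        have h := KanExtension.ran_map_app_ranπ φ (ι := S.belowι β) (z := z) g
        refine (Category.assoc _ _ _).trans ((congrArg (t ≫ ·) h.symm).trans ?_)
        refine (Category.assoc _ _ _).symm.trans ((congrArg (· ≫ _) sq.w).trans ?_)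
        exact Category.assoc _ _ _⟩
      naturality z z' k := by
        exact ConcreteCategory.hom_ext _ _ fun g =>
          Subtype.ext (Prod.ext (tπ_map g k).symm (sπ_map g k).symm) }
  -- The objects of `C_β` of degree below that of `y` are the same as those of `C`, so cones only
  -- have to be repackaged between iterated full subcategories.
  have hq (y : S.Below β) {K' L' : Type v} (j : K' ⟶ L')
      (hj : (MorphismProperty.epimorphisms (Type v)).llp j) :
      (matchingCone ((S.restrict β).below ((S.restrict β).deg y)) q y).Lifts j := by
    refine lifts_diagonalsToSquares i φ _ y ?_ j hj
    intro t' c' hc'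
    obtain ⟨l, hl, hl'⟩ := hf y.obj y.property i hi t'
      { base := c'.base
        proj := fun z g => c'.proj ⟨⟨z.obj, z.property.trans y.property⟩, z.property⟩ ⟨g⟩
        proj_map := fun {z z'} g k => c'.proj_map
          (z := ⟨⟨z.obj, z.property.trans y.property⟩, z.property⟩)
          (z' := ⟨⟨z'.obj, z'.property.trans y.property⟩, z'.property⟩) ⟨g⟩ ⟨⟨k.hom⟩⟩
        proj_app := fun z g => c'.proj_app
          ⟨⟨z.obj, z.property.trans y.property⟩, z.property⟩ ⟨g⟩ } (by
        ext z g
        · have := congrArg MatchingCone.base hc'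
          exact this
        · have := congrArg (fun c =>
            c.proj ⟨⟨z.obj, z.property.trans y.property⟩, z.property⟩ ⟨g⟩) hc'
          exact this)
    refine ⟨l, hl, ?_⟩
    ext z g
    · have := congrArg MatchingCone.base hl'
      exact this
    · have := congrArg (fun c => c.proj ⟨z.obj.obj, z.property⟩ g.hom) hl'
      exact this
  -- This is where the condition on `C(x,-)` is used: `∅ ⟶ C(x,-)` lifts against `q`. The lift
  -- chooses a diagonal for each `x ⟶ z`, naturally in `z`, which is a map from `L` to `M_x A`.
  obtain ⟨r, -, hr⟩ := (hS.restrict β).exists_lift_below epimorphisms_llp_rlp (β := β)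
    (f := initial.to W) (p := q) (a := Functor.whiskerLeft _ (initial.to _))
    (b := Functor.whiskerLeft _ b)
    (by rw [← Functor.whiskerLeft_comp, ← Functor.whiskerLeft_comp]
        exact congrArg _ (initial.hom_ext _ _))
    (fun δ _ => ((S.restrict β).projectiveL_latchingMap_iff _ δ _ _).1 (hx δ))
    (fun y _ => hq y)
  let rr (z : S.Below β) (g : x ⟶ z.obj) : L ⟶ A.obj z.obj := r.app ⟨z, z.property⟩ g
  have rr_eq (z : S.Below β) (g : x ⟶ z.obj) : q.app z (rr z g) = b.app z g :=
    ConcreteCategory.congr_hom (congr_app hr ⟨z, z.property⟩) g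
  have rr_map {z z' : S.Below β} (g : x ⟶ z.obj) (k : z ⟶ z') :
      rr z g ≫ A.map k.hom = rr z' (g ≫ k.hom) :=
    (ConcreteCategory.congr_hom (r.naturality
      (X := ⟨z, z.property⟩) (Y := ⟨z', z'.property⟩) ⟨k⟩) g).symm
  obtain ⟨l, hl⟩ := KanExtension.exists_ran_lift (ι := S.belowι β) (S.belowι β ⋙ A) rr
    fun z z' g k => rr_map g k
  refine ⟨⟨⟨l, ?_, ?_⟩⟩⟩
  · refine KanExtension.ran_hom_ext (ι := S.belowι β) _ fun z g => ?_
    refine (Category.assoc _ _ _).trans ((congrArg (i ≫ ·) (hl z g)).trans ?_)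
    exact congrArg (fun q => q.1.1) (rr_eq z g)
  · refine KanExtension.ran_hom_ext (ι := S.belowι β) _ fun z g => ?_
    refine (Category.assoc _ _ _).trans
      ((congrArg (l ≫ ·) (KanExtension.ran_map_app_ranπ φ (ι := S.belowι β) (z := z) g)).trans ?_)
    refine (Category.assoc _ _ _).symm.trans ((congrArg (· ≫ _) (hl z g)).trans ?_)
    exact congrArg (fun q => q.1.2) (rr_eq z g)

end Matching

section Latching

variable [HasLimits M]

/-- The diagram of powers of `X` by the sets `C(-,x)`. -/
noncomputable def powers (x : C) (X : M) : C ⥤ M where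
  obj y := ∏ᶜ fun _ : y ⟶ x => X
  map k := Pi.lift fun h => Pi.π _ (k ≫ h)
  map_id y := by ext; simp
  map_comp k k' := by ext; simp

/-- The projections of the powers of `X`. -/
noncomputable def powersπ {x : C} (X : M) {y : C} (h : y ⟶ x) : (powers x X).obj y ⟶ X :=
  Pi.π (fun _ : y ⟶ x => X) h

lemma powers_map_powersπ {x : C} (X : M) {y y' : C} (k : y ⟶ y') (h : y' ⟶ x) :
    (powers x X).map k ≫ powersπ X h = powersπ X (k ≫ h) := Pi.lift_π _ _

lemma powers_map_powersπ_assoc {x : C} (X : M) {y y' : C} (k : y ⟶ y') (h : y' ⟶ x) {T : M}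
    (t : X ⟶ T) : (powers x X).map k ≫ powersπ X h ≫ t = powersπ X (k ≫ h) ≫ t := by
  rw [← Category.assoc, powers_map_powersπ]

lemma powers_hom_ext {x y : C} {X T : M} {l l' : T ⟶ (powers x X).obj y}
    (h : ∀ k : y ⟶ x, l ≫ powersπ X k = l' ≫ powersπ X k) : l = l' := Pi.hom_ext _ _ h

/-- The universal property of the powers of `X`. -/
noncomputable def powersLift {x y : C} {X T : M} (l : (y ⟶ x) → (T ⟶ X)) :
    T ⟶ (powers x X).obj y := Pi.lift l

lemma powersLift_powersπ {x y : C} {X T : M} (l : (y ⟶ x) → (T ⟶ X)) (h : y ⟶ x) :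
    powersLift l ≫ powersπ X h = l h := Pi.lift_π _ _

lemma powersLift_powersπ_assoc {x y : C} {X T : M} (l : (y ⟶ x) → (T ⟶ X)) (h : y ⟶ x) {T' : M}
    (t : X ⟶ T') : powersLift l ≫ powersπ X h ≫ t = l h ≫ t := by
  rw [← Category.assoc, powersLift_powersπ]

/-- Functoriality of powers in the base. -/
noncomputable def powersMap (x : C) {X Y : M} (p : X ⟶ Y) : powers x X ⟶ powers x Y where
  app y := powersLift fun h => powersπ X h ≫ p
  naturality y y' k := powers_hom_ext fun h => by
    rw [Category.assoc, Category.assoc, powersLift_powersπ, powers_map_powersπ,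
      powersLift_powersπ, powers_map_powersπ_assoc]

lemma powersMap_app_powersπ (x : C) {X Y : M} (p : X ⟶ Y) {y : C} (h : y ⟶ x) :
    (powersMap x p).app y ≫ powersπ Y h = powersπ X h ≫ p := powersLift_powersπ _ _

/-- The condition on `C(-,x)` says that the maps `y ⟶ x` passing through lower degrees, taken up to
zigzag, inject into `C(y,x)`. On the image of this injection the diagonals `L ⟶ X` are prescribed by
`c`; on the rest they can be chosen freely, since `i` lifts against `p`. -/
lemma lifts_powersMap (x : C)
    (hx : (S.restrict (S.deg x)).cReedyR (MorphismProperty.monomorphisms (Type v)).op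
      (terminal.from ((S.belowι (S.deg x)).op ⋙ CategoryTheory.yoneda.obj x).rightOp))
    {X Y : M} (p : X ⟶ Y) (y : C) (hy : S.deg y < S.deg x) {K L : M} (i : K ⟶ L)
    (hi : HasLiftingProperty i p) :
    (matchingCone (S.below (S.deg y)) (powersMap x p) y).Lifts i := by
  intro t c hc
  let F := ((S.belowι (S.deg x)).op ⋙ CategoryTheory.yoneda.obj x).rightOp
  let Sq : Type v := { q : (K ⟶ X) × (L ⟶ Y) // q.1 ≫ p = i ≫ q.2 }
  -- The map from diagonals to squares, surjective because `i` lifts against `p`.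
  let e : (L ⟶ X : Type v) ⟶ Sq := ↾ fun l => ⟨(i ≫ l, l ≫ p), Category.assoc _ _ _⟩
  have he : Epi e := by
    rw [epi_iff_surjective]
    rintro ⟨⟨k, s⟩, hks⟩
    have sq : CommSq k i p s := ⟨hks⟩
    exact ⟨sq.lift, Subtype.ext (Prod.ext sq.fac_left sq.fac_right)⟩
  let y' : S.Below (S.deg x) := ⟨y, hy⟩
  -- Passing from `Set^op` to `Set` exchanges the roles: an injection is lifted against the
  -- surjection `e`.
  have lp : HasLiftingProperty e.op ((S.restrict (S.deg x)).matchingMap (terminal.from F) y') := by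
    rw [HasLiftingProperty.iff_unop]
    exact hasLiftingProperty_of_mono_of_epi _ _ (hx y') he
  rw [hasLiftingProperty_matchingMap_iff] at lp
  have hterm (z : S.Below (S.deg x)) :
      IsTerminal ((⊤_ (S.Below (S.deg x) ⥤ (Type v)ᵒᵖ)).obj z) :=
    terminalIsTerminal.isTerminalObj ((evaluation _ _).obj z)
  have w (h : y ⟶ x) : (t ≫ powersπ X h) ≫ p = i ≫ c.base ≫ powersπ Y h := by
    have := congrArg (· ≫ powersπ Y h) (congrArg MatchingCone.base hc)
    simpa [powersMap_app_powersπ] using this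
  have w' (z : S.Below (S.deg y)) (g : y ⟶ z.obj) (h : z.obj ⟶ x) :
      t ≫ powersπ X (g ≫ h) = i ≫ c.proj z g ≫ powersπ X h := by
    have := congrArg (· ≫ powersπ X h) (congrArg (fun c => c.proj z g) hc)
    refine Eq.trans ?_ (this.trans (Category.assoc _ _ _))
    exact (congrArg (t ≫ ·) (powers_map_powersπ X g h).symm).trans (Category.assoc _ _ _).symm
  have w'' (z : S.Below (S.deg y)) (g : y ⟶ z.obj) (h : z.obj ⟶ x) :
      (c.proj z g ≫ powersπ X h) ≫ p = c.base ≫ powersπ Y (g ≫ h) := by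
    have := congrArg (· ≫ powersπ Y h) (c.proj_app z g)
    refine Eq.trans ?_ (this.trans ?_)
    · refine (Category.assoc _ _ _).trans
        ((congrArg (_ ≫ ·) (powersMap_app_powersπ x p h).symm).trans ?_)
      exact (Category.assoc _ _ _).symm
    · exact (Category.assoc _ _ _).trans (congrArg (_ ≫ ·) (powers_map_powersπ Y g h))
  have w₃ {z z' : S.Below (S.deg y)} (g : y ⟶ z.obj) (k : z ⟶ z') (h : z'.obj ⟶ x) :
      c.proj z g ≫ powersπ X (k.hom ≫ h) = c.proj z' (g ≫ k.hom) ≫ powersπ X h := by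
    have := congrArg (· ≫ powersπ X h) (c.proj_map g k)
    refine Eq.trans ?_ this
    refine (congrArg (_ ≫ ·) (powers_map_powersπ X k.hom h).symm).trans ?_
    exact (Category.assoc _ _ _).symm
  -- In `Set` this sends `h : y ⟶ x` to its square. The cone supplied next prescribes the diagonals
  -- of the composites through lower degrees, and `l` then becomes a choice `ll` of diagonals for
  -- all `h`.
  let t' : op Sq ⟶ F.obj y' :=
    Quiver.Hom.op (↾ fun h : y ⟶ x => (⟨(t ≫ powersπ X h, c.base ≫ powersπ Y h), w h⟩ : Sq))
  obtain ⟨l, hl, hl'⟩ := lp t'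
    { base := (hterm y').from _
      proj := fun z g =>
        Quiver.Hom.op (↾ fun h => c.proj ⟨z.obj.obj, z.property⟩ g.hom ≫ powersπ X h)
      proj_map := fun {z z'} g k => Quiver.Hom.unop_inj (by
        ext h
        exact w₃ (z := ⟨z.obj.obj, z.property⟩) (z' := ⟨z'.obj.obj, z'.property⟩) g.hom
          ⟨k.hom.hom⟩ h)
      proj_app := fun z g => (hterm _).hom_ext _ _ } (by
    ext1
    · exact (hterm _).hom_ext _ _
    · funext z g
      refine Quiver.Hom.unop_inj (ConcreteCategory.hom_ext _ _ fun h => Subtype.ext ?_)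
      refine Prod.ext ?_ ?_
      · exact w' ⟨z.obj.obj, z.property⟩ g.hom h
      · exact (w'' ⟨z.obj.obj, z.property⟩ g.hom h).symm)
  let ll (h : y ⟶ x) : L ⟶ X := l.unop h
  have hl₁ (h : y ⟶ x) : e (ll h) = ⟨(t ≫ powersπ X h, c.base ≫ powersπ Y h), w h⟩ := by
    have := congrArg Quiver.Hom.unop hl
    exact ConcreteCategory.congr_hom this h
  have hl₂ (z : S.Below (S.deg y)) (g : y ⟶ z.obj) (h : z.obj ⟶ x) :
      ll (g ≫ h) = c.proj z g ≫ powersπ X h := by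
    have := congrArg Quiver.Hom.unop (congrArg (fun c => c.proj
      ⟨⟨z.obj, z.property.trans hy⟩, z.property⟩ ⟨g⟩) hl')
    exact ConcreteCategory.congr_hom this h
  refine ⟨powersLift ll, ?_, ?_⟩
  · refine powers_hom_ext fun h => ?_
    rw [Category.assoc, powersLift_powersπ]
    exact congrArg (fun q => q.1.1) (hl₁ h)
  · ext1
    · refine powers_hom_ext fun h => ?_
      have := congrArg (fun q => q.1.2) (hl₁ h)
      simp only [MatchingCone.precomp_base, matchingCone_base, Category.assoc,
        powersMap_app_powersπ, powersLift_powersπ_assoc]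
      exact this
    · funext z g
      refine powers_hom_ext fun h => ?_
      refine (Category.assoc _ _ _).trans
        ((congrArg (_ ≫ ·) (powers_map_powersπ X g h)).trans ?_)
      exact (powersLift_powersπ ll _).trans (hl₂ z g h)

/-- The latching object functor at `x` preserves the left maps. -/
lemma latching_map_app_mem [HasColimits M] (hS : S.HasThroughDecomposition) (x : C)
    (hx : (S.restrict (S.deg x)).cReedyR (MorphismProperty.monomorphisms (Type v)).op
      (terminal.from ((S.belowι (S.deg x)).op ⋙ CategoryTheory.yoneda.obj x).rightOp))
    {R : MorphismProperty M} (hR : R.llp.rlp = R) {A B : C ⥤ M} (f : A ⟶ B)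
    (hf : ∀ δ < S.deg x, ∀ {X Y : S.Stratum δ ⥤ M} (q : X ⟶ Y), R.functorCategory _ q →
      (latchingCocone (S.below δ) f (S.stratumι δ)).Lifts q) :
    R.llp (((S.latching (S.deg x)).map f).app x) := by
  intro X Y p hp
  refine ⟨fun {t s} sq => ?_⟩
  let β := S.deg x
  let φ : S.belowι β ⋙ A ⟶ S.belowι β ⋙ B := Functor.whiskerLeft _ f
  let tι (z : S.Below β) (h : z.obj ⟶ x) : A.obj z.obj ⟶ X :=
    KanExtension.lanι (S.belowι β) (S.belowι β ⋙ A) h ≫ t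
  let sι (z : S.Below β) (h : z.obj ⟶ x) : B.obj z.obj ⟶ Y :=
    KanExtension.lanι (S.belowι β) (S.belowι β ⋙ B) h ≫ s
  have tι_map {z z' : S.Below β} (k : z ⟶ z') (h : z'.obj ⟶ x) :
      A.map k.hom ≫ tι z' h = tι z (k.hom ≫ h) :=
    KanExtension.map_lanι_assoc (ι := S.belowι β) (S.belowι β ⋙ A) (z' := z') k h t
  have sι_map {z z' : S.Below β} (k : z ⟶ z') (h : z'.obj ⟶ x) :
      B.map k.hom ≫ sι z' h = sι z (k.hom ≫ h) :=
    KanExtension.map_lanι_assoc (ι := S.belowι β) (S.belowι β ⋙ B) (z' := z') k h s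
  have w (z : S.Below β) (h : z.obj ⟶ x) : tι z h ≫ p = f.app z.obj ≫ sι z h := by
    refine (Category.assoc _ _ _).trans ((congrArg (_ ≫ ·) sq.w).trans ?_)
    exact KanExtension.lanι_lan_map_app_assoc φ (ι := S.belowι β) (z := z) h s
  -- Maps `L_x A ⟶ X` correspond to maps `A ⟶ X^{C(-,x)}` over `C_β`. So the square from `L_x f` to
  -- `p` becomes one from `f` to `powersMap x p`.
  let a : S.belowι β ⋙ A ⟶ S.belowι β ⋙ powers x X :=
    { app z := powersLift (tι z)
      naturality z z' k := powers_hom_ext fun h => by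
        refine (Category.assoc _ _ _).trans ((congrArg (_ ≫ ·) (powersLift_powersπ _ h)).trans ?_)
        refine (tι_map k h).trans ((powersLift_powersπ (tι z) _).symm.trans ?_)
        refine (congrArg (_ ≫ ·) (powers_map_powersπ X k.hom h).symm).trans ?_
        exact (Category.assoc _ _ _).symm }
  let b : S.belowι β ⋙ B ⟶ S.belowι β ⋙ powers x Y :=
    { app z := powersLift (sι z)
      naturality z z' k := powers_hom_ext fun h => by
        refine (Category.assoc _ _ _).trans ((congrArg (_ ≫ ·) (powersLift_powersπ _ h)).trans ?_)
        refine (sι_map k h).trans ((powersLift_powersπ (sι z) _).symm.trans ?_)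
        refine (congrArg (_ ≫ ·) (powers_map_powersπ Y k.hom h).symm).trans ?_
        exact (Category.assoc _ _ _).symm }
  obtain ⟨l, hl, hl'⟩ := hS.exists_lift_below hR (β := β) (f := f) (p := powersMap x p) (a := a)
    (b := b) (by
      ext z
      refine powers_hom_ext fun h => ?_
      refine (Category.assoc _ _ _).trans
        ((congrArg (_ ≫ ·) (powersMap_app_powersπ x p h)).trans ?_)
      refine (Category.assoc _ _ _).symm.trans
        ((congrArg (· ≫ p) (powersLift_powersπ (tι z) h)).trans ((w z h).trans ?_))
      refine (congrArg (_ ≫ ·) (powersLift_powersπ (sι z) h).symm).trans ?_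
      exact (Category.assoc _ _ _).symm) hf fun y hy K L i hi => lifts_powersMap x hx p y hy i (hi p hp)
  let l' (z : S.Below β) : B.obj z.obj ⟶ (powers x X).obj z.obj := l.app z
  -- The same correspondence turns the lift over `C_β` into a map out of the latching object at `x`.
  obtain ⟨m, hm⟩ := KanExtension.exists_lan_desc (ι := S.belowι β) (S.belowι β ⋙ B)
    (fun z h => l' z ≫ powersπ X h) fun z z' k h => by
      refine (Category.assoc _ _ _).symm.trans ((congrArg (· ≫ _) (l.naturality k)).trans ?_)
      exact (Category.assoc _ _ _).trans (congrArg (_ ≫ ·) (powers_map_powersπ X k.hom h))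
  refine ⟨⟨⟨m, ?_, ?_⟩⟩⟩
  · refine KanExtension.lan_hom_ext (ι := S.belowι β) _ fun z h => ?_
    refine (KanExtension.lanι_lan_map_app_assoc φ (ι := S.belowι β) (z := z) h m).trans ?_
    refine (congrArg (_ ≫ ·) (hm z h)).trans ?_
    refine (Category.assoc _ _ _).symm.trans ((congrArg (· ≫ _) (congr_app hl z)).trans ?_)
    exact powersLift_powersπ (tι z) h
  · refine KanExtension.lan_hom_ext (ι := S.belowι β) _ fun z h => ?_
    refine (Category.assoc _ _ _).symm.trans ((congrArg (· ≫ _) (hm z h)).trans ?_)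
    refine (Category.assoc _ _ _).trans
      ((congrArg (_ ≫ ·) (powersMap_app_powersπ x p h).symm).trans ?_)
    refine (Category.assoc _ _ _).symm.trans ((congrArg (· ≫ _) (congr_app hl' z)).trans ?_)
    exact powersLift_powersπ (sι z) h

end Latching

end Stratification

/-! ### Partial factorizations and their limits -/

namespace Stratification

variable {C : Type v} [SmallCategory C] {S : Stratification C} {M : Type u} [Category.{v} M]

/-- The inclusion of `C_ε` in `C_δ` for `ε ≤ δ`. -/
@[simps, reducible]
def belowOfLE (S : Stratification C) {ε δ : Ordinal.{v}} (h : ε ≤ δ) : S.Below ε ⥤ S.Below δ where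
  obj z := ⟨z.obj, z.property.trans_le h⟩
  map k := ⟨k.hom⟩

/-- The inclusion of the stratum of degree `γ` in `C_δ` for `γ < δ`. -/
@[simps, reducible]
def stratumToBelow (S : Stratification C) {γ δ : Ordinal.{v}} (h : γ < δ) :
    S.Stratum γ ⥤ S.Below δ where
  obj d := ⟨d.obj, d.deg_obj.trans_lt h⟩
  map k := ⟨k.1⟩

/-- A factorization of `f` over the objects of degree `< δ`. -/
structure PartialFactorization (S : Stratification C) {A B : C ⥤ M} (f : A ⟶ B)
    (δ : Ordinal.{v}) where
  E : S.Below δ ⥤ M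
  i : S.belowι δ ⋙ A ⟶ E
  p : E ⟶ S.belowι δ ⋙ B
  fac : i ≫ p = Functor.whiskerLeft _ f

namespace PartialFactorization

variable {A B : C ⥤ M} {f : A ⟶ B} {δ : Ordinal.{v}}

/-- The inverse system compares restrictions by strict equality, so diagrams have to be equal as
functors and not only isomorphic. -/
lemma ext {l l' : PartialFactorization S f δ} (obj : ∀ z, l.E.obj z = l'.E.obj z)
    (map : ∀ {z z'} (k : z ⟶ z'),
      l.E.map k = eqToHom (obj z) ≫ l'.E.map k ≫ eqToHom (obj z').symm)
    (i : ∀ z, l.i.app z = l'.i.app z ≫ eqToHom (obj z).symm)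
    (p : ∀ z, l.p.app z = eqToHom (obj z) ≫ l'.p.app z) : l = l' := by
  obtain ⟨E, il, pl, _⟩ := l
  obtain ⟨E', il', pl', _⟩ := l'
  obtain rfl : E = E' := CategoryTheory.Functor.ext obj fun _ _ => map
  obtain rfl : il = il' := by
    ext z
    simpa using i z
  obtain rfl : pl = pl' := by
    ext z
    simpa using p z
  rfl

/-- Restriction of partial factorizations. -/
@[simps, reducible]
def restrict {ε : Ordinal.{v}} (h : ε ≤ δ) (l : PartialFactorization S f δ) :
    PartialFactorization S f ε where
  E := S.belowOfLE h ⋙ l.E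
  i :=
    { app z := l.i.app ((S.belowOfLE h).obj z)
      naturality _ _ k := l.i.naturality ((S.belowOfLE h).map k) }
  p :=
    { app z := l.p.app ((S.belowOfLE h).obj z)
      naturality _ _ k := l.p.naturality ((S.belowOfLE h).map k) }
  fac := by
    ext z
    exact congr_app l.fac ((S.belowOfLE h).obj z)

/-- The canonical latching cocone of a partial factorization. -/
def latchingCocone (l : PartialFactorization S f δ) (γ : Ordinal.{v}) (hγ : γ < δ) :
    LatchingCocone (l.restrict hγ.le).i (S.stratumι γ) (S.stratumToBelow hγ ⋙ l.E) where
  base :=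
    { app d := l.i.app ((S.stratumToBelow hγ).obj d)
      naturality _ _ k := l.i.naturality ((S.stratumToBelow hγ).map k) }
  incl z d h := l.E.map (X := (S.belowOfLE hγ.le).obj z) (Y := (S.stratumToBelow hγ).obj d) ⟨h⟩
  map_incl _ _ _ := (l.E.map_comp _ _).symm
  incl_map _ _ _ _ _ := (l.E.map_comp _ _).symm
  app_incl z d h := (l.i.naturality
    (X := (S.belowOfLE hγ.le).obj z) (Y := (S.stratumToBelow hγ).obj d) ⟨h⟩).symm

/-- The canonical matching cone of a partial factorization. -/
def matchingCone (l : PartialFactorization S f δ) (γ : Ordinal.{v}) (hγ : γ ≤ δ) (x : S.Below δ) :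
    MatchingCone (l.restrict hγ).p x.obj (l.E.obj x) where
  base := l.p.app x
  proj z g := l.E.map (Y := (S.belowOfLE hγ).obj z) ⟨g⟩
  proj_map _ _ := (l.E.map_comp _ _).symm
  proj_app z g := l.p.naturality (Y := (S.belowOfLE hγ).obj z) ⟨g⟩

/-- The partial factorization is a factorization for the c-Reedy pre-wfs in degrees `< δ`. -/
structure IsReedy (l : PartialFactorization S f δ) (R : MorphismProperty M) : Prop where
  latching (γ : Ordinal.{v}) (hγ : γ < δ) {X Y : S.Stratum γ ⥤ M} (q : X ⟶ Y) :
    R.functorCategory _ q → (l.latchingCocone γ hγ).Lifts q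
  matching (γ : Ordinal.{v}) (hγ : γ < δ) (x : S.Below δ) (hx : S.deg x.obj = γ)
    {K L : M} (i : K ⟶ L) : R.llp i → (l.matchingCone γ hγ.le x).Lifts i

lemma IsReedy.restrict {l : PartialFactorization S f δ} {R : MorphismProperty M}
    (h : l.IsReedy R) {ε : Ordinal.{v}} (hε : ε ≤ δ) : (l.restrict hε).IsReedy R where
  latching γ hγ _ _ q hq := h.latching γ (hγ.trans_le hε) q hq
  matching γ hγ x hx _ _ i hi := h.matching γ (hγ.trans_le hε) ((S.belowOfLE hε).obj x) hx i hi

/-- The conditions in degree `γ` involve only values in degrees at most `γ`. -/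
lemma isReedy_of_restrict {l : PartialFactorization S f δ} {R : MorphismProperty M}
    (h : ∀ γ < δ, ∃ (ε : Ordinal.{v}) (hε : ε ≤ δ), γ < ε ∧ (l.restrict hε).IsReedy R) :
    l.IsReedy R where
  latching γ hγ _ _ q hq := by
    obtain ⟨ε, hε, hγ', h⟩ := h γ hγ
    exact h.latching γ hγ' q hq
  matching γ hγ x hx _ _ i hi := by
    obtain ⟨ε, hε, hγ', h⟩ := h γ hγ
    exact h.matching γ hγ' ⟨x.obj, hx.trans_lt hγ'⟩ hx i hi

section Limit

lemma obj_eq_of_restrict_eq {ε : Ordinal.{v}} {h : ε ≤ δ} {l : PartialFactorization S f δ}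
    {l' : PartialFactorization S f ε} (e : l.restrict h = l') (z : S.Below ε) :
    l'.E.obj z = l.E.obj ((S.belowOfLE h).obj z) := by
  subst e
  rfl

lemma map_eq_of_restrict_eq {ε : Ordinal.{v}} {h : ε ≤ δ} {l : PartialFactorization S f δ}
    {l' : PartialFactorization S f ε} (e : l.restrict h = l') {z z' : S.Below ε} (k : z ⟶ z') :
    l'.E.map k = eqToHom (obj_eq_of_restrict_eq e z) ≫ l.E.map ((S.belowOfLE h).map k) ≫
      eqToHom (obj_eq_of_restrict_eq e z').symm := by
  subst e
  exact ((Category.id_comp _).trans (Category.comp_id _)).symm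

lemma i_eq_of_restrict_eq {ε : Ordinal.{v}} {h : ε ≤ δ} {l : PartialFactorization S f δ}
    {l' : PartialFactorization S f ε} (e : l.restrict h = l') (z : S.Below ε) :
    l'.i.app z = l.i.app ((S.belowOfLE h).obj z) ≫
      eqToHom (obj_eq_of_restrict_eq e z).symm := by
  subst e
  exact (Category.comp_id _).symm

lemma p_eq_of_restrict_eq {ε : Ordinal.{v}} {h : ε ≤ δ} {l : PartialFactorization S f δ}
    {l' : PartialFactorization S f ε} (e : l.restrict h = l') (z : S.Below ε) :
    l'.p.app z = eqToHom (obj_eq_of_restrict_eq e z) ≫ l.p.app ((S.belowOfLE h).obj z) := by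
  subst e
  exact (Category.id_comp _).symm

/-- Objects come from the stage just after their degree. A morphism may be computed at any common
stage of its ends, and all stages agree up to transport along equalities of objects; functoriality
is checked at one stage containing all objects concerned. -/
lemma exists_limit (hδ : Order.IsSuccLimit δ) (l : ∀ i, i < δ → PartialFactorization S f i)
    (hl : ∀ (i k : Ordinal.{v}) (hk : k < δ) (hik : i ≤ k),
      (l k hk).restrict hik = l i (hik.trans_lt hk)) :
    ∃ l' : PartialFactorization S f δ, ∀ (i : Ordinal.{v}) (hi : i < δ),
      l'.restrict hi.le = l i hi := by
  let ob (x : S.Below δ) : M :=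
    (l _ (hδ.succ_lt x.property)).E.obj ⟨x.obj, Order.lt_succ _⟩
  have ob_eq (x : S.Below δ) (j : Ordinal.{v}) (hj : j < δ) (hx : S.deg x.obj < j) :
      ob x = (l j hj).E.obj ⟨x.obj, hx⟩ :=
    obj_eq_of_restrict_eq (hl _ j hj (Order.succ_le_of_lt hx)) ⟨x.obj, Order.lt_succ _⟩
  -- The stage `j` is a parameter, so that three morphisms with different natural stages can be
  -- moved to a common one by `mp_eq`.
  let mp {x y : S.Below δ} (k : x ⟶ y) (j : Ordinal.{v}) (hj : j < δ) (hx : S.deg x.obj < j)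
      (hy : S.deg y.obj < j) : ob x ⟶ ob y :=
    eqToHom (ob_eq x j hj hx) ≫ (l j hj).E.map (X := ⟨x.obj, hx⟩) (Y := ⟨y.obj, hy⟩) ⟨k.hom⟩ ≫
      eqToHom (ob_eq y j hj hy).symm
  have mp_eq {x y : S.Below δ} (k : x ⟶ y) {j j' : Ordinal.{v}} (hj : j < δ) (hj' : j' < δ)
      (hx : S.deg x.obj < j) (hy : S.deg y.obj < j) (hx' : S.deg x.obj < j')
      (hy' : S.deg y.obj < j') : mp k j hj hx hy = mp k j' hj' hx' hy' := by
    wlog hjj : j ≤ j' generalizing j j'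
    · exact (this hj' hj hx' hy' hx hy (le_of_not_ge hjj)).symm
    have := map_eq_of_restrict_eq (hl j j' hj' hjj) (z := ⟨x.obj, hx⟩) (z' := ⟨y.obj, hy⟩) ⟨k.hom⟩
    simp only [mp]
    rw [this]
    simp only [Category.assoc, eqToHom_trans, eqToHom_trans_assoc]
  have lt_max {x y : S.Below δ} : Order.succ (max (S.deg x.obj) (S.deg y.obj)) < δ :=
    hδ.succ_lt (max_lt x.property y.property)
  have lt_l (x y : C) : S.deg x < Order.succ (max (S.deg x) (S.deg y)) :=
    Order.lt_succ_of_le (le_max_left _ _)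
  have lt_r (x y : C) : S.deg y < Order.succ (max (S.deg x) (S.deg y)) :=
    Order.lt_succ_of_le (le_max_right _ _)
  let E : S.Below δ ⥤ M :=
    { obj := ob
      map {x y} k := mp k _ lt_max (lt_l x.obj y.obj) (lt_r x.obj y.obj)
      map_id x := by
        simp only [mp]
        have := (l _ (lt_max (x := x) (y := x))).E.map_id ⟨x.obj, lt_l _ _⟩
        refine (congrArg (fun t => _ ≫ t ≫ _) this).trans ?_
        simp
      map_comp {x y z} k k' := by
        have hm : Order.succ (max (max (S.deg x.obj) (S.deg y.obj)) (S.deg z.obj)) < δ :=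
          hδ.succ_lt (max_lt (max_lt x.property y.property) z.property)
        have hx : S.deg x.obj < Order.succ (max (max (S.deg x.obj) (S.deg y.obj)) (S.deg z.obj)) :=
          Order.lt_succ_of_le ((le_max_left _ _).trans (le_max_left _ _))
        have hy : S.deg y.obj < Order.succ (max (max (S.deg x.obj) (S.deg y.obj)) (S.deg z.obj)) :=
          Order.lt_succ_of_le ((le_max_right _ _).trans (le_max_left _ _))
        have hz : S.deg z.obj < Order.succ (max (max (S.deg x.obj) (S.deg y.obj)) (S.deg z.obj)) :=
          Order.lt_succ_of_le (le_max_right _ _)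
        rw [mp_eq (k ≫ k') _ hm _ _ hx hz, mp_eq k _ hm _ _ hx hy, mp_eq k' _ hm _ _ hy hz]
        simp only [mp, Category.assoc, eqToHom_trans_assoc, eqToHom_refl, Category.id_comp]
        rw [← Functor.map_comp_assoc]
        rfl }
  let ii (x : S.Below δ) (j : Ordinal.{v}) (hj : j < δ) (hx : S.deg x.obj < j) :
      A.obj x.obj ⟶ ob x :=
    (l j hj).i.app ⟨x.obj, hx⟩ ≫ eqToHom (ob_eq x j hj hx).symm
  have ii_eq (x : S.Below δ) {j : Ordinal.{v}} (hj : j < δ) (hx : S.deg x.obj < j) :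
      ii x _ (hδ.succ_lt x.property) (Order.lt_succ _) = ii x j hj hx := by
    have := i_eq_of_restrict_eq (hl _ j hj (Order.succ_le_of_lt hx)) ⟨x.obj, Order.lt_succ _⟩
    simp only [ii]
    rw [this]
    simp
  let pp (x : S.Below δ) (j : Ordinal.{v}) (hj : j < δ) (hx : S.deg x.obj < j) :
      ob x ⟶ B.obj x.obj :=
    eqToHom (ob_eq x j hj hx) ≫ (l j hj).p.app ⟨x.obj, hx⟩
  have pp_eq (x : S.Below δ) {j : Ordinal.{v}} (hj : j < δ) (hx : S.deg x.obj < j) :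
      pp x _ (hδ.succ_lt x.property) (Order.lt_succ _) = pp x j hj hx := by
    have := p_eq_of_restrict_eq (hl _ j hj (Order.succ_le_of_lt hx)) ⟨x.obj, Order.lt_succ _⟩
    simp only [pp]
    rw [this]
    simp
  refine ⟨{ E := E
            i :=
              { app x := ii x _ (hδ.succ_lt x.property) (Order.lt_succ _)
                naturality x y k := ?_ }
            p :=
              { app x := pp x _ (hδ.succ_lt x.property) (Order.lt_succ _)
                naturality x y k := ?_ }
            fac := ?_ }, fun j hj => ?_⟩
  · rw [ii_eq y lt_max (lt_r x.obj y.obj), ii_eq x lt_max (lt_l x.obj y.obj)]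
    have := (l _ (lt_max (x := x) (y := y))).i.naturality (X := ⟨x.obj, lt_l _ _⟩)
      (Y := ⟨y.obj, lt_r _ _⟩) ⟨k.hom⟩
    refine (Category.assoc _ _ _).symm.trans ((congrArg (· ≫ _) this).trans ?_)
    simp only [ii, E, mp, Category.assoc, eqToHom_trans_assoc, eqToHom_refl, Category.id_comp]
  · rw [pp_eq y lt_max (lt_r x.obj y.obj), pp_eq x lt_max (lt_l x.obj y.obj)]
    have := (l _ (lt_max (x := x) (y := y))).p.naturality (X := ⟨x.obj, lt_l _ _⟩)
      (Y := ⟨y.obj, lt_r _ _⟩) ⟨k.hom⟩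
    refine Eq.trans ?_ ((congrArg (eqToHom (ob_eq x _ lt_max (lt_l x.obj y.obj)) ≫ ·) this).trans
      (Category.assoc _ _ _).symm)
    simp only [pp, E, mp, Category.assoc, eqToHom_trans_assoc, eqToHom_refl, Category.id_comp]
  · ext x
    have := congr_app (l _ (hδ.succ_lt x.property)).fac ⟨x.obj, Order.lt_succ _⟩
    refine Eq.trans ?_ this
    simp only [ii, pp, NatTrans.comp_app, Category.assoc, eqToHom_refl,
      Category.id_comp]
  · refine ext (fun z => ob_eq ⟨z.obj, z.property.trans hj⟩ j hj z.property) (fun {z z'} k => ?_)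
      (fun z => ?_) (fun z => ?_)
    · exact mp_eq ((S.belowOfLE hj.le).map k) _ hj _ _ z.property z'.property
    · exact ii_eq ⟨z.obj, z.property.trans hj⟩ hj z.property
    · exact pp_eq ⟨z.obj, z.property.trans hj⟩ hj z.property

end Limit

end PartialFactorization

end Stratification

/-! ### Transport along equalities of objects -/

section Conj

variable {M : Type u} [Category.{v} M]

/-- Transport of a morphism along equalities of objects. -/
def conjEqToHom {X X' Y Y' : M} (hX : X = X') (hY : Y = Y') (a : X' ⟶ Y') : X ⟶ Y :=
  eqToHom hX ≫ a ≫ eqToHom hY.symm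

/-- Reduces each composition identity in the glued diagram to the untransported one. -/
lemma conjEqToHom_comp {X X' Y Y' Z Z' : M} (hX : X = X') (hY : Y = Y') (hZ : Z = Z')
    {a : X' ⟶ Y'} {b : Y' ⟶ Z'} {c : X' ⟶ Z'} (h : a ≫ b = c) :
    conjEqToHom hX hY a ≫ conjEqToHom hY hZ b = conjEqToHom hX hZ c := by
  subst hX hY hZ h
  simp [conjEqToHom]

lemma conjEqToHom_refl {X Y : M} (a : X ⟶ Y) : conjEqToHom rfl rfl a = a := by
  simp [conjEqToHom]

lemma conjEqToHom_id {X X' : M} (hX : X = X') : conjEqToHom hX hX (𝟙 X') = 𝟙 X := by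
  simp [conjEqToHom]

end Conj

lemma LatchingCocone.Lifts.postcomp_iso {C : Type v} [SmallCategory C] {P : ObjectProperty C}
    {M : Type u} [Category.{v} M] {E : P.FullSubcategory ⥤ M} {A : C ⥤ M} {i : P.ι ⋙ A ⟶ E}
    {D : Type w} [Category.{w'} D] {K : D ⥤ C} {X X' Y Z : D ⥤ M} {c : LatchingCocone i K X}
    {p : Y ⟶ Z} (h : c.Lifts p) (e : X ≅ X') : (c.postcomp e.hom).Lifts p := by
  intro b c' hc'
  obtain ⟨l, hl, hl'⟩ := h (e.hom ≫ b) c' (by rw [hc', ← postcomp_comp])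
  exact ⟨e.inv ≫ l, by rw [Category.assoc, hl, e.inv_hom_id_assoc], by
    rw [← postcomp_comp, e.hom_inv_id_assoc, hl']⟩

lemma MatchingCone.Lifts.precomp_iso {C : Type v} [SmallCategory C] {P : ObjectProperty C}
    {M : Type u} [Category.{v} M] {E : P.FullSubcategory ⥤ M} {B : C ⥤ M} {p : E ⟶ P.ι ⋙ B}
    {x : C} {T T' K L : M} {c : MatchingCone p x T} {i : K ⟶ L} (h : c.Lifts i) (e : T' ≅ T) :
    (c.precomp e.hom).Lifts i := by
  intro t c' hc'
  obtain ⟨l, hl, hl'⟩ := h (t ≫ e.hom) c' (by rw [← hc', ← precomp_comp])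
  exact ⟨l ≫ e.inv, by rw [← Category.assoc, hl, Category.assoc, e.hom_inv_id, Category.comp_id],
    by rw [← precomp_comp, Category.assoc, e.inv_hom_id, Category.comp_id, hl']⟩

/-! ### Gluing a diagram on the next stratum -/

namespace Stratification

variable {C : Type v} [SmallCategory C] {S : Stratification C} {M : Type u} [Category.{v} M]

namespace PartialFactorization

variable {A B : C ⥤ M} {f : A ⟶ B} {δ : Ordinal.{v}}

/-- The data on the stratum of degree `δ` needed to extend a partial factorization. -/
structure StratumExtension (l : PartialFactorization S f δ) where
  G : S.Stratum δ ⥤ M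
  c : LatchingCocone l.i (S.stratumι δ) G
  m (d : S.Stratum δ) : MatchingCone l.p d.obj (G.obj d)
  map_base {d d' : S.Stratum δ} (e : d ⟶ d') :
    G.map e ≫ (m d').base = (m d).base ≫ B.map e.1
  map_proj {d d' : S.Stratum δ} (e : d ⟶ d') (z : S.Below δ) (g : d'.obj ⟶ z.obj) :
    G.map e ≫ (m d').proj z g = (m d).proj z (e.1 ≫ g)
  incl_proj (z z' : S.Below δ) (d : S.Stratum δ) (h : z.obj ⟶ d.obj) (g : d.obj ⟶ z'.obj) :
    c.incl z d h ≫ (m d).proj z' g = l.E.map ⟨h ≫ g⟩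
  base_proj (z : S.Below δ) (d : S.Stratum δ) (g : d.obj ⟶ z.obj) :
    c.base.app d ≫ (m d).proj z g = A.map g ≫ l.i.app z
  incl_base (z : S.Below δ) (d : S.Stratum δ) (h : z.obj ⟶ d.obj) :
    c.incl z d h ≫ (m d).base = l.p.app z ≫ B.map h
  base_base (d : S.Stratum δ) : c.base.app d ≫ (m d).base = f.app d.obj

namespace StratumExtension

variable {l : PartialFactorization S f δ} (e : l.StratumExtension)

/-- Stratum maps act through `G`. A map passing below must act by projecting to a lower value and
including again; `connected` shows that the result does not depend on the passage, and
`not_inStratum` that the two prescriptions never compete. -/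
lemma exists_map (hS : S.HasThroughDecomposition) (d d' : S.Stratum δ) (k : d.obj ⟶ d'.obj) :
    ∃ t : e.G.obj d ⟶ e.G.obj d', (∀ hk : S.inStratum k, t = e.G.map ⟨k, hk⟩) ∧
      ∀ (z : S.Below δ) (g : d.obj ⟶ z.obj) (h : z.obj ⟶ d'.obj), g ≫ h = k →
        t = (e.m d).proj z g ≫ e.c.incl z d' h := by
  have hdd : S.deg d.obj = S.deg d'.obj := d.deg_obj.trans d'.deg_obj.symm
  by_cases hk : S.inStratum k
  · refine ⟨e.G.map ⟨k, hk⟩, fun _ => rfl, ?_⟩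
    rintro z g h rfl
    exact (hS.not_inStratum g h (z.property.trans_eq d.deg_obj.symm) hk).elim
  · obtain ⟨z, g, h, hz, rfl⟩ := hS.exists_fac k hdd hk
    refine ⟨(e.m d).proj ⟨z, hz.trans_eq d.deg_obj⟩ g ≫ e.c.incl ⟨z, hz.trans_eq d.deg_obj⟩ d' h,
      fun hk' => (hk hk').elim, fun z' g' h' H => ?_⟩
    -- The invariant predicate is that the passage induces the same composite as the chosen one.
    -- Sliding invariance is `proj_map` together with `map_incl`.
    refine hS.connected hdd (fun z' hz' g' h' =>
      (e.m d).proj ⟨z, hz.trans_eq d.deg_obj⟩ g ≫ e.c.incl ⟨z, hz.trans_eq d.deg_obj⟩ d' h =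
        (e.m d).proj ⟨z', hz'.trans_eq d.deg_obj⟩ g' ≫
          e.c.incl ⟨z', hz'.trans_eq d.deg_obj⟩ d' h') ?_ hz (z'.property.trans_eq d.deg_obj.symm)
      g h g' h' H.symm rfl
    intro z₁ z₂ hz₁ hz₂ g₁ k₁ h₁
    have h₁' : (e.m d).proj ⟨z₁, hz₁.trans_eq d.deg_obj⟩ g₁ ≫
        e.c.incl ⟨z₁, hz₁.trans_eq d.deg_obj⟩ d' (k₁ ≫ h₁) =
      (e.m d).proj ⟨z₂, hz₂.trans_eq d.deg_obj⟩ (g₁ ≫ k₁) ≫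
        e.c.incl ⟨z₂, hz₂.trans_eq d.deg_obj⟩ d' h₁ := by
      rw [← (e.m d).proj_map (z := ⟨z₁, hz₁.trans_eq d.deg_obj⟩)
        (z' := ⟨z₂, hz₂.trans_eq d.deg_obj⟩) g₁ ⟨k₁⟩, Category.assoc]
      exact congrArg _ (e.c.map_incl (z := ⟨z₁, hz₁.trans_eq d.deg_obj⟩)
        (z' := ⟨z₂, hz₂.trans_eq d.deg_obj⟩) ⟨k₁⟩ h₁).symm
    exact ⟨fun H => H.trans h₁', fun H => H.trans h₁'.symm⟩

/-- The glued diagram restricts to `l` strictly, whereas its restriction to the stratum is compared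
with `G` by the isomorphism `ψ`; only strictness over `C_δ` is required by the transfinite
construction. -/
theorem exists_glue (hS : S.HasThroughDecomposition) :
    ∃ (l' : PartialFactorization S f (Order.succ δ)) (h : l'.restrict (Order.le_succ δ) = l)
      (ψ : S.stratumToBelow (Order.lt_succ δ) ⋙ l'.E ≅ e.G),
      (∀ d, l'.i.app ((S.stratumToBelow (Order.lt_succ δ)).obj d) =
        e.c.base.app d ≫ ψ.inv.app d) ∧
      (∀ d, l'.p.app ((S.stratumToBelow (Order.lt_succ δ)).obj d) =
        ψ.hom.app d ≫ (e.m d).base) ∧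
      (∀ (z : S.Below δ) (d : S.Stratum δ) (g : z.obj ⟶ d.obj),
        l'.E.map (X := (S.belowOfLE (Order.le_succ δ)).obj z)
          (Y := (S.stratumToBelow (Order.lt_succ δ)).obj d) ⟨g⟩ =
          eqToHom (obj_eq_of_restrict_eq h z).symm ≫ e.c.incl z d g ≫ ψ.inv.app d) ∧
      (∀ (d : S.Stratum δ) (z : S.Below δ) (g : d.obj ⟶ z.obj),
        l'.E.map (X := (S.stratumToBelow (Order.lt_succ δ)).obj d)
          (Y := (S.belowOfLE (Order.le_succ δ)).obj z) ⟨g⟩ =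
          ψ.hom.app d ≫ (e.m d).proj z g ≫ eqToHom (obj_eq_of_restrict_eq h z)) := by
  classical
  choose T T_st T_thr using e.exists_map hS
  have T_thr' (d d' : S.Stratum δ) (z : S.Below δ) (g : d.obj ⟶ z.obj) (h : z.obj ⟶ d'.obj) :
      T d d' (g ≫ h) = (e.m d).proj z g ≫ e.c.incl z d' h := T_thr d d' _ z g h rfl
  have cases_T (d d' : S.Stratum δ) (k : d.obj ⟶ d'.obj) : S.inStratum k ∨
      ∃ (z : S.Below δ) (g : d.obj ⟶ z.obj) (h : z.obj ⟶ d'.obj), g ≫ h = k := by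
    by_cases hk : S.inStratum k
    · exact Or.inl hk
    · obtain ⟨z, g, h, hz, H⟩ := hS.exists_fac k (d.deg_obj.trans d'.deg_obj.symm) hk
      exact Or.inr ⟨⟨z, hz.trans_eq d.deg_obj⟩, g, h, H⟩
  have incl_T (z : S.Below δ) (d d' : S.Stratum δ) (h : z.obj ⟶ d.obj) (k : d.obj ⟶ d'.obj) :
      e.c.incl z d h ≫ T d d' k = e.c.incl z d' (h ≫ k) := by
    obtain hk | ⟨z', g, h', rfl⟩ := cases_T d d' k
    · rw [T_st d d' k hk]
      exact e.c.incl_map z h (⟨k, hk⟩ : d ⟶ d')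
    · rw [T_thr', ← Category.assoc, e.incl_proj]
      exact (e.c.map_incl (z := z) (z' := z') ⟨h ≫ g⟩ h').trans
        (congrArg _ (Category.assoc _ _ _))
  have T_proj (d d' : S.Stratum δ) (z : S.Below δ) (k : d.obj ⟶ d'.obj) (g : d'.obj ⟶ z.obj) :
      T d d' k ≫ (e.m d').proj z g = (e.m d).proj z (k ≫ g) := by
    obtain hk | ⟨z', g', h', rfl⟩ := cases_T d d' k
    · rw [T_st d d' k hk]
      exact e.map_proj (⟨k, hk⟩ : d ⟶ d') z g
    · rw [T_thr', Category.assoc, e.incl_proj]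
      exact ((e.m d).proj_map (z := z') (z' := z) g' ⟨h' ≫ g⟩).trans
        (congrArg _ (Category.assoc _ _ _).symm)
  have T_id (d : S.Stratum δ) : T d d (𝟙 d.obj) = 𝟙 _ :=
    (T_st d d _ (S.inStratum.id_mem _)).trans (e.G.map_id d)
  -- If one of the two maps passes below, so does the composite, and the other map is absorbed by
  -- `incl_T` or `T_proj`.
  have T_comp (d d' d'' : S.Stratum δ) (k : d.obj ⟶ d'.obj) (k' : d'.obj ⟶ d''.obj) :
      T d d' k ≫ T d' d'' k' = T d d'' (k ≫ k') := by
    obtain hk' | ⟨z', g', h', rfl⟩ := cases_T d' d'' k'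
    · obtain hk | ⟨z, g, h, rfl⟩ := cases_T d d' k
      · rw [T_st d d' k hk, T_st d' d'' k' hk',
          T_st d d'' _ (S.inStratum.comp_mem _ _ hk hk')]
        exact (e.G.map_comp (⟨k, hk⟩ : d ⟶ d') (⟨k', hk'⟩ : d' ⟶ d'')).symm
      · rw [T_thr', Category.assoc, incl_T, Category.assoc, T_thr']
        rfl
    · rw [T_thr', ← Category.assoc, T_proj, ← Category.assoc, T_thr']
  have base_T (d d' : S.Stratum δ) (k : d.obj ⟶ d'.obj) :
      A.map k ≫ e.c.base.app d' = e.c.base.app d ≫ T d d' k := by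
    obtain hk | ⟨z, g, h, rfl⟩ := cases_T d d' k
    · rw [T_st d d' k hk]
      exact e.c.base.naturality (⟨k, hk⟩ : d ⟶ d')
    · rw [T_thr', ← Category.assoc, e.base_proj, A.map_comp]
      exact (Category.assoc _ _ _).trans ((congrArg _ (e.c.app_incl z h).symm).trans
        (Category.assoc _ _ _).symm)
  have T_base (d d' : S.Stratum δ) (k : d.obj ⟶ d'.obj) :
      T d d' k ≫ (e.m d').base = (e.m d).base ≫ B.map k := by
    obtain hk | ⟨z, g, h, rfl⟩ := cases_T d d' k
    · rw [T_st d d' k hk]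
      exact e.map_base (⟨k, hk⟩ : d ⟶ d')
    · rw [T_thr', Category.assoc, e.incl_base, B.map_comp, ← Category.assoc, ← Category.assoc]
      exact congrArg (· ≫ _) ((e.m d).proj_app z g)
  have eq_δ {x : S.Below (Order.succ δ)} (h : ¬ S.deg x.obj < δ) : S.deg x.obj = δ :=
    le_antisymm (Order.lt_succ_iff.1 x.property) (le_of_not_gt h)
  let ob (x : S.Below (Order.succ δ)) : M :=
    if h : S.deg x.obj < δ then l.E.obj ⟨x.obj, h⟩ else e.G.obj ⟨x.obj, eq_δ h⟩
  have lo (x : S.Below (Order.succ δ)) (h : S.deg x.obj < δ) : ob x = l.E.obj ⟨x.obj, h⟩ :=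
    dif_pos h
  have hi (x : S.Below (Order.succ δ)) (h : S.deg x.obj = δ) : ob x = e.G.obj ⟨x.obj, h⟩ :=
    dif_neg (h.symm.le.not_gt)
  -- Exactly one of the four formulas applies to given `x` and `y`. Quantifying each over all proofs
  -- of its degree conditions turns them into rewriting rules after `choose`.
  have H (x y : S.Below (Order.succ δ)) (k : x ⟶ y) : ∃ t : ob x ⟶ ob y,
      (∀ hx hy, t = conjEqToHom (lo x hx) (lo y hy)
        (l.E.map (X := ⟨x.obj, hx⟩) (Y := ⟨y.obj, hy⟩) ⟨k.hom⟩)) ∧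
      (∀ hx hy, t = conjEqToHom (lo x hx) (hi y hy) (e.c.incl ⟨x.obj, hx⟩ ⟨y.obj, hy⟩ k.hom)) ∧
      (∀ hx hy, t = conjEqToHom (hi x hx) (lo y hy)
        ((e.m ⟨x.obj, hx⟩).proj ⟨y.obj, hy⟩ k.hom)) ∧
      (∀ hx hy, t = conjEqToHom (hi x hx) (hi y hy) (T ⟨x.obj, hx⟩ ⟨y.obj, hy⟩ k.hom)) := by
    by_cases hx : S.deg x.obj < δ <;> by_cases hy : S.deg y.obj < δ
    · exact ⟨conjEqToHom (lo x hx) (lo y hy)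
        (l.E.map (X := ⟨x.obj, hx⟩) (Y := ⟨y.obj, hy⟩) ⟨k.hom⟩),
        fun _ _ => rfl, fun _ hy' => (hy.ne hy').elim, fun hx' => (hx.ne hx').elim,
        fun hx' => (hx.ne hx').elim⟩
    · exact ⟨conjEqToHom (lo x hx) (hi y (eq_δ hy)) (e.c.incl ⟨x.obj, hx⟩ ⟨y.obj, eq_δ hy⟩ k.hom),
        fun _ hy' => (hy hy').elim, fun _ _ => rfl, fun hx' => (hx.ne hx').elim,
        fun hx' => (hx.ne hx').elim⟩
    · exact ⟨conjEqToHom (hi x (eq_δ hx)) (lo y hy)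
        ((e.m ⟨x.obj, eq_δ hx⟩).proj ⟨y.obj, hy⟩ k.hom),
        fun hx' => (hx hx').elim, fun hx' => (hx hx').elim, fun _ _ => rfl,
        fun _ hy' => (hy.ne hy').elim⟩
    · exact ⟨conjEqToHom (hi x (eq_δ hx)) (hi y (eq_δ hy))
        (T ⟨x.obj, eq_δ hx⟩ ⟨y.obj, eq_δ hy⟩ k.hom),
        fun hx' => (hx hx').elim, fun hx' => (hx hx').elim, fun _ hy' => (hy hy').elim,
        fun _ _ => rfl⟩
  choose mp mp_ll mp_lh mp_hl mp_hh using H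
  have cases (x : S.Below (Order.succ δ)) : S.deg x.obj < δ ∨ S.deg x.obj = δ :=
    (lt_or_ge (S.deg x.obj) δ).imp_right fun h => eq_δ h.not_gt
  let E : S.Below (Order.succ δ) ⥤ M :=
    { obj := ob
      map {x y} k := mp x y k
      map_id x := by
        obtain hx | hx := cases x
        · rw [mp_ll x x _ hx hx]
          exact (congrArg _ (l.E.map_id ⟨x.obj, hx⟩)).trans (conjEqToHom_id (lo x hx))
        · rw [mp_hh x x _ hx hx]
          exact (congrArg _ (T_id ⟨x.obj, hx⟩)).trans (conjEqToHom_id (hi x hx))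
      map_comp {x y z} k k' := by
        obtain hx | hx := cases x <;> obtain hy | hy := cases y <;> obtain hz | hz := cases z
        · rw [mp_ll x y k hx hy, mp_ll y z k' hy hz, mp_ll x z _ hx hz]
          exact (conjEqToHom_comp _ _ _ (l.E.map_comp (X := ⟨x.obj, hx⟩) (Y := ⟨y.obj, hy⟩)
            (Z := ⟨z.obj, hz⟩) ⟨k.hom⟩ ⟨k'.hom⟩).symm).symm
        · rw [mp_ll x y k hx hy, mp_lh y z k' hy hz, mp_lh x z _ hx hz]
          exact (conjEqToHom_comp _ _ _ (e.c.map_incl (z := ⟨x.obj, hx⟩) (z' := ⟨y.obj, hy⟩)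
            (d := ⟨z.obj, hz⟩) ⟨k.hom⟩ k'.hom)).symm
        · rw [mp_lh x y k hx hy, mp_hl y z k' hy hz, mp_ll x z _ hx hz]
          exact (conjEqToHom_comp _ _ _ (e.incl_proj ⟨x.obj, hx⟩ ⟨z.obj, hz⟩ ⟨y.obj, hy⟩
            k.hom k'.hom)).symm
        · rw [mp_lh x y k hx hy, mp_hh y z k' hy hz, mp_lh x z _ hx hz]
          exact (conjEqToHom_comp _ _ _ (incl_T ⟨x.obj, hx⟩ ⟨y.obj, hy⟩ ⟨z.obj, hz⟩
            k.hom k'.hom)).symm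
        · rw [mp_hl x y k hx hy, mp_ll y z k' hy hz, mp_hl x z _ hx hz]
          exact (conjEqToHom_comp _ _ _ ((e.m ⟨x.obj, hx⟩).proj_map (z := ⟨y.obj, hy⟩)
            (z' := ⟨z.obj, hz⟩) k.hom ⟨k'.hom⟩)).symm
        · rw [mp_hl x y k hx hy, mp_lh y z k' hy hz, mp_hh x z _ hx hz]
          exact (conjEqToHom_comp _ _ _ (T_thr' ⟨x.obj, hx⟩ ⟨z.obj, hz⟩ ⟨y.obj, hy⟩
            k.hom k'.hom).symm).symm
        · rw [mp_hh x y k hx hy, mp_hl y z k' hy hz, mp_hl x z _ hx hz]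
          exact (conjEqToHom_comp _ _ _ (T_proj ⟨x.obj, hx⟩ ⟨y.obj, hy⟩ ⟨z.obj, hz⟩
            k.hom k'.hom)).symm
        · rw [mp_hh x y k hx hy, mp_hh y z k' hy hz, mp_hh x z _ hx hz]
          exact (conjEqToHom_comp _ _ _ (T_comp ⟨x.obj, hx⟩ ⟨y.obj, hy⟩ ⟨z.obj, hz⟩
            k.hom k'.hom)).symm }
  have Hi (x : S.Below (Order.succ δ)) : ∃ t : A.obj x.obj ⟶ ob x,
      (∀ hx, t = conjEqToHom rfl (lo x hx) (l.i.app ⟨x.obj, hx⟩)) ∧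
      (∀ hx, t = conjEqToHom rfl (hi x hx) (e.c.base.app ⟨x.obj, hx⟩)) := by
    by_cases hx : S.deg x.obj < δ
    · exact ⟨conjEqToHom rfl (lo x hx) (l.i.app ⟨x.obj, hx⟩), fun _ => rfl,
        fun hx' => (hx.ne hx').elim⟩
    · exact ⟨conjEqToHom rfl (hi x (eq_δ hx)) (e.c.base.app ⟨x.obj, eq_δ hx⟩),
        fun hx' => (hx hx').elim, fun _ => rfl⟩
  choose ii ii_l ii_h using Hi
  have Hp (x : S.Below (Order.succ δ)) : ∃ t : ob x ⟶ B.obj x.obj,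
      (∀ hx, t = conjEqToHom (lo x hx) rfl (l.p.app ⟨x.obj, hx⟩)) ∧
      (∀ hx, t = conjEqToHom (hi x hx) rfl (e.m ⟨x.obj, hx⟩).base) := by
    by_cases hx : S.deg x.obj < δ
    · exact ⟨conjEqToHom (lo x hx) rfl (l.p.app ⟨x.obj, hx⟩), fun _ => rfl,
        fun hx' => (hx.ne hx').elim⟩
    · exact ⟨conjEqToHom (hi x (eq_δ hx)) rfl (e.m ⟨x.obj, eq_δ hx⟩).base,
        fun hx' => (hx hx').elim, fun _ => rfl⟩
  choose pp pp_l pp_h using Hp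
  let l' : PartialFactorization S f (Order.succ δ) :=
    { E := E
      i :=
        { app := ii
          naturality x y k := by
            change A.map k.hom ≫ ii y = ii x ≫ mp x y k
            rw [← conjEqToHom_refl (A.map k.hom)]
            obtain hx | hx := cases x <;> obtain hy | hy := cases y
            · rw [ii_l x hx, ii_l y hy, mp_ll x y k hx hy]
              refine (conjEqToHom_comp _ _ _ ?_).trans (conjEqToHom_comp _ _ _ rfl).symm
              exact l.i.naturality (X := ⟨x.obj, hx⟩) (Y := ⟨y.obj, hy⟩) ⟨k.hom⟩
            · rw [ii_l x hx, ii_h y hy, mp_lh x y k hx hy]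
              refine (conjEqToHom_comp _ _ _ ?_).trans (conjEqToHom_comp _ _ _ rfl).symm
              exact (e.c.app_incl ⟨x.obj, hx⟩ (d := ⟨y.obj, hy⟩) k.hom).symm
            · rw [ii_h x hx, ii_l y hy, mp_hl x y k hx hy]
              refine (conjEqToHom_comp _ _ _ ?_).trans (conjEqToHom_comp _ _ _ rfl).symm
              exact (e.base_proj ⟨y.obj, hy⟩ ⟨x.obj, hx⟩ k.hom).symm
            · rw [ii_h x hx, ii_h y hy, mp_hh x y k hx hy]
              refine (conjEqToHom_comp _ _ _ ?_).trans (conjEqToHom_comp _ _ _ rfl).symm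
              exact base_T ⟨x.obj, hx⟩ ⟨y.obj, hy⟩ k.hom }
      p :=
        { app := pp
          naturality x y k := by
            change mp x y k ≫ pp y = pp x ≫ B.map k.hom
            rw [← conjEqToHom_refl (B.map k.hom)]
            obtain hx | hx := cases x <;> obtain hy | hy := cases y
            · rw [pp_l x hx, pp_l y hy, mp_ll x y k hx hy]
              refine (conjEqToHom_comp _ _ _ ?_).trans (conjEqToHom_comp _ _ _ rfl).symm
              exact l.p.naturality (X := ⟨x.obj, hx⟩) (Y := ⟨y.obj, hy⟩) ⟨k.hom⟩
            · rw [pp_l x hx, pp_h y hy, mp_lh x y k hx hy]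
              refine (conjEqToHom_comp _ _ _ ?_).trans (conjEqToHom_comp _ _ _ rfl).symm
              exact e.incl_base ⟨x.obj, hx⟩ ⟨y.obj, hy⟩ k.hom
            · rw [pp_h x hx, pp_l y hy, mp_hl x y k hx hy]
              refine (conjEqToHom_comp _ _ _ ?_).trans (conjEqToHom_comp _ _ _ rfl).symm
              exact (e.m ⟨x.obj, hx⟩).proj_app ⟨y.obj, hy⟩ k.hom
            · rw [pp_h x hx, pp_h y hy, mp_hh x y k hx hy]
              refine (conjEqToHom_comp _ _ _ ?_).trans (conjEqToHom_comp _ _ _ rfl).symm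
              exact T_base ⟨x.obj, hx⟩ ⟨y.obj, hy⟩ k.hom }
      fac := by
        ext x
        change ii x ≫ pp x = f.app x.obj
        rw [← conjEqToHom_refl (f.app x.obj)]
        obtain hx | hx := cases x
        · rw [ii_l x hx, pp_l x hx]
          exact conjEqToHom_comp _ _ _ (congr_app l.fac ⟨x.obj, hx⟩)
        · rw [ii_h x hx, pp_h x hx]
          exact conjEqToHom_comp _ _ _ (e.base_base ⟨x.obj, hx⟩) }
  have hl' : l'.restrict (Order.le_succ δ) = l := by
    refine PartialFactorization.ext (fun z => lo _ z.property) (fun {z z'} k => ?_) (fun z => ?_)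
      fun z => ?_
    · exact mp_ll _ _ _ z.property z'.property
    · exact (ii_l _ z.property).trans (Category.id_comp _)
    · exact (pp_l _ z.property).trans (congrArg (_ ≫ ·) (Category.comp_id _))
  let ψ : S.stratumToBelow (Order.lt_succ δ) ⋙ l'.E ≅ e.G :=
    NatIso.ofComponents (fun d => eqToIso (hi _ d.deg_obj)) fun {d d'} k => by
      have h := (mp_hh _ _ ((S.stratumToBelow (Order.lt_succ δ)).map k) d.deg_obj
        d'.deg_obj).trans (congrArg _ (T_st d d' k.1 k.2))
      refine (congrArg (· ≫ _) h).trans ?_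
      simp [conjEqToHom]
  refine ⟨l', hl', ψ, fun d => ?_, fun d => ?_, fun z d g => ?_, fun d z g => ?_⟩
  · exact (ii_h _ d.deg_obj).trans (Category.id_comp _)
  · exact (pp_h _ d.deg_obj).trans (congrArg (_ ≫ ·) (Category.comp_id _))
  · exact mp_lh _ _ _ z.property d.deg_obj
  · exact mp_hl _ _ _ d.deg_obj z.property

/-- Conditions in degrees below `δ` depend only on the restriction, which is `l`; those in degree
`δ` are the hypotheses on `e`, transported along `ψ`. -/
theorem exists_isReedy_succ (hS : S.HasThroughDecomposition) {R : MorphismProperty M}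
    (hl : l.IsReedy R)
    (hc : ∀ {X Y : S.Stratum δ ⥤ M} (q : X ⟶ Y), R.functorCategory _ q → e.c.Lifts q)
    (hm : ∀ (d : S.Stratum δ) {K L : M} (i : K ⟶ L), R.llp i → (e.m d).Lifts i) :
    ∃ l' : PartialFactorization S f (Order.succ δ),
      l'.restrict (Order.le_succ δ) = l ∧ l'.IsReedy R := by
  obtain ⟨l', hl', ψ, hbase, hp, hincl, hproj⟩ := e.exists_glue hS
  refine ⟨l', hl', fun γ hγ X Y q hq => ?_, fun γ hγ x hx K L i hi => ?_⟩
  · obtain hγ' | rfl := (Order.lt_succ_iff.1 hγ).lt_or_eq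
    · have := hl.latching γ hγ' q hq
      rw [← hl'] at this
      exact this
    · have h := (hc q hq).postcomp_iso ψ.symm
      -- Once `l` is the restriction itself, the `eqToHom`s in the description of the glued maps are
      -- identities.
      subst hl'
      convert h
      ext1
      · ext d
        exact hbase d
      · funext z d g
        exact (hincl z d g).trans (Category.id_comp _)
  · obtain hγ' | rfl := (Order.lt_succ_iff.1 hγ).lt_or_eq
    · have := hl.matching γ hγ' ⟨x.obj, hx.trans_lt hγ'⟩ hx i hi
      rw [← hl'] at this
      exact this
    · have h := (hm ⟨x.obj, hx⟩ i hi).precomp_iso (ψ.app ⟨x.obj, hx⟩)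
      subst hl'
      have key : l'.matchingCone γ hγ.le x = MatchingCone.precomp (T' := l'.E.obj x)
          (e.m ⟨x.obj, hx⟩) (ψ.hom.app ⟨x.obj, hx⟩) :=
        MatchingCone.ext (hp ⟨x.obj, hx⟩) (funext fun z => funext fun g =>
          (hproj ⟨x.obj, hx⟩ z g).trans (congrArg (_ ≫ ·) (Category.comp_id _)))
      rw [key]
      exact h

end StratumExtension

end PartialFactorization

end Stratification

/-! ### c-Reedy factorizations -/

lemma relMatching_hom_ext {C : Type v} [SmallCategory C] {P : ObjectProperty C} {M : Type u}
    [Category.{v} M] [HasLimits M] {E : P.FullSubcategory ⥤ M} {B : C ⥤ M} {p : E ⟶ P.ι ⋙ B}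
    {x : C} {T : M} {l l' : T ⟶ (relMatching p).obj x}
    (base : l ≫ (relMatchingCone p x).base = l' ≫ (relMatchingCone p x).base)
    (proj : ∀ z g, l ≫ (relMatchingCone p x).proj z g = l' ≫ (relMatchingCone p x).proj z g) :
    l = l' :=
  (isUniversal_relMatchingCone p x ((relMatchingCone p x).precomp l')).unique
    (MatchingCone.ext base (funext fun z => funext fun g => proj z g)) rfl

lemma LatchingCocone.exists_isUniversal {C : Type v} [SmallCategory C] {P : ObjectProperty C}
    {M : Type u} [Category.{v} M] [HasColimits M] {E : P.FullSubcategory ⥤ M} {A : C ⥤ M}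
    (i : P.ι ⋙ A ⟶ E) {D : Type w} [Category.{w'} D] (K : D ⥤ C) :
    ∃ (X : D ⥤ M) (c : LatchingCocone i K X), c.IsUniversal :=
  ⟨_, _, LatchingCocone.isUniversal_ofSq (i := i) (K := K) (IsPushout.of_hasPushout _ _)⟩

namespace Stratification

variable {C : Type v} [SmallCategory C] {S : Stratification C} {M : Type u} [Category.{v} M]
  [HasLimits M]

namespace PartialFactorization

variable {A B : C ⥤ M} {f : A ⟶ B} {δ : Ordinal.{v}} (l : PartialFactorization S f δ)

/-- The cone defining the map from `A` to the relative matching object. -/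
def coneOfSource (x : C) : MatchingCone l.p x (A.obj x) where
  base := f.app x
  proj z g := A.map g ≫ l.i.app z
  proj_map {z z'} g k := by
    refine (Category.assoc _ _ _).trans ((congrArg (_ ≫ ·) (l.i.naturality k).symm).trans ?_)
    refine (Category.assoc _ _ _).symm.trans (congrArg (· ≫ _) (A.map_comp _ _).symm)
  proj_app z g := by
    refine (Category.assoc _ _ _).trans ((congrArg (_ ≫ ·) (congr_app l.fac z)).trans ?_)
    exact f.naturality g

/-- The cone defining the maps between values of `l.E` and relative matching objects. -/
def coneOfBelow (z : S.Below δ) (x : C) (h : z.obj ⟶ x) : MatchingCone l.p x (l.E.obj z) where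
  base := l.p.app z ≫ B.map h
  proj z' g := l.E.map ⟨h ≫ g⟩
  proj_map {z z'} g k := by
    refine (l.E.map_comp _ _).symm.trans (congrArg l.E.map ?_)
    exact InducedCategory.hom_ext (Category.assoc _ _ _)
  proj_app z g := by
    refine (l.p.naturality _).trans ?_
    exact (congrArg (_ ≫ ·) (B.map_comp _ _)).trans (Category.assoc _ _ _).symm

/-- This cocone is the canonical map from the relative latching object to the relative matching
object. It needs only the values of the diagram in degrees below `δ`. -/
theorem exists_latchingCocone_relMatching {D : Type w} [Category.{w'} D] (K : D ⥤ C) :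
    ∃ c : LatchingCocone l.i K (K ⋙ relMatching l.p),
      (∀ d, (relMatchingCone l.p (K.obj d)).precomp (c.base.app d) = l.coneOfSource (K.obj d)) ∧
      ∀ z d h, (relMatchingCone l.p (K.obj d)).precomp (c.incl z d h) =
        l.coneOfBelow z (K.obj d) h := by
  obtain ⟨φ, hφ⟩ := exists_relMatching_lift l.p (K := K) (F := K ⋙ A)
    (fun d => l.coneOfSource (K.obj d)) (fun e => f.naturality (K.map e))
    (fun e z g => (Category.assoc _ _ _).symm.trans (congrArg (· ≫ _) (A.map_comp _ _).symm))
  choose θ hθ _ using fun (z : S.Below δ) (d : D) (h : z.obj ⟶ K.obj d) =>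
    isUniversal_relMatchingCone l.p (K.obj d) (l.coneOfBelow z (K.obj d) h)
  have φ_base d : φ.app d ≫ (relMatchingCone l.p (K.obj d)).base = f.app (K.obj d) :=
    congrArg MatchingCone.base (hφ d)
  have φ_proj d z g : φ.app d ≫ (relMatchingCone l.p (K.obj d)).proj z g =
      A.map g ≫ l.i.app z := congrArg (fun c => c.proj z g) (hφ d)
  have θ_base z d h : θ z d h ≫ (relMatchingCone l.p (K.obj d)).base =
      l.p.app z ≫ B.map h := congrArg MatchingCone.base (hθ z d h)
  have θ_proj z d h z' g : θ z d h ≫ (relMatchingCone l.p (K.obj d)).proj z' g =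
      l.E.map ⟨h ≫ g⟩ := congrArg (fun c => c.proj z' g) (hθ z d h)
  refine ⟨{ base := φ
            incl := θ
            map_incl := fun {z z'} k d h => relMatching_hom_ext ?_ fun z'' g => ?_
            incl_map := fun z d d' h e => relMatching_hom_ext ?_ fun z'' g => ?_
            app_incl := fun z d h => relMatching_hom_ext ?_ fun z'' g => ?_ }, hφ, hθ⟩
  · rw [Category.assoc, θ_base, θ_base, B.map_comp, ← Category.assoc, ← Category.assoc]
    exact congrArg (· ≫ _) (l.p.naturality k)
  · rw [Category.assoc, θ_proj, θ_proj, ← l.E.map_comp]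
    exact congrArg l.E.map (InducedCategory.hom_ext (Category.assoc _ _ _).symm)
  · refine (Category.assoc _ _ _).trans ((congrArg (_ ≫ ·) (relMatching_map_base _ _)).trans ?_)
    rw [← Category.assoc, θ_base, θ_base, B.map_comp, Category.assoc]
  · refine (Category.assoc _ _ _).trans ((congrArg (_ ≫ ·) (relMatching_map_proj _ _ _ _)).trans ?_)
    rw [θ_proj, θ_proj]
    exact congrArg l.E.map (InducedCategory.hom_ext (Category.assoc _ _ _).symm)
  · rw [Category.assoc, θ_base, Category.assoc]
    refine Eq.trans ?_ (congrArg (_ ≫ ·) (φ_base d)).symm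
    refine (Category.assoc _ _ _).symm.trans ((congrArg (· ≫ _) (congr_app l.fac z)).trans ?_)
    exact (f.naturality h).symm
  · rw [Category.assoc, θ_proj, Category.assoc]
    refine Eq.trans ?_ (congrArg (_ ≫ ·) (φ_proj d z'' g)).symm
    refine (l.i.naturality _).symm.trans ?_
    exact (congrArg (· ≫ _) (A.map_comp _ _)).trans (Category.assoc _ _ _)

/-- The extension is a factorization, over the stratum, of the canonical map from latching to
matching objects. Its left factor becomes the relative latching map, and its right factor the
relative matching map. -/
theorem exists_stratumExtension [HasColimits M] {R : MorphismProperty M} (hR : R.llp.rlp = R)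
    (hfac : ∀ {X Y : S.Stratum δ ⥤ M} (g : X ⟶ Y), ∃ (Z : S.Stratum δ ⥤ M) (j : X ⟶ Z) (q : Z ⟶ Y),
      projectiveL R _ j ∧ R.functorCategory _ q ∧ j ≫ q = g) :
    ∃ e : l.StratumExtension,
      (∀ {X Y : S.Stratum δ ⥤ M} (q : X ⟶ Y), R.functorCategory _ q → e.c.Lifts q) ∧
      ∀ (d : S.Stratum δ) {K L : M} (i : K ⟶ L), R.llp i → (e.m d).Lifts i := by
  obtain ⟨cQ, hbase, hincl⟩ := l.exists_latchingCocone_relMatching (S.stratumι δ)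
  have h_bb (d : S.Stratum δ) : cQ.base.app d ≫ (relMatchingCone l.p d.obj).base =
      f.app d.obj := congrArg MatchingCone.base (hbase d)
  have h_bp (d : S.Stratum δ) z g : cQ.base.app d ≫ (relMatchingCone l.p d.obj).proj z g =
      A.map g ≫ l.i.app z := congrArg (fun c => c.proj z g) (hbase d)
  have h_ib z (d : S.Stratum δ) h : cQ.incl z d h ≫ (relMatchingCone l.p d.obj).base =
      l.p.app z ≫ B.map h := congrArg MatchingCone.base (hincl z d h)
  have h_ip z (d : S.Stratum δ) h z' g : cQ.incl z d h ≫ (relMatchingCone l.p d.obj).proj z' g =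
      l.E.map ⟨h ≫ g⟩ := congrArg (fun c => c.proj z' g) (hincl z d h)
  obtain ⟨P, cP, hP⟩ := LatchingCocone.exists_isUniversal l.i (S.stratumι δ)
  obtain ⟨w, hw, -⟩ := hP cQ
  obtain ⟨G, j, q, hj, hq, rfl⟩ := hfac w
  have e_base (d : S.Stratum δ) : (cP.base.app d ≫ j.app d) ≫ q.app d = cQ.base.app d :=
    (Category.assoc _ _ _).trans (congr_app (congrArg LatchingCocone.base hw) d)
  have e_incl z (d : S.Stratum δ) h : (cP.incl z d h ≫ j.app d) ≫ q.app d = cQ.incl z d h :=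
    (Category.assoc _ _ _).trans (congrArg (fun c => c.incl z d h) hw)
  refine ⟨{ G := G
            c := cP.postcomp j
            m := fun d => (relMatchingCone l.p d.obj).precomp (q.app d)
            map_base := fun {d d'} e => ?_
            map_proj := fun {d d'} e z g => ?_
            incl_proj := fun z z' d h g => ?_
            base_proj := fun z d g => ?_
            incl_base := fun z d h => ?_
            base_base := fun d => ?_ }, fun {X Y} p hp => ?_, fun d {K L} i hi => ?_⟩
  · refine (Category.assoc _ _ _).symm.trans ((congrArg (· ≫ _) (q.naturality e)).trans ?_)
    refine (Category.assoc _ _ _).trans ((congrArg (q.app d ≫ ·) (relMatching_map_base l.p e.1)).trans ?_)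
    exact (Category.assoc _ _ _).symm
  · refine (Category.assoc _ _ _).symm.trans ((congrArg (· ≫ _) (q.naturality e)).trans ?_)
    exact (Category.assoc _ _ _).trans (congrArg (q.app d ≫ ·) (relMatching_map_proj l.p e.1 z g))
  · refine (Category.assoc _ _ _).symm.trans ((congrArg (· ≫ _) (e_incl z d h)).trans ?_)
    exact h_ip z d h z' g
  · refine (Category.assoc _ _ _).symm.trans ((congrArg (· ≫ _) (e_base d)).trans ?_)
    exact h_bp d z g
  · refine (Category.assoc _ _ _).symm.trans ((congrArg (· ≫ _) (e_incl z d h)).trans ?_)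
    exact h_ib z d h
  · refine (Category.assoc _ _ _).symm.trans ((congrArg (· ≫ _) (e_base d)).trans ?_)
    exact h_bb d
  · exact (LatchingCocone.IsUniversal.hasLiftingProperty_iff hP rfl p).1 (hj p hp)
  · refine (MatchingCone.IsUniversal.hasLiftingProperty_iff
      (isUniversal_relMatchingCone l.p d.obj) rfl i).1 ?_
    have := hq d
    rw [← hR] at this
    exact this i hi

end PartialFactorization

theorem exists_isReedy [HasColimits M] (hS : S.HasThroughDecomposition) {R : MorphismProperty M}
    (hR : R.llp.rlp = R)
    (hfac : ∀ (δ : Ordinal.{v}) {X Y : S.Stratum δ ⥤ M} (g : X ⟶ Y),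
      ∃ (Z : S.Stratum δ ⥤ M) (j : X ⟶ Z) (q : Z ⟶ Y),
        projectiveL R _ j ∧ R.functorCategory _ q ∧ j ≫ q = g)
    {A B : C ⥤ M} (f : A ⟶ B) (β : Ordinal.{v}) :
    ∃ l : PartialFactorization S f β, l.IsReedy R := by
  obtain ⟨l⟩ := nonempty_of_transfinite
    (T := fun δ => { l : PartialFactorization S f δ // l.IsReedy R })
    (fun h l => ⟨l.1.restrict h, l.2.restrict h⟩) (fun _ => rfl) (fun _ _ _ => rfl)
    ⟨⟨{ E := { obj := fun x => (not_lt_zero x.property).elim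
               map := fun {x _} _ => (not_lt_zero x.property).elim
               map_id := fun x => (not_lt_zero x.property).elim
               map_comp := fun {x _ _} _ _ => (not_lt_zero x.property).elim }
        i := { app := fun x => (not_lt_zero x.property).elim
               naturality := fun {x _} _ => (not_lt_zero x.property).elim }
        p := { app := fun x => (not_lt_zero x.property).elim
               naturality := fun {x _} _ => (not_lt_zero x.property).elim }
        fac := by
          ext x
          exact (not_lt_zero x.property).elim },
      ⟨fun γ hγ => (not_lt_zero hγ).elim, fun γ hγ => (not_lt_zero hγ).elim⟩⟩⟩
    (fun δ l => by
      obtain ⟨e, hc, hm⟩ := l.1.exists_stratumExtension hR (hfac δ)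
      obtain ⟨l', h, h'⟩ := e.exists_isReedy_succ hS l.2 hc hm
      exact ⟨⟨l', h'⟩, Subtype.ext h⟩)
    (fun δ hδ l hl => by
      obtain ⟨l', h⟩ := PartialFactorization.exists_limit hδ (fun i hi => (l i hi).1)
        fun i k hk hik => congrArg Subtype.val (hl i k hk hik)
      refine ⟨⟨l', PartialFactorization.isReedy_of_restrict fun γ hγ =>
        ⟨Order.succ γ, (hδ.succ_lt hγ).le, Order.lt_succ γ, ?_⟩⟩,
        fun i hi => Subtype.ext (h i hi)⟩
      rw [h _ (hδ.succ_lt hγ)]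
      exact (l _ _).2) β
  exact ⟨l.1, l.2⟩

theorem HasThroughDecomposition.exists_factorization [HasColimits M] (hS : S.HasThroughDecomposition)
    {β : Ordinal.{v}} (hβ : ∀ x, S.deg x < β) {R : MorphismProperty M}
    (hR : R.llp.rlp = R)
    (hfac : ∀ (δ : Ordinal.{v}) {X Y : S.Stratum δ ⥤ M} (g : X ⟶ Y),
      ∃ (Z : S.Stratum δ ⥤ M) (j : X ⟶ Z) (q : Z ⟶ Y),
        projectiveL R _ j ∧ R.functorCategory _ q ∧ j ≫ q = g)
    {A B : C ⥤ M} (f : A ⟶ B) :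
    ∃ (E : C ⥤ M) (i : A ⟶ E) (p : E ⟶ B), S.cReedyL R i ∧ S.cReedyR R p ∧ i ≫ p = f := by
  obtain ⟨l, hl⟩ := exists_isReedy hS hR hfac f β
  -- Every object has degree below `β`, so stage `β` already covers all of `C`.
  let t : C ⥤ S.Below β := { obj := fun x => ⟨x, hβ x⟩, map := fun k => ⟨k⟩ }
  let i : A ⟶ t ⋙ l.E :=
    { app := fun x => l.i.app (t.obj x), naturality := fun _ _ k => l.i.naturality (t.map k) }
  let p : t ⋙ l.E ⟶ B :=
    { app := fun x => l.p.app (t.obj x), naturality := fun _ _ k => l.p.naturality (t.map k) }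
  refine ⟨t ⋙ l.E, i, p, fun δ => ?_, ?_, ?_⟩
  · refine (S.projectiveL_latchingMap_iff R δ i _).2 fun q hq => ?_
    by_cases hδ : δ < β
    · exact hl.latching δ hδ q hq
    -- The class `cReedyL` quantifies over all ordinals; strata from `β` on are empty and impose no
    -- condition.
    · have : IsEmpty (S.Stratum δ) := ⟨fun d => hδ (d.deg_obj ▸ hβ d.obj)⟩
      intro b c _
      refine ⟨{ app := fun d => isEmptyElim d, naturality := fun d => isEmptyElim d }, ?_, ?_⟩
      · ext d
        exact isEmptyElim d
      · exact LatchingCocone.ext (by ext d; exact isEmptyElim d)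
          (funext fun _ => funext fun d => isEmptyElim d)
  · exact (S.cReedyR_iff hR p).2 fun x K L j hj =>
      hl.matching (S.deg x) (hβ x) (t.obj x) rfl j hj
  · ext x
    exact congr_app l.fac (t.obj x)

end Stratification

/-! ### Retracts and the c-Reedy weak factorization system -/

namespace Stratification

variable {C : Type v} [SmallCategory C] {M : Type u} [Category.{v} M]

section Retracts

variable {A B A' B' : C ⥤ M} {f : A ⟶ B} {f' : A' ⟶ B'} (r : RetractArrow f f')
  (P : ObjectProperty C)

-- A problem for `f` is carried to `f'` by the section of the retract, solved there, and its
-- solution is carried back by the retraction.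
include r in
lemma matchingCone_lifts_of_retract (x : C) {K L : M} (i : K ⟶ L)
    (h : (matchingCone P f' x).Lifts i) : (matchingCone P f x).Lifts i := by
  intro t c hc
  have hi (x : C) : r.i.left.app x ≫ f'.app x = f.app x ≫ r.i.right.app x := congr_app r.i_w x
  have hr (x : C) : r.r.left.app x ≫ f.app x = f'.app x ≫ r.r.right.app x := congr_app r.r_w x
  have hl (x : C) : r.i.left.app x ≫ r.r.left.app x = 𝟙 (A.obj x) := congr_app r.retract_left x
  have hr' (x : C) : r.i.right.app x ≫ r.r.right.app x = 𝟙 (B.obj x) := congr_app r.retract_right x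
  have hc_base : t ≫ f.app x = i ≫ c.base := congrArg MatchingCone.base hc
  have hc_proj z g : t ≫ A.map g = i ≫ c.proj z g := congrArg (fun c => c.proj z g) hc
  let c' : MatchingCone (Functor.whiskerLeft P.ι f') x L :=
    { base := c.base ≫ r.i.right.app x
      proj z g := c.proj z g ≫ r.i.left.app z.obj
      proj_map {z z'} g k := by
        rw [← c.proj_map g k, Category.assoc, Category.assoc]
        exact congrArg _ (r.i.left.naturality k.hom).symm
      proj_app z g := by
        refine (Category.assoc _ _ _).trans ((congrArg (_ ≫ ·) (hi z.obj)).trans ?_)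
        refine (Category.assoc _ _ _).symm.trans ((congrArg (· ≫ _) (c.proj_app z g)).trans ?_)
        refine (Category.assoc _ _ _).trans ((congrArg (_ ≫ ·) (r.i.right.naturality g)).trans ?_)
        exact (Category.assoc _ _ _).symm }
  obtain ⟨l, hl₁, hl₂⟩ := h (t ≫ r.i.left.app x) c' (by
    refine MatchingCone.ext ?_ (funext fun z => funext fun g => ?_)
    · refine (Category.assoc _ _ _).trans ((congrArg (t ≫ ·) (hi x)).trans ?_)
      refine (Category.assoc _ _ _).symm.trans ((congrArg (· ≫ _) hc_base).trans ?_)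
      exact Category.assoc _ _ _
    · refine (Category.assoc _ _ _).trans
        ((congrArg (t ≫ ·) (r.i.left.naturality g).symm).trans ?_)
      refine (Category.assoc _ _ _).symm.trans ((congrArg (· ≫ _) (hc_proj z g)).trans ?_)
      exact Category.assoc _ _ _)
  have h_base : l ≫ f'.app x = c.base ≫ r.i.right.app x := congrArg MatchingCone.base hl₂
  have h_proj z g : l ≫ A'.map g = c.proj z g ≫ r.i.left.app z.obj :=
    congrArg (fun c => c.proj z g) hl₂
  refine ⟨l ≫ r.r.left.app x, ?_, MatchingCone.ext ?_ (funext fun z => funext fun g => ?_)⟩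
  · rw [← Category.assoc, hl₁, Category.assoc, hl, Category.comp_id]
  · refine (Category.assoc _ _ _).trans ((congrArg (l ≫ ·) (hr x)).trans ?_)
    refine (Category.assoc _ _ _).symm.trans ((congrArg (· ≫ _) h_base).trans ?_)
    exact (Category.assoc _ _ _).trans ((congrArg (_ ≫ ·) (hr' x)).trans (Category.comp_id _))
  · refine (Category.assoc _ _ _).trans ((congrArg (l ≫ ·) (r.r.left.naturality g).symm).trans ?_)
    refine (Category.assoc _ _ _).symm.trans ((congrArg (· ≫ _) (h_proj z g)).trans ?_)
    exact (Category.assoc _ _ _).trans ((congrArg (_ ≫ ·) (hl z.obj)).trans (Category.comp_id _))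

include r in
lemma latchingCocone_lifts_of_retract {D : Type w} [Category.{w'} D] (K : D ⥤ C) {Y Z : D ⥤ M}
    (p : Y ⟶ Z) (h : (latchingCocone P f' K).Lifts p) : (latchingCocone P f K).Lifts p := by
  intro b c hc
  have hi (x : C) : r.i.left.app x ≫ f'.app x = f.app x ≫ r.i.right.app x := congr_app r.i_w x
  have hr (x : C) : r.r.left.app x ≫ f.app x = f'.app x ≫ r.r.right.app x := congr_app r.r_w x
  have hl (x : C) : r.i.left.app x ≫ r.r.left.app x = 𝟙 (A.obj x) := congr_app r.retract_left x
  have hr' (x : C) : r.i.right.app x ≫ r.r.right.app x = 𝟙 (B.obj x) := congr_app r.retract_right x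
  have hc_base d : c.base.app d ≫ p.app d = f.app (K.obj d) ≫ b.app d :=
    congr_app (congrArg LatchingCocone.base hc) d
  have hc_incl z d h : c.incl z d h ≫ p.app d = B.map h ≫ b.app d :=
    congrArg (fun c => c.incl z d h) hc
  let c' : LatchingCocone (Functor.whiskerLeft P.ι f') K Y :=
    { base := Functor.whiskerLeft K r.r.left ≫ c.base
      incl z d h := r.r.right.app z.obj ≫ c.incl z d h
      map_incl {z z'} k d h := by
        refine (Category.assoc _ _ _).symm.trans
          ((congrArg (· ≫ _) (r.r.right.naturality k.hom)).trans ?_)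
        exact (Category.assoc _ _ _).trans (congrArg (_ ≫ ·) (c.map_incl k h))
      incl_map z d d' h e := (Category.assoc _ _ _).trans (congrArg (_ ≫ ·) (c.incl_map z h e))
      app_incl z d h := by
        refine (Category.assoc _ _ _).symm.trans ((congrArg (· ≫ _) (hr z.obj).symm).trans ?_)
        refine (Category.assoc _ _ _).trans ((congrArg (_ ≫ ·) (c.app_incl z h)).trans ?_)
        refine (Category.assoc _ _ _).symm.trans
          ((congrArg (· ≫ _) (r.r.left.naturality h).symm).trans ?_)
        exact Category.assoc _ _ _ }
  obtain ⟨l, hl₁, hl₂⟩ := h (Functor.whiskerLeft K r.r.right ≫ b) c' (by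
    refine LatchingCocone.ext ?_ (funext fun z => funext fun d => funext fun h => ?_)
    · ext d
      refine (Category.assoc _ _ _).trans ((congrArg (_ ≫ ·) (hc_base d)).trans ?_)
      refine (Category.assoc _ _ _).symm.trans ((congrArg (· ≫ _) (hr _)).trans ?_)
      exact Category.assoc _ _ _
    · refine (Category.assoc _ _ _).trans ((congrArg (_ ≫ ·) (hc_incl z d h)).trans ?_)
      refine (Category.assoc _ _ _).symm.trans
        ((congrArg (· ≫ _) (r.r.right.naturality h).symm).trans ?_)
      exact Category.assoc _ _ _)
  have h_base d : f'.app (K.obj d) ≫ l.app d = r.r.left.app (K.obj d) ≫ c.base.app d :=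
    congr_app (congrArg LatchingCocone.base hl₂) d
  have h_incl z d h : B'.map h ≫ l.app d = r.r.right.app z.obj ≫ c.incl z d h :=
    congrArg (fun c => c.incl z d h) hl₂
  refine ⟨Functor.whiskerLeft K r.i.right ≫ l, ?_,
    LatchingCocone.ext ?_ (funext fun z => funext fun d => funext fun h => ?_)⟩
  · rw [Category.assoc, hl₁]
    ext d
    refine (Category.assoc _ _ _).symm.trans ((congrArg (· ≫ _) (hr' _)).trans ?_)
    exact Category.id_comp _
  · ext d
    refine (Category.assoc _ _ _).symm.trans ((congrArg (· ≫ _) (hi (K.obj d)).symm).trans ?_)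
    refine (Category.assoc _ _ _).trans ((congrArg (_ ≫ ·) (h_base d)).trans ?_)
    refine (Category.assoc _ _ _).symm.trans ((congrArg (· ≫ _) (hl _)).trans ?_)
    exact Category.id_comp _
  · refine (Category.assoc _ _ _).symm.trans
      ((congrArg (· ≫ _) (r.i.right.naturality h)).trans ?_)
    refine (Category.assoc _ _ _).trans ((congrArg (_ ≫ ·) (h_incl z d h)).trans ?_)
    refine (Category.assoc _ _ _).symm.trans ((congrArg (· ≫ _) (hr' _)).trans ?_)
    exact Category.id_comp _

end Retracts

variable {S : Stratification C} {R : MorphismProperty M}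

lemma isStableUnderRetracts_cReedyR [HasLimits M] (hR : R.llp.rlp = R) :
    (S.cReedyR R).IsStableUnderRetracts where
  of_retract r h := (S.cReedyR_iff hR _).2 fun x _ _ i hi =>
    matchingCone_lifts_of_retract r _ x i ((S.cReedyR_iff hR _).1 h x i hi)

lemma isStableUnderRetracts_cReedyL [HasColimits M] :
    (S.cReedyL R).IsStableUnderRetracts where
  of_retract r h δ := (S.projectiveL_latchingMap_iff R δ _ _).2 fun p hp =>
    latchingCocone_lifts_of_retract r _ _ p ((S.projectiveL_latchingMap_iff R δ _ _).1 (h δ) p hp)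

lemma hasLiftingProperty_of_cReedyL_of_cReedyR [HasLimits M] [HasColimits M]
    (hS : S.HasThroughDecomposition) {β : Ordinal.{v}} (hβ : ∀ x, S.deg x < β)
    (hR : R.llp.rlp = R) {A B X Y : C ⥤ M} {f : A ⟶ B} {p : X ⟶ Y} (hf : S.cReedyL R f)
    (hp : S.cReedyR R p) : HasLiftingProperty f p where
  sq_hasLift {a b} sq := by
    obtain ⟨l, hl₁, hl₂⟩ := hS.exists_lift_below hR (β := β) (f := f) (p := p)
      (a := Functor.whiskerLeft _ a) (b := Functor.whiskerLeft _ b)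
      (by rw [← Functor.whiskerLeft_comp, ← Functor.whiskerLeft_comp, sq.w])
      (fun δ _ _ _ => (S.projectiveL_latchingMap_iff R δ f _).1 (hf δ))
      (fun x _ _ _ => (S.cReedyR_iff hR p).1 hp x)
    refine ⟨⟨{ l := { app := fun x => l.app ⟨x, hβ x⟩
                      naturality := fun x y k =>
                        l.naturality (X := ⟨x, hβ x⟩) (Y := ⟨y, hβ y⟩) ⟨k⟩ }
               fac_left := ?_, fac_right := ?_ }⟩⟩
    · ext x
      exact congr_app hl₁ ⟨x, hβ x⟩
    · ext x
      exact congr_app hl₂ ⟨x, hβ x⟩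

lemma isWeakFactorizationSystem_cReedy [HasLimits M] [HasColimits M]
    (hS : S.HasThroughDecomposition) {β : Ordinal.{v}} (hβ : ∀ x, S.deg x < β)
    (hR : R.llp.rlp = R)
    (hfac : ∀ (δ : Ordinal.{v}) {X Y : S.Stratum δ ⥤ M} (g : X ⟶ Y),
      ∃ (Z : S.Stratum δ ⥤ M) (j : X ⟶ Z) (q : Z ⟶ Y),
        projectiveL R _ j ∧ R.functorCategory _ q ∧ j ≫ q = g) :
    (S.cReedyL R).IsWeakFactorizationSystem (S.cReedyR R) := by
  have := isStableUnderRetracts_cReedyR (S := S) hR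
  have := isStableUnderRetracts_cReedyL (S := S) (R := R)
  have : (S.cReedyL R).HasFactorization (S.cReedyR R) := ⟨fun f => by
    obtain ⟨E, i, p, hi, hp, fac⟩ := hS.exists_factorization hβ hR hfac f
    exact ⟨⟨E, i, p, fac, hi, hp⟩⟩⟩
  exact .mk' _ _ fun i p hi hp => hasLiftingProperty_of_cReedyL_of_cReedyR hS hβ hR hi hp

end Stratification

/-! ### Projective model structures -/

section Projective

variable {D : Type w} [Category.{w'} D] {M : Type u} [Category.{v} M] [ModelCategory M]

lemma fibrations_llp_rlp : (fibrations M).llp.rlp = fibrations M := by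
  rw [MorphismProperty.llp_eq_of_wfs (trivialCofibrations M) (fibrations M),
    MorphismProperty.rlp_eq_of_wfs (trivialCofibrations M) (fibrations M)]

lemma trivialFibrations_llp_rlp : (trivialFibrations M).llp.rlp = trivialFibrations M := by
  rw [MorphismProperty.llp_eq_of_wfs (cofibrations M) (trivialFibrations M),
    MorphismProperty.rlp_eq_of_wfs (cofibrations M) (trivialFibrations M)]

namespace HasProjectiveModelStructure

variable (h : HasProjectiveModelStructure D M)

include h

/-- Both sides are the trivial cofibrations of the projective model structure. This connects the
class in the theorem with the left class of the c-Reedy system for fibrations. -/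
lemma acyclicProjectiveCofibrations_eq :
    acyclicProjectiveCofibrations D M = projectiveL (fibrations M) D := by
  obtain ⟨_, hW, hF⟩ := h
  have hTF : trivialFibrations (D ⥤ M) = (trivialFibrations M).functorCategory D := by
    rw [trivialFibrations, hW, hF]
    exact le_antisymm (fun _ _ _ hf x => ⟨hf.1 x, hf.2 x⟩)
      fun _ _ _ hf => ⟨fun x => (hf x).1, fun x => (hf x).2⟩
  rw [acyclicProjectiveCofibrations, projectiveCofibrations, projectiveL, projectiveL, ← hTF, ← hF,
    ← hW, MorphismProperty.llp_eq_of_wfs (cofibrations (D ⥤ M)) (trivialFibrations (D ⥤ M)),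
    MorphismProperty.llp_eq_of_wfs (trivialCofibrations (D ⥤ M)) (fibrations (D ⥤ M))]
  rfl

lemma exists_factorization_trivialFibrations {X Y : D ⥤ M} (g : X ⟶ Y) :
    ∃ (Z : D ⥤ M) (j : X ⟶ Z) (q : Z ⟶ Y),
      projectiveL (trivialFibrations M) D j ∧ (trivialFibrations M).functorCategory D q ∧
        j ≫ q = g := by
  obtain ⟨_, hW, hF⟩ := h
  have hTF : trivialFibrations (D ⥤ M) = (trivialFibrations M).functorCategory D := by
    rw [trivialFibrations, hW, hF]
    exact le_antisymm (fun _ _ _ hf x => ⟨hf.1 x, hf.2 x⟩)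
      fun _ _ _ hf => ⟨fun x => (hf x).1, fun x => (hf x).2⟩
  let d := MorphismProperty.factorizationData (cofibrations (D ⥤ M)) (trivialFibrations (D ⥤ M)) g
  refine ⟨d.Z, d.i, d.p, ?_, hTF ▸ d.hp, d.fac⟩
  rw [projectiveL, ← hTF,
    MorphismProperty.llp_eq_of_wfs (cofibrations (D ⥤ M)) (trivialFibrations (D ⥤ M))]
  exact d.hi

lemma exists_factorization_fibrations {X Y : D ⥤ M} (g : X ⟶ Y) :
    ∃ (Z : D ⥤ M) (j : X ⟶ Z) (q : Z ⟶ Y),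
      projectiveL (fibrations M) D j ∧ (fibrations M).functorCategory D q ∧ j ≫ q = g := by
  obtain ⟨_, hW, hF⟩ := h
  let d := MorphismProperty.factorizationData (trivialCofibrations (D ⥤ M)) (fibrations (D ⥤ M)) g
  refine ⟨d.Z, d.i, d.p, ?_, hF ▸ d.hp, d.fac⟩
  rw [projectiveL, ← hF,
    MorphismProperty.llp_eq_of_wfs (trivialCofibrations (D ⥤ M)) (fibrations (D ⥤ M))]
  exact d.hi

end HasProjectiveModelStructure

end Projective

/-! ### Acyclic maps and the model structure -/

namespace Stratification

variable {C : Type v} [SmallCategory C] {S : Stratification C} {M : Type u} [Category.{v} M]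

lemma IsAlmostCReedy.hasThroughDecomposition (hS : S.IsAlmostCReedy) : S.HasThroughDecomposition :=
  hS.isBistratified.hasThroughDecomposition

section Matching

variable [HasLimits M] {A B : C ⥤ M} {f : A ⟶ B}

lemma cReedyR_mono {R R' : MorphismProperty M} (h : R ≤ R') : S.cReedyR R ≤ S.cReedyR R' :=
  fun _ _ _ hf x => h _ (hf x)

lemma IsAlmostCReedy.matching_map_app_mem (hS : S.IsAlmostCReedy) {R : MorphismProperty M}
    (hR : R.llp.rlp = R) (x : C) (hf : ∀ y, S.deg y < S.deg x → R (S.matchingMap f y)) :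
    R (((S.matching (S.deg x)).map f).app x) :=
  Stratification.matching_map_app_mem hS.hasThroughDecomposition x (hS.coyoneda x) hR f
    fun y hy _ _ i hi => (S.hasLiftingProperty_matchingMap_iff f y i).1 <| by
      have := hf y hy
      rw [← hR] at this
      exact this i hi

lemma matchingMap_snd (x : C) : S.matchingMap f x ≫ pullback.snd _ _ = f.app x :=
  pullback.lift_snd _ _ _

end Matching

section Latching

variable [HasColimits M] {A B : C ⥤ M} {f : A ⟶ B}

lemma cReedyL_anti {R R' : MorphismProperty M} (h : R ≤ R') : S.cReedyL R' ≤ S.cReedyL R :=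
  fun _ _ _ hf δ _ _ p hp => hf δ p fun d => h _ (hp d)

lemma IsAlmostCReedy.latching_map_app_mem [HasLimits M] (hS : S.IsAlmostCReedy) {R : MorphismProperty M}
    (hR : R.llp.rlp = R) (x : C)
    (hf : ∀ δ < S.deg x, projectiveL R (S.Stratum δ) (S.stratumLatchingMap δ f)) :
    R.llp (((S.latching (S.deg x)).map f).app x) :=
  Stratification.latching_map_app_mem hS.hasThroughDecomposition x (hS.yoneda x) hR f
    fun δ hδ _ _ => (S.projectiveL_latchingMap_iff R δ f _).1 (hf δ hδ)

lemma inr_latchingMap (δ : Ordinal.{v}) {D : Type w} [Category.{w'} D] (K : D ⥤ C) (d : D) :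
    (pushout.inr (Functor.whiskerLeft K ((S.latching δ).map f))
      (Functor.whiskerLeft K ((S.fromLatching δ).app A))).app d ≫ (S.latchingMap δ K f).app d =
        f.app (K.obj d) :=
  congr_app (show pushout.inr _ _ ≫ S.latchingMap δ K f = Functor.whiskerLeft K f from
    pushout.inr_desc _ _ _) d

end Latching

section ModelCategory

variable [ModelCategory M] {A B : C ⥤ M} {f : A ⟶ B}

/-- The map `f_x` is the relative matching map followed by a base change of `M_x f`, which is an
acyclic fibration. Two-out-of-three concludes. -/
lemma weakEquivalence_matchingMap_iff [HasLimits M] (x : C)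
    (hx : trivialFibrations M (((S.matching (S.deg x)).map f).app x)) :
    weakEquivalences M (S.matchingMap f x) ↔ weakEquivalences M (f.app x) := by
  rw [← matchingMap_snd (S := S) (f := f) x]
  have : weakEquivalences M (pullback.snd (((S.matching (S.deg x)).map f).app x)
      (((S.toMatching (S.deg x)).app B).app x)) :=
    ((trivialFibrations M).pullback_snd _ _ hx).2
  exact ((weakEquivalences M).postcomp_iff (W' := weakEquivalences M) _ _ this).symm

lemma weakEquivalence_latchingMap_app_iff [HasColimits M] (δ : Ordinal.{v}) {D : Type w} [Category.{w'} D]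
    (K : D ⥤ C) (d : D)
    (hd : trivialCofibrations M (((S.latching δ).map f).app (K.obj d))) :
    weakEquivalences M ((S.latchingMap δ K f).app d) ↔
      weakEquivalences M (f.app (K.obj d)) := by
  rw [← inr_latchingMap (S := S) δ K d]
  have h := (IsPushout.of_hasPushout (Functor.whiskerLeft K ((S.latching δ).map f))
    (Functor.whiskerLeft K ((S.fromLatching δ).app A))).map ((evaluation D M).obj d)
  exact ((weakEquivalences M).precomp_iff (W' := weakEquivalences M) _ _
    ((trivialCofibrations M).of_isPushout h.flip hd).2).symm

variable [HasLimits M] (hS : S.IsAlmostCReedy)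

include hS

/-- If the relative matching maps below the degree of `x` are acyclic fibrations, then so is `M_x
f`, and acyclicity at `x` can be read off from `f_x`. One inclusion knows this hypothesis outright;
the other obtains it by induction on the degree. -/
lemma IsAlmostCReedy.cReedyR_trivialFibrations :
    S.cReedyR (trivialFibrations M) =
      S.cReedyR (fibrations M) ⊓ (weakEquivalences M).functorCategory C := by
  refine le_antisymm (fun A B f hf => ?_) (fun A B f hf x => ?_)
  · refine ⟨cReedyR_mono (trivialFibrations_sub_fibrations M) f hf, fun x => ?_⟩
    exact (weakEquivalence_matchingMap_iff x (hS.matching_map_app_mem trivialFibrations_llp_rlp x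
      fun y _ => hf y)).1 (hf x).2
  · suffices ∀ (δ : Ordinal.{v}) (x : C), S.deg x = δ → trivialFibrations M (S.matchingMap f x) from
      this _ x rfl
    intro δ
    induction δ using WellFoundedLT.induction with
    | ind δ ih =>
      rintro x rfl
      exact ⟨hf.1 x, (weakEquivalence_matchingMap_iff x (hS.matching_map_app_mem
        trivialFibrations_llp_rlp x fun y hy => ih _ hy y rfl)).2 (hf.2 x)⟩

lemma IsAlmostCReedy.trivialCofibrations_latching_map_app [HasColimits M] (x : C)
    (hf : ∀ δ < S.deg x, projectiveL (fibrations M) (S.Stratum δ) (S.stratumLatchingMap δ f)) :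
    trivialCofibrations M (((S.latching (S.deg x)).map f).app x) := by
  rw [← MorphismProperty.llp_eq_of_wfs (trivialCofibrations M) (fibrations M)]
  exact hS.latching_map_app_mem fibrations_llp_rlp x hf

variable [HasColimits M] (hM : ∀ δ : Ordinal.{v}, HasProjectiveModelStructure (S.Stratum δ) M)

include hM

/-- The dual argument with `L_x f`, once the projective model structures identify left lifting
against objectwise fibrations with being an acyclic projective-cofibration. -/
lemma IsAlmostCReedy.cReedyL_fibrations :
    S.cReedyL (fibrations M) =
      S.cReedyL (trivialFibrations M) ⊓ (weakEquivalences M).functorCategory C := by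
  refine le_antisymm (fun A B f hf => ?_) (fun A B f hf δ => ?_)
  · refine ⟨cReedyL_anti (trivialFibrations_sub_fibrations M) f hf, fun x => ?_⟩
    have h := hf (S.deg x)
    rw [← (hM _).acyclicProjectiveCofibrations_eq] at h
    exact (weakEquivalence_latchingMap_app_iff (S.deg x) (S.stratumι (S.deg x)) ⟨x, rfl⟩
      (hS.trivialCofibrations_latching_map_app x fun γ _ => hf γ)).1 (h.2 ⟨x, rfl⟩)
  · induction δ using WellFoundedLT.induction with
    | ind δ ih =>
      rw [← (hM _).acyclicProjectiveCofibrations_eq]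
      refine ⟨hf.1 δ, ?_⟩
      rintro ⟨x, rfl⟩
      exact (weakEquivalence_latchingMap_app_iff (S.deg x) (S.stratumι (S.deg x)) ⟨x, rfl⟩
        (hS.trivialCofibrations_latching_map_app x fun γ hγ => ih γ hγ)).2 (hf.2 x)

/-- The c-Reedy model structure. -/
theorem IsAlmostCReedy.exists_modelCategory :
    ∃ _ : ModelCategory (C ⥤ M),
      weakEquivalences (C ⥤ M) = (weakEquivalences M).functorCategory C ∧
      fibrations (C ⥤ M) = S.cReedyR (fibrations M) ∧
      trivialFibrations (C ⥤ M) = S.cReedyR (trivialFibrations M) ∧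
      cofibrations (C ⥤ M) = S.cReedyL (trivialFibrations M) ∧
      trivialCofibrations (C ⥤ M) = S.cReedyL (fibrations M) := by
  obtain ⟨β, h⟩ := hS.isBistratified
  obtain ⟨hβ, h⟩ := h.deg_lt_and_hasThroughDecomposition
  let _ : CategoryWithFibrations (C ⥤ M) := ⟨S.cReedyR (fibrations M)⟩
  let _ : CategoryWithCofibrations (C ⥤ M) := ⟨S.cReedyL (trivialFibrations M)⟩
  let _ : CategoryWithWeakEquivalences (C ⥤ M) := ⟨(weakEquivalences M).functorCategory C⟩
  have hTF : trivialFibrations (C ⥤ M) = S.cReedyR (trivialFibrations M) :=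
    hS.cReedyR_trivialFibrations.symm
  have hTC : trivialCofibrations (C ⥤ M) = S.cReedyL (fibrations M) :=
    (hS.cReedyL_fibrations hM).symm
  have : (weakEquivalences (C ⥤ M)).HasTwoOutOfThreeProperty :=
    { comp_mem f g hf hg x := (weakEquivalences M).comp_mem _ _ (hf x) (hg x)
      of_postcomp f g hg hfg x := (weakEquivalences M).of_postcomp _ _ (hg x) (hfg x)
      of_precomp f g hf hfg x := (weakEquivalences M).of_precomp _ _ (hf x) (hfg x) }
  have : (cofibrations (C ⥤ M)).IsWeakFactorizationSystem (trivialFibrations (C ⥤ M)) := by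
    rw [hTF]
    exact isWeakFactorizationSystem_cReedy h hβ trivialFibrations_llp_rlp
      fun δ _ _ => (hM δ).exists_factorization_trivialFibrations
  have : (trivialCofibrations (C ⥤ M)).IsWeakFactorizationSystem (fibrations (C ⥤ M)) := by
    rw [hTC]
    exact isWeakFactorizationSystem_cReedy h hβ fibrations_llp_rlp
      fun δ _ _ => (hM δ).exists_factorization_fibrations
  exact ⟨ModelCategory.mk' _, rfl, rfl, hTF, rfl, hTC⟩

end ModelCategory

end Stratification

/-! ### Strata that are groupoids -/

/-- The comma category of `x` over `ι` is empty or has an initial object `g₀`, so the Kan extension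
at `x` is terminal or is the value at `z₀`. Inclusions of automorphism groups in a groupoid are of
this kind. -/
lemma KanExtension.ran_map_app_mem {C : Type v} [SmallCategory C] {D : Type w} [Category.{v} D]
    {ι : D ⥤ C} {M : Type u} [Category.{v} M] [∀ x, HasLimitsOfShape (StructuredArrow x ι) M]
    {R : MorphismProperty M} (hR : R.llp.rlp = R) {E B : D ⥤ M} (p : E ⟶ B)
    (hp : R.functorCategory D p) (x : C)
    (hx : ∀ (z : D) (_ : x ⟶ ι.obj z), ∃ (z₀ : D) (g₀ : x ⟶ ι.obj z₀),
      ∀ (z : D) (g : x ⟶ ι.obj z), ∃! k : z₀ ⟶ z, g₀ ≫ ι.map k = g) :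
    R ((ι.ran.map p).app x) := by
  rw [← hR]
  refine fun K L i hi => ⟨fun {t s} sq => ?_⟩
  by_cases h : ∃ z, Nonempty (x ⟶ ι.obj z)
  · obtain ⟨z, ⟨g⟩⟩ := h
    obtain ⟨z₀, g₀, h₀⟩ := hx z g
    choose k hk hk' using h₀
    replace hk (z : D) (g : x ⟶ ι.obj z) : g₀ ≫ ι.map (k z g) = g := hk z g
    replace hk' (z : D) (g : x ⟶ ι.obj z) (l : z₀ ⟶ z) (hl : g₀ ≫ ι.map l = g) : l = k z g :=
      hk' z g l hl
    have := hi (p.app z₀) (hp z₀)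
    have sq₀ : CommSq (t ≫ ranπ ι E g₀) i (p.app z₀) (s ≫ ranπ ι B g₀) := ⟨by
      rw [Category.assoc, ← ran_map_app_ranπ, ← Category.assoc, sq.w, Category.assoc]⟩
    obtain ⟨l, hl⟩ := exists_ran_lift (ι := ι) E (x := x) (fun z g => sq₀.lift ≫ E.map (k z g))
      fun z z' g u => by
        rw [Category.assoc, ← E.map_comp, hk' z' (g ≫ ι.map u) (k z g ≫ u)
          (by rw [ι.map_comp, ← Category.assoc, hk])]
    refine ⟨⟨l, ran_hom_ext _ fun z g => ?_, ran_hom_ext _ fun z g => ?_⟩⟩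
    · rw [Category.assoc, hl, sq₀.fac_left_assoc, Category.assoc, ranπ_map, hk]
    · rw [Category.assoc, ran_map_app_ranπ, ← Category.assoc, hl, Category.assoc, p.naturality,
        sq₀.fac_right_assoc, Category.assoc, ranπ_map, hk]
  · obtain ⟨l, -⟩ := exists_ran_lift (ι := ι) E (x := x) (T := L)
      (fun z g => (h ⟨z, ⟨g⟩⟩).elim) fun z z' g => (h ⟨z, ⟨g⟩⟩).elim
    exact ⟨⟨l, ran_hom_ext _ fun z g => (h ⟨z, ⟨g⟩⟩).elim, ran_hom_ext _ fun z g =>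
      (h ⟨z, ⟨g⟩⟩).elim⟩⟩

/-- Lifts of diagrams on a groupoid may be constructed from equivariant lifts at every object. -/
lemma hasLiftingProperty_of_isGroupoid {G : Type w} [Category.{w'} G] [IsGroupoid G] {M : Type u}
    [Category.{v} M] {X Y E B : G ⥤ M} (φ : X ⟶ Y) (p : E ⟶ B)
    (h : ∀ (a : X ⟶ E) (b : Y ⟶ B), CommSq a φ p b → ∀ g : G, ∃ l : Y.obj g ⟶ E.obj g,
      (∀ e : g ⟶ g, Y.map e ≫ l = l ≫ E.map e) ∧ φ.app g ≫ l = a.app g ∧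
        l ≫ p.app g = b.app g) : HasLiftingProperty φ p := by
  refine ⟨fun {a b} sq => ?_⟩
  choose l hl hl₁ hl₂ using h a b sq
  -- Only the lifts at one representative of each isomorphism class are kept; elsewhere they are
  -- defined by transport along a chosen isomorphism `c`. Equivariance makes the result natural.
  let r (g : G) : G := @Quotient.out G (isIsomorphicSetoid G) (@Quotient.mk' G (isIsomorphicSetoid G) g)
  have r_eq {g g' : G} (k : g ⟶ g') : r g = r g' :=
    congrArg (@Quotient.out G (isIsomorphicSetoid G))
      (@Quotient.sound' G (isIsomorphicSetoid G) _ _ ⟨asIso k⟩)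
  have c (g : G) : g ⟶ r g :=
    (@Quotient.mk_out' G (isIsomorphicSetoid G) g).some.inv
  -- The representatives of `g` and `g'` are equal only propositionally, hence the two variables `s`
  -- and `s'`.
  have key {g g' s s' : G} (hs : s = s') (c : g ⟶ s) (c' : g' ⟶ s') (k : g ⟶ g') :
      Y.map k ≫ Y.map c' ≫ l s' ≫ E.map (inv c') = (Y.map c ≫ l s ≫ E.map (inv c)) ≫ E.map k := by
    subst hs
    have := hl s (inv c ≫ k ≫ c')
    have h₁ : Y.map k ≫ Y.map c' = Y.map c ≫ Y.map (inv c ≫ k ≫ c') := by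
      rw [← Y.map_comp, ← Y.map_comp, IsIso.hom_inv_id_assoc]
    rw [← Category.assoc, h₁, Category.assoc, reassoc_of% this, ← E.map_comp]
    simp
  refine ⟨⟨{ app := fun g => Y.map (c g) ≫ l (r g) ≫ E.map (inv (c g))
             naturality := fun g g' k => key (r_eq k) (c g) (c g') k }, ?_, ?_⟩⟩
  · ext g
    rw [NatTrans.comp_app, ← φ.naturality_assoc, reassoc_of% (hl₁ (r g)), ← a.naturality,
      ← X.map_comp_assoc, IsIso.hom_inv_id, X.map_id, Category.id_comp]
  · ext g
    rw [NatTrans.comp_app, Category.assoc, Category.assoc, p.naturality,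
      reassoc_of% (hl₂ (r g)), ← b.naturality, ← Y.map_comp_assoc, IsIso.hom_inv_id, Y.map_id,
      Category.id_comp]

namespace Stratification

variable {C : Type v} [SmallCategory C] {S : Stratification C} {M : Type u} [Category.{v} M]

section

variable [HasColimits M]

/-- Colimits of diagrams are objectwise, so restriction along `K'` preserves the pushout and the
restricted map is again a relative latching map. -/
lemma hasLiftingProperty_whiskerLeft_latchingMap_iff (δ : Ordinal.{v}) {A B : C ⥤ M} (f : A ⟶ B)
    {D : Type w} [Category.{w'} D] (K : D ⥤ C) {D' : Type*} [Category* D'] (K' : D' ⥤ D)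
    {X Y : D' ⥤ M} (p : X ⟶ Y) :
    HasLiftingProperty (Functor.whiskerLeft K' (S.latchingMap δ K f)) p ↔
      (latchingCocone (S.below δ) f (K' ⋙ K)).Lifts p := by
  refine LatchingCocone.IsUniversal.hasLiftingProperty_iff (LatchingCocone.isUniversal_ofSq
    (i := Functor.whiskerLeft (S.belowι δ) f) (K := K' ⋙ K)
    ((IsPushout.of_hasPushout (Functor.whiskerLeft K ((S.latching δ).map f))
      (Functor.whiskerLeft K ((S.fromLatching δ).app A))).map
        ((Functor.whiskeringLeft D' D M).obj K'))) ?_ p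
  ext1
  · exact congrArg (Functor.whiskerLeft K') (show pushout.inr _ _ ≫ S.latchingMap δ K f = _ from
      pushout.inr_desc _ _ _)
  · funext z d h
    have w : pushout.inl _ _ ≫ S.latchingMap δ K f =
      Functor.whiskerLeft K ((S.fromLatching δ).app B) := pushout.inl_desc _ _ _
    refine (Category.assoc _ _ _).trans ((congrArg (KanExtension.lanι (S.belowι δ) _ h ≫ ·)
      (congr_app w (K'.obj d))).trans ?_)
    exact KanExtension.lanι_lanAdjunction_counit (ι := S.belowι _) B (z := z) h

end

/-- An isomorphism passing through a lower degree would make an identity do so, but identities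
belong to the stratum. -/
lemma HasThroughDecomposition.inStratum_iso_hom (hS : S.HasThroughDecomposition) {x y : C}
    (hxy : S.deg x = S.deg y) (e : x ≅ y) : S.inStratum e.hom := by
  by_contra he
  obtain ⟨z, g, h, hz, fac⟩ := hS.exists_fac e.hom hxy he
  refine hS.not_inStratum g (h ≫ e.inv) hz ?_
  rw [← Category.assoc, fac, e.hom_inv_id]
  exact S.inStratum.id_mem x

/-- The automorphism group of `d` in `C`, as a subcategory of the stratum. -/
def autToStratum (hS : S.HasThroughDecomposition) {δ : Ordinal.{v}} (d : S.Stratum δ) :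
    SingleObj (Aut d.obj) ⥤ S.Stratum δ where
  obj _ := d
  map a := ⟨(autι d.obj).map a, hS.inStratum_iso_hom rfl (show Aut d.obj from a)⟩
  map_id a := Subtype.ext ((autι d.obj).map_id a)
  map_comp a b := Subtype.ext ((autι d.obj).map_comp a b)

lemma exists_autToStratum_map_eq (hS : S.HasThroughDecomposition) {δ : Ordinal.{v}}
    [IsGroupoid (S.Stratum δ)] (d : S.Stratum δ) (e : d ⟶ d) :
    ∃! a : (SingleObj.star (Aut d.obj) ⟶ SingleObj.star (Aut d.obj)),
      (autToStratum hS d).map a = e :=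
  ⟨(S.stratumι δ).mapIso (asIso e), rfl, fun _ ha =>
    Iso.ext (congrArg Subtype.val ha)⟩

/-- Restriction to an automorphism group preserves left maps, because its right adjoint preserves
objectwise `R`-maps. Conversely, lifts over the automorphism groups are equivariant and assemble
over the groupoid. -/
theorem projectiveL_stratumLatchingMap_iff [HasLimits M] [HasColimits M]
    (hS : S.HasThroughDecomposition) {R : MorphismProperty M} (hR : R.llp.rlp = R)
    {A B : C ⥤ M} (f : A ⟶ B) (δ : Ordinal.{v}) [IsGroupoid (S.Stratum δ)] :
    projectiveL R (S.Stratum δ) (S.stratumLatchingMap δ f) ↔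
      ∀ d : S.Stratum δ, projectiveL R _ (S.latchingMap δ (autι d.obj) f) := by
  have key (d : S.Stratum δ) {X Y : SingleObj (Aut d.obj) ⥤ M} (p : X ⟶ Y) :
      HasLiftingProperty (S.latchingMap δ (autι d.obj) f) p ↔
        HasLiftingProperty (Functor.whiskerLeft (autToStratum hS d) (S.stratumLatchingMap δ f)) p :=
    (S.hasLiftingProperty_latchingMap_iff δ f _ p).trans
      (hasLiftingProperty_whiskerLeft_latchingMap_iff δ f (S.stratumι δ) (autToStratum hS d) p).symm
  constructor
  · intro h d X Y p hp
    rw [key]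
    refine (((autToStratum hS d).ranAdjunction M).hasLiftingProperty_iff _ _).2 (h _ fun y => ?_)
    refine KanExtension.ran_map_app_mem hR p hp y fun _ (g : y ⟶ d) => ⟨SingleObj.star _, g,
      fun _ (g' : y ⟶ d) => ?_⟩
    obtain ⟨a, ha, ha'⟩ := exists_autToStratum_map_eq hS d (inv g ≫ g')
    refine ⟨a, ?_, fun b hb => ha' b ?_⟩
    · exact (congrArg (g ≫ ·) ha).trans (IsIso.hom_inv_id_assoc _ _)
    · exact (IsIso.eq_inv_comp g).2 hb
  · intro h X Y p hp
    refine hasLiftingProperty_of_isGroupoid _ _ fun a b sq d => ?_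
    have := (key d _).1 (h d (Functor.whiskerLeft (autToStratum hS d) p) fun _ => hp d)
    have sq' : CommSq (Functor.whiskerLeft (autToStratum hS d) a)
        (Functor.whiskerLeft (autToStratum hS d) (S.stratumLatchingMap δ f))
        (Functor.whiskerLeft (autToStratum hS d) p)
        (Functor.whiskerLeft (autToStratum hS d) b) := ⟨by
      rw [← Functor.whiskerLeft_comp, ← Functor.whiskerLeft_comp, sq.w]⟩
    refine ⟨sq'.lift.app (SingleObj.star _), fun e => ?_, ?_, ?_⟩
    · obtain ⟨a, rfl, -⟩ := exists_autToStratum_map_eq hS d e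
      exact sq'.lift.naturality a
    · exact congr_app sq'.fac_left _
    · exact congr_app sq'.fac_right _

lemma cReedyL_iff_of_isGroupoid [HasLimits M] [HasColimits M] (hS : S.HasThroughDecomposition)
    (hG : ∀ δ, IsGroupoid (S.Stratum δ)) {R : MorphismProperty M} (hR : R.llp.rlp = R)
    {A B : C ⥤ M} (f : A ⟶ B) :
    S.cReedyL R f ↔ ∀ x : C, projectiveL R _ (S.autLatchingMap x f) := by
  refine (forall_congr' fun δ => projectiveL_stratumLatchingMap_iff hS hR f δ).trans
    ⟨fun h x => h _ ⟨x, rfl⟩, fun h δ => ?_⟩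
  rintro ⟨x, rfl⟩
  exact h x

/-- No projective model structure on `M^{aut(x)}` is assumed, so acyclicity is not expressed there
by lifting. It is compared instead with that of `f_x`, which serves both the stratum and the
automorphism group. -/
theorem IsAlmostGReedy.acyclic_iff [HasLimits M] [HasColimits M] [ModelCategory M]
    (hS : S.IsAlmostGReedy)
    (hM : ∀ δ : Ordinal.{v}, HasProjectiveModelStructure (S.Stratum δ) M) {A B : C ⥤ M}
    (f : A ⟶ B) :
    S.cReedyL (fibrations M) f ↔
      ∀ x : C, acyclicProjectiveCofibrations (SingleObj (Aut x)) M (S.autLatchingMap x f) := by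
  have hS' := hS.toIsAlmostCReedy
  have h₁ := cReedyL_iff_of_isGroupoid hS'.hasThroughDecomposition hS.isGroupoid
    (R := trivialFibrations M) trivialFibrations_llp_rlp f
  constructor
  · intro h
    have h' := h
    rw [hS'.cReedyL_fibrations hM] at h'
    refine fun x => ⟨h₁.1 h'.1 x, fun d => ?_⟩
    exact (weakEquivalence_latchingMap_app_iff (S.deg x) (autι x) d
      (hS'.trivialCofibrations_latching_map_app x fun γ _ => h γ)).2 (h'.2 x)
  · intro h
    have hc := h₁.2 fun x => (h x).1
    intro δ
    induction δ using WellFoundedLT.induction with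
    | ind δ ih =>
      rw [← (hM _).acyclicProjectiveCofibrations_eq]
      refine ⟨hc δ, ?_⟩
      rintro ⟨x, rfl⟩
      have hx := hS'.trivialCofibrations_latching_map_app x fun γ hγ => ih γ hγ
      -- By induction `L_x f` is an acyclic cofibration, so either relative latching map is a weak
      -- equivalence at `x` exactly when `f_x` is.
      refine (weakEquivalence_latchingMap_app_iff (S.deg x) (S.stratumι (S.deg x)) ⟨x, rfl⟩ hx).2 ?_
      exact (weakEquivalence_latchingMap_app_iff (S.deg x) (autι x) (SingleObj.star _) hx).1
        ((h x).2 _)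

end Stratification

/-! ### The theorem -/

theorem mainTheorem8 {C : Type v} [SmallCategory C] (S : Stratification C)
    (hS : S.IsAlmostCReedy)
    {M : Type u} [Category.{v} M] [HasLimits M] [HasColimits M] [ModelCategory M]
    (hM : ∀ δ : Ordinal.{v}, HasProjectiveModelStructure (S.Stratum δ) M) :
    ∃ _ : ModelCategory (C ⥤ M),
      (∀ {A B : C ⥤ M} (f : A ⟶ B),
        (weakEquivalences (C ⥤ M) f ↔ ∀ x : C, weakEquivalences M (f.app x)) ∧
        (fibrations (C ⥤ M) f ↔ ∀ x : C, fibrations M (S.matchingMap f x)) ∧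
        (trivialFibrations (C ⥤ M) f ↔ ∀ x : C, trivialFibrations M (S.matchingMap f x)) ∧
        (cofibrations (C ⥤ M) f ↔ ∀ δ : Ordinal.{v},
          projectiveCofibrations (S.Stratum δ) M (S.stratumLatchingMap δ f)) ∧
        (trivialCofibrations (C ⥤ M) f ↔ ∀ δ : Ordinal.{v},
          acyclicProjectiveCofibrations (S.Stratum δ) M (S.stratumLatchingMap δ f))) ∧
      (S.IsAlmostGReedy → ∀ {A B : C ⥤ M} (f : A ⟶ B),
        (cofibrations (C ⥤ M) f ↔ ∀ x : C,
          projectiveCofibrations (SingleObj (Aut x)) M (S.autLatchingMap x f)) ∧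
        (trivialCofibrations (C ⥤ M) f ↔ ∀ x : C,
          acyclicProjectiveCofibrations (SingleObj (Aut x)) M (S.autLatchingMap x f))) := by
  obtain ⟨_, hW, hF, hTF, hC, hTC⟩ := hS.exists_modelCategory hM
  refine ⟨inferInstance, fun f => ⟨?_, ?_, ?_, ?_, ?_⟩, fun hG A B f => ⟨?_, ?_⟩⟩
  · rw [hW]; rfl
  · rw [hF]; rfl
  · rw [hTF]; rfl
  · rw [hC]; rfl
  · rw [hTC]
    exact forall_congr' fun δ => by rw [(hM δ).acyclicProjectiveCofibrations_eq]
  · rw [hC]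
    exact Stratification.cReedyL_iff_of_isGroupoid hS.hasThroughDecomposition hG.isGroupoid
      trivialFibrations_llp_rlp f
  · rw [hTC]
    exact hG.acyclic_iff hM f
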